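/- **Conventions.** A map of genus $g$ is a graph with at least one edge (loops and multiple edges allowed) embedded in the compact connected oriented surface of genus $g$ with simply connected faces, up to orientation-preserving homeomorphism. Equivalently, it is a triple $(\sigma,\alpha,\varphi)$ of permutations of a finite non-empty set $E$ (the half-edges) with $\varphi\alpha\sigma=1$, $\alpha$ an involution without fixed points, and $\langle\sigma,\alpha,\varphi\rangle$ transitive on $E$, up to simultaneous conjugation; the vertices, edges and faces are the cycles of $\sigma,\alpha,\varphi$ (their sets are $V$, $\mathbf E$, $F$), and $|V|-|\mathbf E|+|F|=2-2g$. Here $\sigma$ lists the half-edges leaving a vertex counterclockwise, $\alpha(e)=\bar e$ is the reversal of $e$, and the cycle of $\varphi$ through $e$ is the boundary, in counterclockwise order, of the face to the left of $e$. The origin and the end of $e$ are $e^-$ and $e^+$; $e\in f$ means that the face $f$ lies to the left of $e$; $\deg f$ is the number of $e\in f$; the corner of $e$ is the sector between $e$ and $\sigma(e)$. The graph distance is $d_{\mathbf m}$. A map is a quadrangulation if all its faces have degree $4$. Let $g\ge 0$, $k\ge 1$. All objects below are taken up to isomorphism. * $\mathbf Q^\circ_{g,k}$ is the set of triples $(\mathbf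 q,\mathbf x,D)$ where $\mathbf q$ is a bipartite quadrangulation of genus $g$, $\mathbf x=(x_1,\dots,x_k)\in V(\mathbf q)^k$, and $D=[d_1,\dots,d_k]$ is a vector of $\mathbb Z^k$ modulo addition of a common integer such that $|d_i-d_j|<d_{\mathbf q}(x_i,x_j)$ for all $i\ne j$ and $d_{\mathbf q}(x_i,x_j)+d_i-d_j\in 2\mathbb N$ for all $i,j$. * $\mathbf{LM}^\circ_{g,k}$ is the set of pairs $(\mathbf m,[\ell])$ where $\mathbf m$ is a map of genus $g$ with exactly $k$ faces, indexed as $f_1,\dots,f_k$, and $[\ell]$ is the class, up to an additive constant, of a function $\ell:V(\mathbf m)\to\mathbb Z$ with $|\ell(x)-\ell(y)|\le 1$ for adjacent $x,y$. We write $\ell(e)=\ell(e^-)$. **Tiles.** For $(\mathbf q,\mathbf x,D)\in\mathbf Q^\circ_{g,k}$ let $\ell(x)=\min_i(d_i+d_{\mathbf q}(x,x_i))$, and let $E_{1/2}$ be the set of half-edges $e$ of $\mathbf q$ with $\ell(e^+)=\ell(e^-)-1$ (exactly one of $e,\bar e$ is in $E_{1/2}$). The $D$-delayed Voronoi tile $E_i(\mathbf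 q,\mathbf x,D)$ is the set of $e\in E_{1/2}$ such that the maximal path that starts with $e$ and, on arriving at a vertex, continues with the first half-edge of $E_{1/2}$ in clockwise order, ends at $x_i$. **The construction $\Psi^\circ_{g,k}$.** Given $(\mathbf q,\mathbf x,D)$ with $\ell$ as above, the labels around a face of $\mathbf q$, read counterclockwise from a lowest one, are $l,l+1,l+2,l+1$ (simple face) or $l,l+1,l,l+1$ (confluent face). Add one edge inside each face: in a simple face, from the corner of highest label to the next corner in clockwise order; in a confluent face, between the two corners of highest label. The added edges form a map $\mathbf m$ with vertex set $V(\mathbf q)\setminus\{x_1,\dots,x_k\}$, each face of which contains exactly one source; $f_i$ is the face that contains $x_i$. Then $\Psi^\circ_{g,k}(\mathbf q,\mathbf x,D)=(\mathbf m,[\ell])$ with $\ell$ restricted to $V(\mathbf m)$. **The construction $\Phi^\circ_{g,k}$.** Given $(\mathbf m,[\ell])$, add a vertex $x_i$ inside each face $f_i$, with label $\ell(x_i)=\min_{e\in f_i}\ell(e)-1$. For $e\in f_i$ let $s(e)=x_i$ if $\ell(e)=\ell(x_i)+1$, and otherwise let $s(e)$ be the first of $\varphi(e),\varphi^2(e),\dots$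 with label $\ell(e)-1$. For each half-edge $e$ of $\mathbf m$ draw an edge from the corner of $e$ to (the corner of) $s(e)$ inside the face, without crossings, and so that, if $s(e)\ne x_i$, the part of the face to the right of the new edge, bounded by it and by the boundary of the face from $e$ to $s(e)$, does not contain $x_i$. Delete the edges of $\mathbf m$. Then $\Phi^\circ_{g,k}(\mathbf m,[\ell])=(\mathbf q,\mathbf x,D)$ with $\mathbf q$ the resulting map and $D=[\ell(x_1),\dots,\ell(x_k)]$. **Theorem.** Let $g\ge 0$ and $k\ge 1$. The constructions above define mappings $\Psi^\circ_{g,k}:\mathbf Q^\circ_{g,k}\to\mathbf{LM}^\circ_{g,k}$ and $\Phi^\circ_{g,k}:\mathbf{LM}^\circ_{g,k}\to\mathbf Q^\circ_{g,k}$, which are inverse of each other, and therefore are bijections. Moreover, if $(\mathbf m,[\ell])=\Psi^\circ_{g,k}(\mathbf q,\mathbf x,D)$, then 1. $|F(\mathbf q)|=|\mathbf E(\mathbf q)|/2=|\mathbf E(\mathbf m)|$, and $|E_i(\mathbf q,\mathbf x,D)|=\deg f_i$ for $1\le i\le k$; 2. $|V(\mathbf q)|=|V(\mathbf m)|+k$;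 3. for every $1\le i\le k$ and $d\ge 1$, $$\bigl|\{e\in E_i(\mathbf q,\mathbf x,D): d_{\mathbf q}(e^-,x_i)=d\}\bigr|=\Bigl|\Bigl\{e\in f_i:\ \ell(e)-\min_{e'\in f_i}\ell(e')+1=d\Bigr\}\Bigr|.$$ -/

import Mathlib

/-- A map on a compact connected oriented surface without boundary, given by its fatgraph
structure on the (finite, non-empty) set `E` of half-edges. The cycles of `σ` list the half-edges
going out of each vertex in counterclockwise order, `α` is the reversal of half-edges, and the
cycles of `φ` are the boundaries of the faces, the face of `e` lying to the left of `e`.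
The corner incident to `e` is the angular sector between `e` and `σ e`. -/
structure Fatgraph where
  E : Type
  finite : Finite E
  nonempty : Nonempty E
  σ : Equiv.Perm E
  α : Equiv.Perm E
  φ : Equiv.Perm E
  φ_mul_α_mul_σ : φ * α * σ = 1
  α_involutive : ∀ e, α (α e) = e
  α_ne : ∀ e, α e ≠ e
  transitive : ∀ e e' : E, ∃ π ∈ Subgroup.closure {σ, α, φ}, π e = e'

namespace Fatgraph

variable (m : Fatgraph)

/-- Vertices are cycles of `σ` (fixed points count as cycles). -/
def Vertex : Type := Quotient (Equiv.Perm.SameCycle.setoid m.σ)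

/-- (Unoriented) edges are cycles of `α`. -/
def Edge : Type := Quotient (Equiv.Perm.SameCycle.setoid m.α)

/-- Faces are cycles of `φ`. -/
def Face : Type := Quotient (Equiv.Perm.SameCycle.setoid m.φ)

/-- The origin of a half-edge. -/
def origin (e : m.E) : m.Vertex := Quotient.mk _ e

/-- The end point of a half-edge. -/
def target (e : m.E) : m.Vertex := m.origin (m.α e)

/-- The face to the left of a half-edge. -/
def face (e : m.E) : m.Face := Quotient.mk _ e

/-- The degree of a face: the number of half-edges incident to it. -/
noncomputable def faceDegree (f : m.Face) : ℕ := Nat.card {e : m.E // m.face e = f}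

/-- The genus is `g`: Euler's formula `|V| - |E| + |F| = 2 - 2g`. -/
def HasGenus (g : ℕ) : Prop :=
  (Nat.card m.Vertex : ℤ) - Nat.card m.Edge + Nat.card m.Face = 2 - 2 * (g : ℤ)

def IsQuadrangulation : Prop := ∀ f : m.Face, m.faceDegree f = 4

def IsBipartite : Prop :=
  ∃ color : m.Vertex → Bool, ∀ e : m.E, color (m.origin e) ≠ color (m.target e)

/-- The simple graph underlying a map (loops dropped, multiple edges merged). -/
def graph : SimpleGraph m.Vertex where
  Adj x y := x ≠ y ∧ ∃ e : m.E, m.origin e = x ∧ m.target e = y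
  symm := ⟨by
    rintro x y ⟨hxy, e, rfl, rfl⟩
    refine ⟨hxy.symm, m.α e, rfl, ?_⟩
    unfold target
    rw [m.α_involutive]⟩
  loopless := ⟨fun _ h => h.1 rfl⟩

/-- The graph distance of the map. -/
noncomputable def dist (x y : m.Vertex) : ℕ := m.graph.dist x y

end Fatgraph

/-- `b` is the first element of `π a, π² a, π³ a, …` which lies in `S`. -/
def IsFirstHit {X : Type} (π : Equiv.Perm X) (S : Set X) (a b : X) : Prop :=
  ∃ j : ℕ, 1 ≤ j ∧ b = (π ^ j) a ∧ b ∈ S ∧ ∀ i : ℕ, 1 ≤ i → i < j → (π ^ i) a ∉ S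

/-- A bipartite quadrangulation `q` of genus `g` with `k` sources and an admissible delay vector,
given by one of its representatives in `ℤ^k`. -/
structure DelayedQuad (g k : ℕ) where
  q : Fatgraph
  genus : q.HasGenus g
  quad : q.IsQuadrangulation
  bipartite : q.IsBipartite
  /-- The sources `x_1, …, x_k`. -/
  x : Fin k → q.Vertex
  /-- The delays `d_1, …, d_k`. -/
  d : Fin k → ℤ
  delay_lt : ∀ i j, i ≠ j → |d i - d j| < (q.dist (x i) (x j) : ℤ)
  delay_even : ∀ i j, ∃ n : ℕ, (q.dist (x i) (x j) : ℤ) + d i - d j = 2 * (n : ℤ)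

/-- A map of genus `g` with `k` faces indexed by `Fin k`, with a labeling of its vertices, which
represents its class up to an additive constant. -/
structure LabeledMap (g k : ℕ) where
  m : Fatgraph
  genus : m.HasGenus g
  /-- The indexed faces `f_1, …, f_k`. -/
  f : Fin k ≃ m.Face
  /-- The labeling. -/
  label : m.Vertex → ℤ
  label_step : ∀ e : m.E, |label (m.origin e) - label (m.target e)| ≤ 1

/-! ### The two sets of isomorphism classes -/

/-- Two quadrangulations with sources and delays are identified if there is an isomorphism of
maps (orientation preserving) that matches the sources, and if the delay vectors agree up to a
common additive constant. -/
def DelayedQuad.Iso {g k : ℕ} (Q Q' : DelayedQuad g k) : Prop :=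
  (∃ θ : Q.q.E ≃ Q'.q.E,
    (∀ e, θ (Q.q.σ e) = Q'.q.σ (θ e)) ∧
    (∀ e, θ (Q.q.α e) = Q'.q.α (θ e)) ∧
    (∀ e i, Q.q.origin e = Q.x i ↔ Q'.q.origin (θ e) = Q'.x i)) ∧
  ∃ c : ℤ, ∀ i, Q'.d i = Q.d i + c

/-- Two labeled maps with indexed faces are identified if there is an isomorphism of maps
(orientation preserving) that matches the indexed faces, and the labels up to a common additive
constant. -/
def LabeledMap.Iso {g k : ℕ} (M M' : LabeledMap g k) : Prop :=
  ∃ θ : M.m.E ≃ M'.m.E,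
    (∀ e, θ (M.m.σ e) = M'.m.σ (θ e)) ∧
    (∀ e, θ (M.m.α e) = M'.m.α (θ e)) ∧
    (∀ e i, M.m.face e = M.f i ↔ M'.m.face (θ e) = M'.f i) ∧
    ∃ c : ℤ, ∀ e, M'.label (M'.m.origin (θ e)) = M.label (M.m.origin e) + c

instance DelayedQuad.isoSetoid (g k : ℕ) : Setoid (DelayedQuad g k) where
  r := DelayedQuad.Iso
  iseqv :=
    { refl := fun Q => ⟨⟨Equiv.refl _, by simp⟩, 0, by simp⟩
      symm := by
        rintro Q Q' ⟨⟨θ, hσ, hα, hx⟩, c, hc⟩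
        refine ⟨⟨θ.symm, fun e => ?_, fun e => ?_, fun e i => ?_⟩, -c, fun i => ?_⟩
        · rw [Equiv.symm_apply_eq, hσ, Equiv.apply_symm_apply]
        · rw [Equiv.symm_apply_eq, hα, Equiv.apply_symm_apply]
        · rw [hx, Equiv.apply_symm_apply]
        · rw [hc]; ring
      trans := by
        rintro Q Q' Q'' ⟨⟨θ, hσ, hα, hx⟩, c, hc⟩ ⟨⟨θ', hσ', hα', hx'⟩, c', hc'⟩
        refine ⟨⟨θ.trans θ', fun e => ?_, fun e => ?_, fun e i => ?_⟩, c + c', fun i => ?_⟩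
        · simp [hσ, hσ']
        · simp [hα, hα']
        · rw [hx, hx', Equiv.trans_apply]
        · rw [hc', hc]; ring }

instance LabeledMap.isoSetoid (g k : ℕ) : Setoid (LabeledMap g k) where
  r := LabeledMap.Iso
  iseqv :=
    { refl := fun M => ⟨Equiv.refl _, by simp, by simp, by simp, 0, by simp⟩
      symm := by
        rintro M M' ⟨θ, hσ, hα, hf, c, hc⟩
        refine ⟨θ.symm, fun e => ?_, fun e => ?_, fun e i => ?_, -c, fun e => ?_⟩
        · rw [Equiv.symm_apply_eq, hσ, Equiv.apply_symm_apply]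
        · rw [Equiv.symm_apply_eq, hα, Equiv.apply_symm_apply]
        · rw [hf, Equiv.apply_symm_apply]
        · have h := hc (θ.symm e)
          rw [Equiv.apply_symm_apply] at h
          rw [h]; ring
      trans := by
        rintro M M' M'' ⟨θ, hσ, hα, hf, c, hc⟩ ⟨θ', hσ', hα', hf', c', hc'⟩
        refine ⟨θ.trans θ', fun e => ?_, fun e => ?_, fun e i => ?_, c + c', fun e => ?_⟩
        · simp [hσ, hσ']
        · simp [hα, hα']
        · rw [hf, hf', Equiv.trans_apply]
        · rw [Equiv.trans_apply, hc', hc]; ring }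

/-- The set `Q°_{g,k}`. -/
def QuadSet (g k : ℕ) : Type 1 := Quotient (DelayedQuad.isoSetoid g k)

/-- The set `LM°_{g,k}`. -/
def LabeledMapSet (g k : ℕ) : Type 1 := Quotient (LabeledMap.isoSetoid g k)

/-! ### Voronoi tiles and the construction `Ψ°` -/

namespace DelayedQuad

variable {g k : ℕ} (Q : DelayedQuad g k)

/-- The label `min_i (d_i + d(x, x_i))` of a vertex. -/
noncomputable def label (v : Q.q.Vertex) : ℤ :=
  ⨅ i : Fin k, (Q.d i + (Q.q.dist v (Q.x i) : ℤ))

/-- The label of a half-edge is the label of its origin. -/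
noncomputable def lab (e : Q.q.E) : ℤ := Q.label (Q.q.origin e)

/-- The orientation `E_{1/2}`: half-edges along which the label decreases by one. -/
def down : Set Q.q.E :=
  {e | Q.label (Q.q.target e) = Q.label (Q.q.origin e) - 1}

/-- One step of the path that turns left as much as possible: having arrived at the end of `e`,
take the first half-edge of `E_{1/2}` in clockwise order after the reversal of `e`. -/
def LeftStep (e e' : Q.q.E) : Prop := IsFirstHit Q.q.σ⁻¹ Q.down (Q.q.α e) e'

/-- The delayed Voronoi tile with center `x_i`: half-edges of `E_{1/2}` from which the maximal
leftmost path ends at `x_i`. -/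
def tile (i : Fin k) : Set Q.q.E :=
  {e | e ∈ Q.down ∧ ∃ e', Relation.ReflTransGen Q.LeftStep e e' ∧
    (∀ e'', ¬ Q.LeftStep e' e'') ∧ Q.q.target e' = Q.x i}

/-- `e` is the corner of lowest label of a simple face: the labels read counterclockwise from `e`
are `l, l+1, l+2, l+1`. -/
def SimpleFrom (e : Q.q.E) : Prop :=
  Q.lab (Q.q.φ e) = Q.lab e + 1 ∧ Q.lab (Q.q.φ (Q.q.φ e)) = Q.lab e + 2 ∧
    Q.lab (Q.q.φ (Q.q.φ (Q.q.φ e))) = Q.lab e + 1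

/-- `e` is a corner of lowest label of a confluent face: the labels read counterclockwise from `e`
are `l, l+1, l, l+1`. -/
def ConfluentFrom (e : Q.q.E) : Prop :=
  Q.lab (Q.q.φ e) = Q.lab e + 1 ∧ Q.lab (Q.q.φ (Q.q.φ e)) = Q.lab e ∧
    Q.lab (Q.q.φ (Q.q.φ (Q.q.φ e))) = Q.lab e + 1

/-- `Linked c c'`: the edge added inside a face of the quadrangulation joins the corners `c`
and `c'` of that face. In a simple face the added edge joins the corner of highest label to the
next one in clockwise order, in a confluent face it joins the two corners of highest label. -/
inductive Linked : Q.q.E → Q.q.E → Prop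
  | simple (e : Q.q.E) (h : Q.SimpleFrom e) : Linked (Q.q.φ (Q.q.φ e)) (Q.q.φ e)
  | simple_symm (e : Q.q.E) (h : Q.SimpleFrom e) : Linked (Q.q.φ e) (Q.q.φ (Q.q.φ e))
  | confluent (e : Q.q.E) (h : Q.ConfluentFrom e) :
      Linked (Q.q.φ e) (Q.q.φ (Q.q.φ (Q.q.φ e)))
  | confluent_symm (e : Q.q.E) (h : Q.ConfluentFrom e) :
      Linked (Q.q.φ (Q.q.φ (Q.q.φ e))) (Q.q.φ e)

/-- The corners from which an added half-edge starts. Each such corner carries exactly one added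
half-edge, which is named after the corner. -/
def added : Set Q.q.E := {c | ∃ c', Q.Linked c c'}

/-- Consider the quadrangulation together with the added edges; `Sum.inl e` is an original
half-edge and `Sum.inr c` the added half-edge starting in the corner `c`, so that
`Sum.inl c, Sum.inr c, Sum.inl (σ c)` are consecutive around their origin.
`RegionStep h h'` says that the areas directly to the left of `h` and of `h'` are the same, or are
separated by an original edge only. In the first three cases `h'` is the reversal of the
half-edge which follows `h` counterclockwise around its origin; in the last case the two
areas are the two sides of an original edge. -/
inductive RegionStep : Q.q.E ⊕ Q.q.E → Q.q.E ⊕ Q.q.E → Prop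
  | corner_empty (c : Q.q.E) (h : c ∉ Q.added) :
      RegionStep (Sum.inl c) (Sum.inl (Q.q.α (Q.q.σ c)))
  | corner_right (c c' : Q.q.E) (h : Q.Linked c c') : RegionStep (Sum.inl c) (Sum.inr c')
  | corner_left (c : Q.q.E) (h : c ∈ Q.added) :
      RegionStep (Sum.inr c) (Sum.inl (Q.q.α (Q.q.σ c)))
  | cross (e : Q.q.E) : RegionStep (Sum.inl e) (Sum.inl (Q.q.α e))

/-- The connected component of the complement of the added edges which lies to the left of the
added half-edge `c` contains the source `x_i`. -/
def SourceOnLeft (c : Q.q.E) (i : Fin k) : Prop :=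
  ∃ e : Q.q.E, Q.q.origin e = Q.x i ∧ Relation.EqvGen Q.RegionStep (Sum.inr c) (Sum.inl e)

/-- `IsPsi Q M`: the labeled map `M` is (isomorphic to) the one which the construction `Ψ°`
yields from `Q`. Its half-edges are the added ones, in the cyclic order in which they occur
around each vertex of the quadrangulation, its labels are the restriction of `label`, up to
an additive constant, and its `i`-th face is the one which contains `x_i`. -/
def IsPsi (M : LabeledMap g k) : Prop :=
  ∃ θ : M.m.E ≃ Q.added,
    (∀ e, IsFirstHit Q.q.σ Q.added (θ e) (θ (M.m.σ e))) ∧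
    (∀ e, Q.Linked (θ e) (θ (M.m.α e))) ∧
    (∀ e i, M.m.face e = M.f i ↔ Q.SourceOnLeft (θ e) i) ∧
    ∃ c : ℤ, ∀ e, M.label (M.m.origin e) = Q.label (Q.q.origin (θ e)) + c

end DelayedQuad

/-! ### The construction `Φ°` -/

namespace LabeledMap

variable {g k : ℕ} (M : LabeledMap g k)

/-- The label of a half-edge is the label of its origin. -/
def lab (e : M.m.E) : ℤ := M.label (M.m.origin e)

/-- The minimal label `min_{e ∈ f_i} l(e)` around the `i`-th face. -/
noncomputable def faceMin (i : Fin k) : ℤ :=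
  ⨅ e : {e : M.m.E // M.m.face e = M.f i}, M.lab e

/-- The label `min_{e ∈ f_i} l(e) - 1` of the vertex `x_i` added inside the `i`-th face. -/
noncomputable def sourceLabel (i : Fin k) : ℤ := M.faceMin i - 1

/-- The index of the face incident to `e`. -/
def faceIndex (e : M.m.E) : Fin k := M.f.symm (M.m.face e)

/-- `m(e) = min {m ≥ 1 : l(φ^m e) = l(e) - 1}`. -/
noncomputable def succTime (e : M.m.E) : ℕ :=
  sInf {n : ℕ | 1 ≤ n ∧ M.lab ((M.m.φ ^ n) e) = M.lab e - 1}

open Classical in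
/-- The successor of `e`: a corner of the map (`Sum.inl`) or an added vertex (`Sum.inr`). -/
noncomputable def succ (e : M.m.E) : M.m.E ⊕ Fin k :=
  if M.lab e = M.sourceLabel (M.faceIndex e) + 1 then Sum.inr (M.faceIndex e)
  else Sum.inl ((M.m.φ ^ M.succTime e) e)

/-- The corner `c` and the corners of which `c` is the successor. -/
def arrivals (c : M.m.E) : Set M.m.E := {b | b = c ∨ M.succ b = Sum.inl c}

/-- The half-edges of the new graph are `Sum.inl e`, drawn from the corner `e` to `succ e`, and
its reversal `Sum.inr e`, for all half-edges `e` of the map. `Rotation h h'` says that `h'` follows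
`h` in counterclockwise order around their common origin in the new graph, the new edges
being drawn without crossings:
* inside a corner `c` of the map one finds first `Sum.inl c`, and then the half-edges
  `Sum.inr b` with `succ b = c`, in the order in which the corners `b` are met when following
  the face from `c`; after the last of them, one enters the corner `σ c`;
* around the vertex `x_i` one finds the half-edges `Sum.inr b` with `succ b = x_i`, in the
  cyclic order in which the corners `b` are met when following the face. -/
inductive Rotation : M.m.E ⊕ M.m.E → M.m.E ⊕ M.m.E → Prop
  | out_in (c b : M.m.E) (h : IsFirstHit M.m.φ (M.arrivals c) c b) (hb : b ≠ c) :
      Rotation (Sum.inl c) (Sum.inr b)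
  | out_out (c : M.m.E) (h : IsFirstHit M.m.φ (M.arrivals c) c c) :
      Rotation (Sum.inl c) (Sum.inl (M.m.σ c))
  | in_in (c a b : M.m.E) (ha : M.succ a = Sum.inl c)
      (h : IsFirstHit M.m.φ (M.arrivals c) a b) (hb : b ≠ c) :
      Rotation (Sum.inr a) (Sum.inr b)
  | in_out (c a : M.m.E) (ha : M.succ a = Sum.inl c)
      (h : IsFirstHit M.m.φ (M.arrivals c) a c) :
      Rotation (Sum.inr a) (Sum.inl (M.m.σ c))
  | source (i : Fin k) (a b : M.m.E) (ha : M.succ a = Sum.inr i)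
      (h : IsFirstHit M.m.φ {b | M.succ b = Sum.inr i} a b) :
      Rotation (Sum.inr a) (Sum.inr b)

/-- `IsPhi M Q`: the quadrangulation with sources and delays `Q` is (isomorphic to) the one which
the construction `Φ°` yields from `M`. Its half-edges are those between corners and their
successors, its sources are the added vertices, and its delays are their labels, up to an
additive constant. -/
def IsPhi (Q : DelayedQuad g k) : Prop :=
  ∃ θ : M.m.E ⊕ M.m.E ≃ Q.q.E,
    (∀ h h', M.Rotation h h' → Q.q.σ (θ h) = θ h') ∧
    (∀ e, Q.q.α (θ (Sum.inl e)) = θ (Sum.inr e)) ∧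
    (∀ e i, M.succ e = Sum.inr i → Q.q.origin (θ (Sum.inr e)) = Q.x i) ∧
    ∃ c : ℤ, ∀ i, Q.d i = M.sourceLabel i + c

end LabeledMap

/-! Everything is read off the set `down` of descending half-edges of the quadrangulation `q`.
Labels change by exactly one along each edge (`lab_φ`), so every face has two ascents and two
descents, and the added edge joins the two corners at which the ascents end. These are exactly the
corners `c` such that `σ c` is descending (`mem_added_iff`). Hence the half-edges of `m` can be
identified with the descending half-edges of `q`, and the rotation of `m` with the first return of
`σ` to `down`. `IsAddedMap` records this identification by a map `η`, which serves both to construct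
`m` and to analyse a given `m`.

The central point is the way a face of `m` turns. Call two descending half-edges siblings if they
arrive side by side at a vertex. The face of `m` goes from a half-edge to its next sibling, and from
a half-edge to its leftmost continuation, by excursions above the label of the end point
(`run_sibling`, `run_leftStep`). So the leftmost continuation is the successor used in `Φ`, and the
faces of `m` are the tiles. Leftmost paths are geodesics (`lab_eq_of_mem_tile`), which turns labels
into distances in the last count. The genus follows by counting vertices, edges and faces.

Conversely, the arcs drawn from the corners of `m` to their successors have an explicit face
permutation, `faceNext`: each edge of `m` is surrounded by one simple or confluent face of degree
four, and there are no other faces (`faceNext_four`). Labels are 1-Lipschitz on the new graph and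
chains of successors descend to sources, so the labels are the delayed distances
(`exists_vertexLabel_eq`). Since all edges leaving a source ascend, the inequalities on the delays
are strict.

Finally, `IsPsi` and `IsPhi` are the same relation. One direction checks that `η` conjugates
`faceNext` to the face permutation of `q` (`φ_inl`, `φ_inr`), the other that the half-edges towards
successors are the descending ones. Each of the two descriptions is realised and is unique up to
isomorphism, so this single relation is the graph of two mutually inverse maps. -/

namespace Equiv.Perm

theorem apply_inv_apply {X : Type} (π : Equiv.Perm X) (x : X) : π (π⁻¹ x) = x :=
  π.apply_symm_apply x

theorem inv_apply_apply {X : Type} (π : Equiv.Perm X) (x : X) : π⁻¹ (π x) = x :=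
  π.symm_apply_apply x

theorem inv_pow_pow_apply {X : Type} (π : Equiv.Perm X) {s j : ℕ} (h : s ≤ j) (a : X) :
    (π⁻¹ ^ s) ((π ^ j) a) = (π ^ (j - s)) a := by
  obtain ⟨t, rfl⟩ : ∃ t, j = s + t := ⟨j - s, by omega⟩
  rw [pow_add, Equiv.Perm.mul_apply, ← Equiv.Perm.mul_apply, inv_pow, inv_mul_cancel]
  simp

end Equiv.Perm

/-! ### First hits along the orbits of a permutation -/

namespace IsFirstHit

variable {X : Type} {π : Equiv.Perm X} {S : Set X} {a b b' : X}

theorem mem (h : IsFirstHit π S a b) : b ∈ S := by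
  obtain ⟨j, -, -, hb, -⟩ := h
  exact hb

theorem sameCycle (h : IsFirstHit π S a b) : π.SameCycle a b := by
  obtain ⟨j, -, rfl, -, -⟩ := h
  exact ⟨j, by simp⟩

theorem unique (h : IsFirstHit π S a b) (h' : IsFirstHit π S a b') : b = b' := by
  obtain ⟨j, hj, rfl, hb, hlt⟩ := h
  obtain ⟨j', hj', rfl, hb', hlt'⟩ := h'
  rcases lt_trichotomy j j' with h | rfl | h
  · exact absurd hb (hlt' j hj h)
  · rfl
  · exact absurd hb' (hlt j' hj' h)

theorem of_apply_mem (h : π a ∈ S) : IsFirstHit π S a (π a) :=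
  ⟨1, le_rfl, by simp, h, fun i hi hi' => by omega⟩

theorem of_apply_notMem (h : π a ∉ S) (hb : IsFirstHit π S (π a) b) : IsFirstHit π S a b := by
  obtain ⟨j, hj, rfl, hb, hlt⟩ := hb
  refine ⟨j + 1, by omega, by rw [pow_succ, Equiv.Perm.mul_apply], hb, fun i hi hij => ?_⟩
  obtain ⟨i, rfl⟩ : ∃ i', i = i' + 1 := ⟨i - 1, by omega⟩
  rw [pow_succ, Equiv.Perm.mul_apply]
  rcases Nat.eq_zero_or_pos i with rfl | hi0
  · simpa using h
  · exact hlt i hi0 (by omega)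

theorem cases_apply (h : IsFirstHit π S a b) :
    (π a ∈ S ∧ b = π a) ∨ (π a ∉ S ∧ IsFirstHit π S (π a) b) := by
  obtain ⟨j, hj, rfl, hb, hlt⟩ := h
  rcases eq_or_lt_of_le hj with rfl | hj
  · left
    simpa using hb
  · right
    refine ⟨by simpa using hlt 1 le_rfl hj, j - 1, by omega, ?_, hb, fun i hi hij => ?_⟩
    · rw [← Equiv.Perm.mul_apply, ← pow_succ, Nat.sub_add_cancel (by omega)]
    · rw [← Equiv.Perm.mul_apply, ← pow_succ]
      exact hlt _ (by omega) (by omega)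

/-- Induction along the trajectory that leads to a first hit. -/
theorem induction_on {P : X → Prop} (h : IsFirstHit π S a b)
    (last : ∀ x, π x = b → P x) (step : ∀ x, π x ∉ S → P (π x) → P x) : P a := by
  obtain ⟨j, hj, rfl, hb, hlt⟩ := h
  induction j generalizing a with
  | zero => omega
  | succ j ih =>
    rcases Nat.eq_zero_or_pos j with rfl | hj0
    · exact last a (by simp)
    · have e : (π ^ (j + 1)) a = (π ^ j) (π a) := by rw [pow_succ, Equiv.Perm.mul_apply]
      refine step a (by simpa using hlt 1 le_rfl (by omega)) ?_
      rw [e] at last hb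
      refine ih hj0 last hb (fun i hi hij => ?_)
      rw [← Equiv.Perm.mul_apply, ← pow_succ]
      exact hlt _ (by omega) (by omega)

theorem inv (ha : a ∈ S) (h : IsFirstHit π S a b) : IsFirstHit π⁻¹ S b a := by
  obtain ⟨j, hj, rfl, hb, hlt⟩ := h
  refine ⟨j, hj, by simp, ha, fun i hi hij => ?_⟩
  rw [π.inv_pow_pow_apply hij.le]
  exact hlt _ (by omega) (by omega)

theorem exists_of_pow (n : ℕ) (hn : 1 ≤ n) (h : (π ^ n) a ∈ S) : ∃ b, IsFirstHit π S a b := by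
  classical
  have hex : ∃ n, 1 ≤ n ∧ (π ^ n) a ∈ S := ⟨n, hn, h⟩
  refine ⟨_, Nat.find hex, (Nat.find_spec hex).1, rfl, (Nat.find_spec hex).2, fun i hi hij => ?_⟩
  exact fun hS => Nat.find_min hex hij ⟨hi, hS⟩

theorem exists_of_sameCycle [Finite X] (h : π.SameCycle a b) (hb : b ∈ S) :
    ∃ b', IsFirstHit π S a b' := by
  obtain ⟨n, hn, -, rfl⟩ := h.exists_pow_eq''
  exact exists_of_pow n hn hb

theorem exists_of_mem [Finite X] (ha : a ∈ S) : ∃ b', IsFirstHit π S a b' :=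
  exists_of_sameCycle (Equiv.Perm.SameCycle.refl π a) ha

/-- An equivalence relation which is stable under first returns to `S` contains the
restriction to `S` of the relation of being in the same cycle. -/
theorem rel_of_sameCycle [Finite X] {R : X → X → Prop} (hR : Equivalence R)
    (hstep : ∀ x y, x ∈ S → IsFirstHit π S x y → R x y) (ha : a ∈ S) (hb : b ∈ S)
    (h : π.SameCycle a b) : R a b := by
  obtain ⟨n, -, rfl⟩ := h.exists_pow_eq'
  induction n using Nat.strong_induction_on generalizing a with
  | _ n ih =>
    rcases Nat.eq_zero_or_pos n with rfl | hn
    · exact hR.refl _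
    · obtain ⟨y, hy⟩ := exists_of_pow n hn hb
      refine hR.trans (hstep a y ha hy) ?_
      obtain ⟨j, hj, rfl, hyS, hlt⟩ := hy
      -- The first return to `S` cannot come after step `n`, which already lands in `S`.
      have hjn : j ≤ n := by
        by_contra! hlt'
        exact hlt n hn hlt' hb
      have e : (π ^ n) a = (π ^ (n - j)) ((π ^ j) a) := by
        rw [← Equiv.Perm.mul_apply, ← pow_add, Nat.sub_add_cancel hjn]
      rw [e] at hb ⊢
      exact ih (n - j) (by omega) hyS hb ⟨(n - j : ℕ), by simp⟩

end IsFirstHit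

/-! ### First-return permutations and the number of cycles -/

section FirstReturn

variable {X : Type} [Finite X] (π : Equiv.Perm X) (S : Set X)

/-- The first return is injective because its argument is the first hit of `S` by `π⁻¹` from its
value; finiteness does the rest. -/
theorem exists_firstReturn :
    ∃ r : Equiv.Perm S, ∀ x : S, IsFirstHit π S x (r x) := by
  choose f hf using fun x : S => IsFirstHit.exists_of_mem (π := π) x.2
  let r : S → S := fun x => ⟨f x, (hf x).mem⟩
  have hinj : Function.Injective r := by
    intro x y hxy
    have hxy' : f x = f y := congrArg Subtype.val hxy
    have hx := (hf x).inv x.2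
    rw [hxy'] at hx
    exact Subtype.ext (hx.unique ((hf y).inv y.2))
  exact ⟨Equiv.ofBijective r (Finite.injective_iff_bijective.mp hinj), hf⟩

end FirstReturn

section CycleCount

variable {X : Type} [Finite X] (π : Equiv.Perm X)

theorem card_sameCycle_eq_minimalPeriod (x : X) :
    Nat.card {y : X // (Quotient.mk (Equiv.Perm.SameCycle.setoid π) y) = Quotient.mk _ x} =
      Function.minimalPeriod π x := by
  classical
  have : Fintype X := Fintype.ofFinite X
  have h := MulAction.minimalPeriod_eq_card (a := π) (b := x)
  have h2 : ((π • ·) : X → X) = π := rfl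
  rw [h2] at h
  rw [h, ← Nat.card_eq_fintype_card]
  refine Nat.card_congr (Equiv.subtypeEquivRight fun y => ?_)
  rw [Quotient.eq]
  constructor
  · intro h
    obtain ⟨i, hi⟩ := Equiv.Perm.SameCycle.symm h
    exact ⟨⟨π ^ i, i, rfl⟩, hi⟩
  · rintro ⟨⟨_, i, rfl⟩, hi⟩
    exact Equiv.Perm.SameCycle.symm ⟨i, hi⟩

theorem card_eq_mul_card_cycles (n : ℕ) (h : ∀ x, Function.minimalPeriod π x = n) :
    Nat.card X = n * Nat.card (Quotient (Equiv.Perm.SameCycle.setoid π)) := by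
  classical
  have : Fintype X := Fintype.ofFinite X
  have : Fintype (Quotient (Equiv.Perm.SameCycle.setoid π)) := Fintype.ofFinite _
  rw [Nat.card_congr (Equiv.sigmaFiberEquiv (Quotient.mk (Equiv.Perm.SameCycle.setoid π))).symm,
    Nat.card_sigma]
  rw [Finset.sum_congr rfl (fun c _ => (?_ : _ = n))]
  · simp [mul_comm]
  · induction c using Quotient.inductionOn with
    | _ x => rw [card_sameCycle_eq_minimalPeriod, h]

end CycleCount

/-! ### Fatgraphs: relations between the permutations, face degrees, connectedness -/

namespace Fatgraph

variable (m : Fatgraph)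

instance : Finite m.E := m.finite

instance : Finite m.Vertex := inferInstanceAs (Finite (Quotient _))

instance : Finite m.Face := inferInstanceAs (Finite (Quotient _))

theorem φ_α_σ (e : m.E) : m.φ (m.α (m.σ e)) = e := by
  have := congrArg (fun p : Equiv.Perm m.E => p e) m.φ_mul_α_mul_σ
  simpa using this

theorem σ_φ (e : m.E) : m.σ (m.φ e) = m.α e := by
  have h := m.φ_α_σ (m.σ⁻¹ (m.α e))
  rw [Equiv.Perm.apply_inv_apply, m.α_involutive] at h
  rw [h, Equiv.Perm.apply_inv_apply]

theorem φ_eq (e : m.E) : m.φ e = m.σ⁻¹ (m.α e) := by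
  rw [← m.σ_φ, Equiv.Perm.inv_apply_apply]

theorem φ_α (e : m.E) : m.φ (m.α e) = m.σ⁻¹ e := by
  rw [m.φ_eq, m.α_involutive]

theorem inv_φ_eq (e : m.E) : m.φ⁻¹ e = m.α (m.σ e) := by
  rw [Equiv.Perm.inv_eq_iff_eq, m.φ_α_σ]

theorem origin_eq_iff {e e' : m.E} : m.origin e = m.origin e' ↔ m.σ.SameCycle e e' :=
  Quotient.eq

theorem face_eq_iff {e e' : m.E} : m.face e = m.face e' ↔ m.φ.SameCycle e e' :=
  Quotient.eq

theorem origin_surjective : Function.Surjective m.origin := Quotient.mk_surjective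

theorem face_surjective : Function.Surjective m.face := Quotient.mk_surjective

theorem origin_σ (e : m.E) : m.origin (m.σ e) = m.origin e :=
  m.origin_eq_iff.2 (Equiv.Perm.sameCycle_apply_left.2 (Equiv.Perm.SameCycle.refl _ _))

theorem origin_inv_σ (e : m.E) : m.origin (m.σ⁻¹ e) = m.origin e := by
  conv_rhs => rw [← Equiv.Perm.apply_inv_apply m.σ e, origin_σ]

theorem origin_φ (e : m.E) : m.origin (m.φ e) = m.target e := by
  rw [m.φ_eq, origin_inv_σ, target]

theorem target_α (e : m.E) : m.target (m.α e) = m.origin e := by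
  rw [target, m.α_involutive]

theorem faceDegree_face (e : m.E) : m.faceDegree (m.face e) = Function.minimalPeriod m.φ e :=
  card_sameCycle_eq_minimalPeriod m.φ e

theorem minimalPeriod_α (e : m.E) : Function.minimalPeriod m.α e = 2 := by
  have h1 : Function.IsPeriodicPt m.α 2 e := m.α_involutive e
  have h2 := h1.minimalPeriod_dvd
  rcases (Nat.dvd_prime Nat.prime_two).1 h2 with h | h
  · exact absurd (Function.minimalPeriod_eq_one_iff_isFixedPt.1 h) (m.α_ne e)
  · exact h

theorem card_eq_two_mul_card_edge : Nat.card m.E = 2 * Nat.card m.Edge :=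
  card_eq_mul_card_cycles m.α 2 m.minimalPeriod_α

theorem IsQuadrangulation.minimalPeriod {m : Fatgraph} (h : m.IsQuadrangulation) (e : m.E) :
    Function.minimalPeriod m.φ e = 4 := by
  rw [← faceDegree_face, h]

theorem IsQuadrangulation.card_eq {m : Fatgraph} (h : m.IsQuadrangulation) :
    Nat.card m.E = 4 * Nat.card m.Face :=
  card_eq_mul_card_cycles m.φ 4 h.minimalPeriod

theorem IsQuadrangulation.φ_four {m : Fatgraph} (h : m.IsQuadrangulation) (e : m.E) :
    m.φ (m.φ (m.φ (m.φ e))) = e := by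
  have := Function.iterate_minimalPeriod (f := m.φ) (x := e)
  rw [h.minimalPeriod] at this
  exact this

/-- A period that divides 4 but not 2 is 4. -/
theorem isQuadrangulation_of_φ (h4 : ∀ e, m.φ (m.φ (m.φ (m.φ e))) = e)
    (h2 : ∀ e, m.φ (m.φ e) ≠ e) : m.IsQuadrangulation := by
  intro f
  obtain ⟨e, rfl⟩ := m.face_surjective f
  rw [faceDegree_face]
  have hd : Function.minimalPeriod m.φ e ∣ 4 :=
    Function.IsPeriodicPt.minimalPeriod_dvd (show m.φ^[4] e = e from h4 e)
  have hn : ¬ Function.minimalPeriod m.φ e ∣ 2 := fun hd2 =>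
    h2 e ((Function.isPeriodicPt_iff_minimalPeriod_dvd (f := m.φ) (n := 2) (x := e)).2 hd2)
  have hle := Nat.le_of_dvd (by norm_num) hd
  interval_cases h : Function.minimalPeriod m.φ e <;> simp_all

/-- An equivalence relation on half-edges which is stable under `σ` and `α` is trivial. -/
theorem rel_of_stable {R : m.E → m.E → Prop} (hR : Equivalence R) (hσ : ∀ e, R e (m.σ e))
    (hα : ∀ e, R e (m.α e)) (e e' : m.E) : R e e' := by
  have hφ : ∀ e, R e (m.φ e) := fun e =>
    hR.trans (hα e) (by rw [← m.σ_φ e]; exact hR.symm (hσ _))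
  obtain ⟨π, hπ, rfl⟩ := m.transitive e e'
  induction hπ using Subgroup.closure_induction generalizing e with
  | mem x hx =>
    rcases hx with rfl | rfl | rfl
    exacts [hσ e, hα e, hφ e]
  | one => exact hR.refl _
  | mul x y _ _ hx hy => exact hR.trans (hy e) (hx _)
  | inv x _ hx =>
    have := hx (x⁻¹ e)
    rw [Equiv.Perm.apply_inv_apply] at this
    exact hR.symm this

theorem graph_adj_of_ne {e : m.E} (h : m.origin e ≠ m.target e) :
    m.graph.Adj (m.origin e) (m.target e) := ⟨h, e, rfl, rfl⟩

theorem graph_connected : m.graph.Connected := by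
  have : Nonempty m.Vertex := m.nonempty.map m.origin
  refine ⟨fun v w => ?_⟩
  obtain ⟨e, rfl⟩ := m.origin_surjective v
  obtain ⟨e', rfl⟩ := m.origin_surjective w
  refine m.rel_of_stable (R := fun e e' => m.graph.Reachable (m.origin e) (m.origin e'))
    ⟨fun _ => .refl _, .symm, .trans⟩ (fun e => ?_) (fun e => ?_) e e'
  · rw [origin_σ]
  · by_cases h : m.origin e = m.target e
    · exact h ▸ .refl _
    · exact (m.graph_adj_of_ne h).reachable

end Fatgraph

/-- Transitivity of the group generated by three permutations, from an equivalence relation. -/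
theorem transitive_of_rel {X : Type} (σ α φ : Equiv.Perm X)
    (h : ∀ R : X → X → Prop, Equivalence R → (∀ e, R e (σ e)) → (∀ e, R e (α e)) →
      (∀ e, R e (φ e)) → ∀ e e', R e e') (e e' : X) :
    ∃ π ∈ Subgroup.closure {σ, α, φ}, π e = e' := by
  -- Being in the same orbit of the group is itself an equivalence relation stable under the three
  -- permutations.
  refine h (fun e e' => ∃ π ∈ Subgroup.closure {σ, α, φ}, π e = e') ⟨?_, ?_, ?_⟩ ?_ ?_ ?_ e e'
  · exact fun x => ⟨1, one_mem _, rfl⟩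
  · rintro x _ ⟨π, hπ, rfl⟩
    exact ⟨π⁻¹, inv_mem hπ, by simp⟩
  · rintro x _ _ ⟨π, hπ, rfl⟩ ⟨π', hπ', rfl⟩
    exact ⟨π' * π, mul_mem hπ' hπ, rfl⟩
  · exact fun e => ⟨σ, Subgroup.subset_closure (by simp), rfl⟩
  · exact fun e => ⟨α, Subgroup.subset_closure (by simp), rfl⟩
  · exact fun e => ⟨φ, Subgroup.subset_closure (by simp), rfl⟩

/-! ### Graph distance, Lipschitz and parity estimates -/

namespace Fatgraph

variable (m : Fatgraph)

theorem dist_triangle (u v w : m.Vertex) : m.dist u w ≤ m.dist u v + m.dist v w :=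
  m.graph_connected.dist_triangle

theorem dist_comm (u v : m.Vertex) : m.dist u v = m.dist v u := SimpleGraph.dist_comm

theorem dist_self (v : m.Vertex) : m.dist v v = 0 := SimpleGraph.dist_self

theorem dist_eq_zero_iff {u v : m.Vertex} : m.dist u v = 0 ↔ u = v :=
  m.graph_connected.dist_eq_zero_iff

theorem dist_origin_target_le (e : m.E) : m.dist (m.origin e) (m.target e) ≤ 1 := by
  by_cases h : m.origin e = m.target e
  · rw [h, dist_self]
    exact zero_le_one
  · exact (SimpleGraph.dist_eq_one_iff_adj.2 (m.graph_adj_of_ne h)).le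

theorem exists_closer {v w : m.Vertex} (h : v ≠ w) :
    ∃ e, m.origin e = v ∧ m.dist (m.target e) w + 1 = m.dist v w := by
  obtain ⟨p, hp⟩ := (m.graph_connected v w).exists_walk_length_eq_dist
  cases p with
  | nil => exact absurd rfl h
  | cons hadj p =>
    rw [SimpleGraph.Walk.length_cons] at hp
    obtain ⟨-, e, rfl, rfl⟩ := hadj
    refine ⟨e, rfl, le_antisymm ?_ ?_⟩
    · rw [dist, dist, ← hp]
      exact Nat.succ_le_succ (SimpleGraph.dist_le p)
    · have h1 := m.dist_triangle (m.origin e) (m.target e) w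
      have h2 := m.dist_origin_target_le e
      omega

/-- Induction along a geodesic towards `w`. -/
theorem dist_induction {w : m.Vertex} {P : m.Vertex → Prop} (base : P w)
    (step : ∀ e, m.dist (m.target e) w + 1 = m.dist (m.origin e) w → P (m.target e) →
      P (m.origin e)) (v : m.Vertex) : P v := by
  induction hn : m.dist v w generalizing v with
  | zero =>
    rw [m.dist_eq_zero_iff.1 hn]
    exact base
  | succ n ih =>
    have hvw : v ≠ w := by
      rintro rfl
      rw [dist_self] at hn
      omega
    obtain ⟨e, rfl, he⟩ := m.exists_closer hvw
    exact step e he (ih _ (by omega))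

theorem abs_sub_le_dist {f : m.Vertex → ℤ} (hf : ∀ e, |f (m.origin e) - f (m.target e)| ≤ 1)
    (v w : m.Vertex) : |f v - f w| ≤ m.dist v w := by
  refine m.dist_induction (w := w) (P := fun v => |f v - f w| ≤ m.dist v w) (by simp)
    (fun e he ih => ?_) v
  have := hf e
  rw [abs_le] at this ih ⊢
  omega

theorem even_dist_add_sub {f : m.Vertex → ℤ}
    (hf : ∀ e, f (m.target e) = f (m.origin e) + 1 ∨ f (m.target e) = f (m.origin e) - 1)
    (v w : m.Vertex) : ((m.dist v w : ℤ) + f v - f w) % 2 = 0 := by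
  refine m.dist_induction (w := w) (P := fun v => ((m.dist v w : ℤ) + f v - f w) % 2 = 0)
    (by simp [dist_self]) (fun e he ih => ?_) v
  rcases hf e with h | h <;> omega

end Fatgraph

/-! ### Labels of a delayed quadrangulation -/

namespace DelayedQuad

variable {g k : ℕ} (Q : DelayedQuad g k)

theorem label_le (v : Q.q.Vertex) (i : Fin k) : Q.label v ≤ Q.d i + Q.q.dist v (Q.x i) :=
  ciInf_le (Set.finite_range _).bddBelow i

theorem lab_σ (e : Q.q.E) : Q.lab (Q.q.σ e) = Q.lab e := by
  rw [lab, Q.q.origin_σ, lab]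

theorem lab_inv_σ (e : Q.q.E) : Q.lab (Q.q.σ⁻¹ e) = Q.lab e := by
  rw [lab, Q.q.origin_inv_σ, lab]

theorem lab_α (e : Q.q.E) : Q.lab (Q.q.α e) = Q.lab (Q.q.φ e) := by
  rw [← Q.q.σ_φ, lab_σ]

theorem label_target (e : Q.q.E) : Q.label (Q.q.target e) = Q.lab (Q.q.φ e) := by
  rw [lab, Q.q.origin_φ]

theorem mem_down_iff {e : Q.q.E} : e ∈ Q.down ↔ Q.lab (Q.q.φ e) = Q.lab e - 1 := by
  rw [← label_target]
  rfl

theorem φ_four (e : Q.q.E) : Q.q.φ (Q.q.φ (Q.q.φ (Q.q.φ e))) = e := Q.quad.φ_four e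

theorem x_injective : Function.Injective Q.x := by
  intro i j hij
  by_contra hne
  have := Q.delay_lt i j hne
  rw [hij, Fatgraph.dist_self] at this
  exact absurd this (not_lt.2 (abs_nonneg _))

variable {Q} in
theorem LeftStep.mem_down {e e' : Q.q.E} (h : Q.LeftStep e e') : e' ∈ Q.down := IsFirstHit.mem h

variable {Q} in
theorem LeftStep.origin_eq {e e' : Q.q.E} (h : Q.LeftStep e e') :
    Q.q.origin e' = Q.q.target e := by
  rw [Fatgraph.target, Fatgraph.origin_eq_iff]
  exact (Equiv.Perm.sameCycle_inv.1 h.sameCycle).symm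

variable {Q} in
theorem leftStep_of_φ_mem_down {e : Q.q.E} (h : Q.q.φ e ∈ Q.down) :
    Q.LeftStep e (Q.q.φ e) := by
  rw [Q.q.φ_eq] at h ⊢
  exact IsFirstHit.of_apply_mem h

variable {Q} in
theorem LeftStep.lab_eq {e e' : Q.q.E} (h : Q.LeftStep e e') (he : e ∈ Q.down) :
    Q.lab e' = Q.lab e - 1 := by
  rw [lab, h.origin_eq, label_target, ← mem_down_iff]
  exact he

variable {Q} in
theorem LeftStep.mem_tile_iff {e e' : Q.q.E} {i : Fin k} (he : e ∈ Q.down)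
    (h : Q.LeftStep e e') : e ∈ Q.tile i ↔ e' ∈ Q.tile i := by
  constructor
  · rintro ⟨-, c, hc, hmax, ht⟩
    rcases hc.cases_head with rfl | ⟨e'', h1, h2⟩
    · exact absurd h (hmax _)
    · rw [IsFirstHit.unique h1 h] at h2
      exact ⟨h.mem_down, c, h2, hmax, ht⟩
  · rintro ⟨-, c, hc, hmax, ht⟩
    exact ⟨he, c, .head h hc, hmax, ht⟩

variable [NeZero k]

theorem exists_label_eq (v : Q.q.Vertex) : ∃ i, Q.label v = Q.d i + Q.q.dist v (Q.x i) := by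
  obtain ⟨i, hi⟩ := exists_eq_ciInf_of_finite (f := fun i => Q.d i + (Q.q.dist v (Q.x i) : ℤ))
  exact ⟨i, hi.symm⟩

theorem label_source (i : Fin k) : Q.label (Q.x i) = Q.d i := by
  refine le_antisymm ?_ ?_
  · simpa [Fatgraph.dist_self] using Q.label_le (Q.x i) i
  · obtain ⟨j, hj⟩ := Q.exists_label_eq (Q.x i)
    rw [hj]
    by_cases hij : i = j
    · subst hij
      simp
    · have := Q.delay_lt i j hij
      rw [abs_lt] at this
      omega

/-- A minimum of delayed distances is 1-Lipschitz. By bipartiteness and the parity condition on the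
delays, the parity of `d i + dist v (x i)` does not depend on `i` and changes along each edge, so
equality of the labels is excluded. -/
theorem lab_φ (e : Q.q.E) : Q.lab (Q.q.φ e) = Q.lab e + 1 ∨ Q.lab (Q.q.φ e) = Q.lab e - 1 := by
  obtain ⟨color, hcolor⟩ := Q.bipartite
  have hpar := Q.q.even_dist_add_sub (f := fun v => if color v then 1 else 0) (fun e => by
    have := hcolor e
    revert this
    cases color (Q.q.origin e) <;> cases color (Q.q.target e) <;> simp)
  rw [← label_target, lab]
  obtain ⟨i, hi⟩ := Q.exists_label_eq (Q.q.origin e)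
  obtain ⟨j, hj⟩ := Q.exists_label_eq (Q.q.target e)
  have h1 := Q.label_le (Q.q.target e) i
  have h2 := Q.label_le (Q.q.origin e) j
  have h3 := Q.q.dist_origin_target_le e
  have h4 := Q.q.dist_triangle (Q.q.origin e) (Q.q.target e) (Q.x j)
  have h5 := Q.q.dist_triangle (Q.q.target e) (Q.q.origin e) (Q.x i)
  rw [Q.q.dist_comm (Q.q.target e) (Q.q.origin e)] at h5
  obtain ⟨n, hn⟩ := Q.delay_even i j
  have p1 := hpar (Q.q.origin e) (Q.x i)
  have p2 := hpar (Q.q.target e) (Q.x j)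
  have p3 := hpar (Q.x i) (Q.x j)
  have := hcolor e
  revert this p1 p2 p3
  cases color (Q.q.origin e) <;> cases color (Q.q.target e) <;> cases color (Q.x i) <;>
    cases color (Q.x j) <;> simp <;> omega

theorem notMem_down_iff {e : Q.q.E} : e ∉ Q.down ↔ Q.lab (Q.q.φ e) = Q.lab e + 1 := by
  rw [mem_down_iff]
  have := Q.lab_φ e
  omega

theorem α_mem_down_iff {e : Q.q.E} : Q.q.α e ∈ Q.down ↔ e ∉ Q.down := by
  rw [mem_down_iff, notMem_down_iff, ← lab_α, Q.q.α_involutive, lab_α]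
  omega

theorem α_notMem_down_iff {e : Q.q.E} : Q.q.α e ∉ Q.down ↔ e ∈ Q.down := by
  rw [α_mem_down_iff, not_not]

/-- A descent from `x i` would lead towards another source `x j` with `dist (x i) (x j) ≤ d i - d
j`, which the strict inequality on the delays forbids. -/
theorem notMem_down_of_source {e : Q.q.E} {i : Fin k} (h : Q.q.origin e = Q.x i) :
    e ∉ Q.down := by
  intro he
  have he' : Q.label (Q.q.target e) = Q.label (Q.q.origin e) - 1 := he
  rw [h, label_source] at he'
  obtain ⟨j, hj⟩ := Q.exists_label_eq (Q.q.target e)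
  by_cases hij : i = j
  · subst hij
    omega
  · have h1 := Q.delay_lt i j hij
    have h2 := Q.q.dist_triangle (Q.q.origin e) (Q.q.target e) (Q.x j)
    have h3 := Q.q.dist_origin_target_le e
    rw [abs_lt] at h1
    rw [h] at h2 h3
    omega

/-- The first edge of a geodesic to a source that realises the minimum descends. -/
theorem exists_mem_down {v : Q.q.Vertex} (h : ∀ i, v ≠ Q.x i) :
    ∃ e ∈ Q.down, Q.q.origin e = v := by
  obtain ⟨i, hi⟩ := Q.exists_label_eq v
  obtain ⟨e, rfl, he⟩ := Q.q.exists_closer (h i)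
  refine ⟨e, ?_, rfl⟩
  by_contra hd
  rw [notMem_down_iff, ← label_target, lab] at hd
  have := Q.label_le (Q.q.target e) i
  omega

/-! ### Leftmost paths and tiles -/

variable {Q}

theorem exists_leftStep {e : Q.q.E} (h : ∀ i, Q.q.target e ≠ Q.x i) : ∃ e', Q.LeftStep e e' := by
  obtain ⟨e', he', ho⟩ := Q.exists_mem_down h
  refine IsFirstHit.exists_of_sameCycle (b := e') ?_ he'
  rw [Equiv.Perm.sameCycle_inv]
  exact Q.q.origin_eq_iff.1 ho.symm

theorem not_leftStep_of_source {e e' : Q.q.E} {i : Fin k} (h : Q.q.target e = Q.x i) :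
    ¬ Q.LeftStep e e' := fun hs =>
  Q.notMem_down_of_source (hs.origin_eq.trans h) hs.mem_down

/-- Two consecutive incoming edges with no outgoing descending edge between them have the same
leftmost continuation. -/
theorem leftStep_congr {e e' e'' : Q.q.E} (he : e ∈ Q.down)
    (h : Q.q.α e' = Q.q.σ (Q.q.α e)) : Q.LeftStep e e'' ↔ Q.LeftStep e' e'' := by
  have hσ : Q.q.σ⁻¹ (Q.q.α e') = Q.q.α e := by rw [h, Equiv.Perm.inv_apply_apply]
  have hd : Q.q.σ⁻¹ (Q.q.α e') ∉ Q.down := by rwa [hσ, α_notMem_down_iff]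
  constructor
  · intro hs
    refine IsFirstHit.of_apply_notMem hd ?_
    rw [hσ]
    exact hs
  · intro hs
    rcases IsFirstHit.cases_apply hs with h1 | h1
    · exact absurd h1.1 hd
    · rw [hσ] at h1
      exact h1.2

theorem mem_tile_of_source {e : Q.q.E} {i : Fin k} (he : e ∈ Q.down)
    (h : Q.q.target e = Q.x i) : e ∈ Q.tile i :=
  ⟨he, e, .refl, fun _ => not_leftStep_of_source h, h⟩

theorem target_of_mem_tile {e : Q.q.E} {i j : Fin k} (h : Q.q.target e = Q.x j)
    (hi : e ∈ Q.tile i) : i = j := by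
  obtain ⟨-, e', he', -, ht⟩ := hi
  rcases he'.cases_head with rfl | ⟨e'', h1, -⟩
  · exact Q.x_injective (ht.symm.trans h)
  · exact absurd h1 (not_leftStep_of_source h)

/-- Induction on descending half-edges along leftmost paths. -/
theorem down_induction {P : Q.q.E → Prop}
    (source : ∀ e ∈ Q.down, ∀ i, Q.q.target e = Q.x i → P e)
    (step : ∀ e ∈ Q.down, ∀ e', Q.LeftStep e e' → P e' → P e) {e : Q.q.E} (he : e ∈ Q.down) :
    P e := by
  -- Each step of a leftmost path lowers the label, which is bounded below.
  obtain ⟨B, hB⟩ := (Set.finite_range Q.lab).bddBelow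
  have hB' : ∀ e, B ≤ Q.lab e := fun e => hB ⟨e, rfl⟩
  induction hn : (Q.lab e - B).toNat using Nat.strong_induction_on generalizing e with
  | _ n ih =>
    by_cases h : ∃ i, Q.q.target e = Q.x i
    · obtain ⟨i, hi⟩ := h
      exact source e he i hi
    · obtain ⟨e', he'⟩ := exists_leftStep (not_exists.1 h)
      refine step e he e' he' (ih _ ?_ he'.mem_down rfl)
      have h1 := hB' e'
      have h2 := he'.lab_eq he
      omega

theorem exists_mem_tile {e : Q.q.E} (he : e ∈ Q.down) : ∃ i, e ∈ Q.tile i := by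
  refine down_induction (P := fun e => ∃ i, e ∈ Q.tile i)
    (fun e he i hi => ⟨i, mem_tile_of_source he hi⟩) (fun e he e' h ih => ?_) he
  obtain ⟨i, hi⟩ := ih
  exact ⟨i, (h.mem_tile_iff he).2 hi⟩

theorem mem_tile_unique {e : Q.q.E} {i j : Fin k} (hi : e ∈ Q.tile i) (hj : e ∈ Q.tile j) :
    i = j := by
  have he := hi.1
  revert hi hj
  refine down_induction (P := fun e => e ∈ Q.tile i → e ∈ Q.tile j → i = j)
    (fun e he l hl hi hj => ?_) (fun e he e' h ih hi hj => ?_) he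
  · rw [target_of_mem_tile hl hi, target_of_mem_tile hl hj]
  · exact ih ((h.mem_tile_iff he).1 hi) ((h.mem_tile_iff he).1 hj)

/-- Siblings have the same leftmost continuation; if they arrive at a source, both paths end there.
-/
theorem mem_tile_congr {e e' : Q.q.E} {i : Fin k} (he : e ∈ Q.down) (he' : e' ∈ Q.down)
    (h : Q.q.α e' = Q.q.σ (Q.q.α e)) : e ∈ Q.tile i ↔ e' ∈ Q.tile i := by
  have ht : Q.q.target e' = Q.q.target e := by
    rw [Fatgraph.target, h, Q.q.origin_σ, Fatgraph.target]
  by_cases hs : ∃ j, Q.q.target e = Q.x j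
  · obtain ⟨j, hj⟩ := hs
    constructor
    · intro hi
      rw [target_of_mem_tile hj hi]
      exact mem_tile_of_source he' (ht.trans hj)
    · intro hi
      rw [target_of_mem_tile (ht.trans hj) hi]
      exact mem_tile_of_source he hj
  · obtain ⟨c, hc⟩ := exists_leftStep (not_exists.1 hs)
    rw [hc.mem_tile_iff he, ((leftStep_congr he h).1 hc).mem_tile_iff he']

/-- The leftmost path from a half-edge of a tile is a geodesic to the center of the tile. -/
theorem lab_eq_of_mem_tile {e : Q.q.E} {i : Fin k} (hi : e ∈ Q.tile i) :
    Q.lab e = Q.d i + Q.q.dist (Q.q.origin e) (Q.x i) := by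
  refine le_antisymm (Q.label_le _ _) ?_
  have he := hi.1
  revert hi
  refine down_induction (P := fun e => e ∈ Q.tile i →
    Q.d i + Q.q.dist (Q.q.origin e) (Q.x i) ≤ Q.lab e)
    (fun e he l hl hi => ?_) (fun e he e' h ih hi => ?_) he
  · obtain rfl := target_of_mem_tile hl hi
    have h1 := Q.q.dist_origin_target_le e
    rw [hl] at h1
    rw [mem_down_iff, ← label_target, hl, label_source] at he
    omega
  · have h1 := ih ((h.mem_tile_iff he).1 hi)
    have h2 := h.lab_eq he
    have h3 := Q.q.dist_triangle (Q.q.origin e) (Q.q.target e) (Q.x i)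
    have h4 := Q.q.dist_origin_target_le e
    rw [h.origin_eq] at h1
    omega

/-- A further step of the leftmost path would start at label `d i`, hence at distance zero from `x
i`. -/
theorem target_eq_of_mem_tile {e : Q.q.E} {i : Fin k} (hi : e ∈ Q.tile i)
    (h : Q.lab e = Q.d i + 1) : Q.q.target e = Q.x i := by
  by_contra hne
  have hs : ∀ j, Q.q.target e ≠ Q.x j := by
    rintro j hj
    exact hne (target_of_mem_tile hj hi ▸ hj)
  obtain ⟨e', he'⟩ := exists_leftStep hs
  have h1 := lab_eq_of_mem_tile ((he'.mem_tile_iff hi.1).1 hi)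
  have h2 := he'.lab_eq hi.1
  have h3 : Q.q.dist (Q.q.origin e') (Q.x i) = 0 := by omega
  rw [Q.q.dist_eq_zero_iff, he'.origin_eq] at h3
  exact hne h3

theorem lab_gt_of_mem_tile {e : Q.q.E} {i : Fin k} (hi : e ∈ Q.tile i) :
    Q.d i + 1 ≤ Q.lab e := by
  have h1 := lab_eq_of_mem_tile hi
  rcases Nat.eq_zero_or_pos (Q.q.dist (Q.q.origin e) (Q.x i)) with h | h
  · exact absurd hi.1 (Q.notMem_down_of_source (Q.q.dist_eq_zero_iff.1 h))
  · omega

theorem lab_of_target_source {e : Q.q.E} {i : Fin k} (he : e ∈ Q.down)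
    (h : Q.q.target e = Q.x i) : Q.lab e = Q.d i + 1 := by
  rw [mem_down_iff, ← label_target, h, label_source] at he
  omega

theorem exists_down_target_eq (i : Fin k) : ∃ e ∈ Q.down, Q.q.target e = Q.x i := by
  obtain ⟨e, he⟩ := Q.q.origin_surjective (Q.x i)
  exact ⟨Q.q.α e, Q.α_mem_down_iff.2 (Q.notMem_down_of_source he), by rw [Q.q.target_α, he]⟩

end DelayedQuad

namespace DelayedQuad

/-! ### The added edges -/

variable {g k : ℕ} {Q : DelayedQuad g k}

theorem Linked.symm {c c' : Q.q.E} (h : Q.Linked c c') : Q.Linked c' c := by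
  cases h with
  | simple e h => exact .simple_symm e h
  | simple_symm e h => exact .simple e h
  | confluent e h => exact .confluent_symm e h
  | confluent_symm e h => exact .confluent e h

/-- The labels read from `c` tell which position `c` has in its face, and so determine its partner:
this is what makes the added edge unique. -/
theorem Linked.eq_iterate {c c' : Q.q.E} (h : Q.Linked c c') :
    (Q.lab (Q.q.φ c) = Q.lab c + 1 ∧ c' = Q.q.φ c) ∨
    (Q.lab (Q.q.φ c) = Q.lab c - 1 ∧ Q.lab (Q.q.φ (Q.q.φ c)) = Q.lab c ∧
      c' = Q.q.φ (Q.q.φ c)) ∨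
    (Q.lab (Q.q.φ c) = Q.lab c - 1 ∧ Q.lab (Q.q.φ (Q.q.φ c)) = Q.lab c - 2 ∧
      c' = Q.q.φ (Q.q.φ (Q.q.φ c))) := by
  cases h with
  | simple e h =>
    obtain ⟨h1, h2, h3⟩ := h
    rw [Q.φ_four]
    exact Or.inr (Or.inr ⟨by omega, by omega, rfl⟩)
  | simple_symm e h =>
    obtain ⟨h1, h2, h3⟩ := h
    exact Or.inl ⟨by omega, rfl⟩
  | confluent e h =>
    obtain ⟨h1, h2, h3⟩ := h
    exact Or.inr (Or.inl ⟨by omega, by omega, rfl⟩)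
  | confluent_symm e h =>
    obtain ⟨h1, h2, h3⟩ := h
    rw [Q.φ_four]
    exact Or.inr (Or.inl ⟨by omega, by omega, rfl⟩)

theorem Linked.unique {c c' c'' : Q.q.E} (h : Q.Linked c c') (h' : Q.Linked c c'') :
    c' = c'' := by
  rcases h.eq_iterate with ⟨h1, h2⟩ | ⟨h1, h2, h3⟩ | ⟨h1, h2, h3⟩ <;>
    rcases h'.eq_iterate with ⟨h1', h2'⟩ | ⟨h1', h2', h3'⟩ | ⟨h1', h2', h3'⟩ <;>
    first | omega | simp_all

theorem leftStep_α_σ {d : Q.q.E} (hd : d ∈ Q.down) :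
    Q.LeftStep (Q.q.α (Q.q.σ d)) d := by
  have h : Q.q.φ (Q.q.α (Q.q.σ d)) = d := Q.q.φ_α_σ d
  have := leftStep_of_φ_mem_down (e := Q.q.α (Q.q.σ d)) (by rwa [h])
  rwa [h] at this

variable (Q) in
/-- The area directly to the left of an original or added half-edge belongs to the region of
the tile `i`. -/
def InRegion (i : Fin k) : Q.q.E ⊕ Q.q.E → Prop
  | Sum.inl e => e ∈ Q.tile i ∨ Q.q.α e ∈ Q.tile i
  | Sum.inr c => Q.q.σ c ∈ Q.tile i

theorem inRegion_of_up {e : Q.q.E} {i : Fin k} (he : e ∉ Q.down) :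
    Q.InRegion i (Sum.inl e) ↔ Q.q.α e ∈ Q.tile i :=
  or_iff_right fun h => he h.1

theorem inRegion_α {e : Q.q.E} {i : Fin k} :
    Q.InRegion i (Sum.inl e) ↔ Q.InRegion i (Sum.inl (Q.q.α e)) := by
  simp only [InRegion, Q.q.α_involutive]
  exact or_comm

variable [NeZero k]

/-- Four steps of size one that add up to zero: two consecutive ascents are followed by two
descents, and the face is simple. -/
theorem linked_of_up_up {u : Q.q.E} (h1 : u ∉ Q.down) (h2 : Q.q.φ u ∉ Q.down) :
    Q.Linked (Q.q.φ u) (Q.q.φ (Q.q.φ u)) := by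
  rw [notMem_down_iff] at h1 h2
  have h3 := Q.lab_φ (Q.q.φ (Q.q.φ u))
  have h4 := Q.lab_φ (Q.q.φ (Q.q.φ (Q.q.φ u)))
  rw [Q.φ_four] at h4
  exact .simple_symm u ⟨by omega, by omega, by omega⟩

theorem linked_of_up_down_up {u : Q.q.E} (h1 : u ∉ Q.down) (h2 : Q.q.φ u ∈ Q.down)
    (h3 : Q.q.φ (Q.q.φ u) ∉ Q.down) : Q.Linked (Q.q.φ u) (Q.q.φ (Q.q.φ (Q.q.φ u))) := by
  rw [notMem_down_iff] at h1 h3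
  rw [mem_down_iff] at h2
  exact .confluent u ⟨by omega, by omega, by omega⟩

theorem φ_φ_mem_down_of_up_up {u : Q.q.E} (h1 : u ∉ Q.down) (h2 : Q.q.φ u ∉ Q.down) :
    Q.q.φ (Q.q.φ u) ∈ Q.down := by
  rw [notMem_down_iff] at h1 h2
  have h3 := Q.lab_φ (Q.q.φ (Q.q.φ u))
  have h4 := Q.lab_φ (Q.q.φ (Q.q.φ (Q.q.φ u)))
  rw [Q.φ_four] at h4
  rw [mem_down_iff]
  omega

theorem φ_φ_φ_mem_down_of_up_up {u : Q.q.E} (h1 : u ∉ Q.down) (h2 : Q.q.φ u ∉ Q.down) :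
    Q.q.φ (Q.q.φ (Q.q.φ u)) ∈ Q.down := by
  rw [notMem_down_iff] at h1 h2
  have h3 := Q.lab_φ (Q.q.φ (Q.q.φ u))
  have h4 := Q.lab_φ (Q.q.φ (Q.q.φ (Q.q.φ u)))
  rw [Q.φ_four] at h4
  rw [mem_down_iff, Q.φ_four]
  omega

theorem φ_φ_notMem_down {d : Q.q.E} (h1 : d ∈ Q.down) (h2 : Q.q.φ d ∈ Q.down) :
    Q.q.φ (Q.q.φ d) ∉ Q.down := by
  rw [mem_down_iff] at h1 h2
  have h3 := Q.lab_φ (Q.q.φ (Q.q.φ d))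
  have h4 := Q.lab_φ (Q.q.φ (Q.q.φ (Q.q.φ d)))
  rw [Q.φ_four] at h4
  rw [notMem_down_iff]
  omega

/-- In both types of faces the linked corners are those at which the two ascents end. -/
theorem φ_mem_added_iff {u : Q.q.E} : Q.q.φ u ∈ Q.added ↔ u ∉ Q.down := by
  constructor
  · rintro ⟨c', h⟩
    generalize hc : Q.q.φ u = c at h
    rw [notMem_down_iff]
    cases h with
    | simple e h =>
      obtain rfl := Q.q.φ.injective hc
      obtain ⟨h1, h2, h3⟩ := h
      omega
    | simple_symm e h =>
      obtain rfl := Q.q.φ.injective hc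
      exact h.1
    | confluent e h =>
      obtain rfl := Q.q.φ.injective hc
      exact h.1
    | confluent_symm e h =>
      obtain rfl := Q.q.φ.injective hc
      obtain ⟨h1, h2, h3⟩ := h
      omega
  · intro h
    by_cases h2 : Q.q.φ u ∈ Q.down
    · by_cases h3 : Q.q.φ (Q.q.φ u) ∈ Q.down
      · have h4 := φ_φ_notMem_down h2 h3
        have h5 := linked_of_up_up h4 (by rwa [Q.φ_four])
        rw [Q.φ_four] at h5
        exact ⟨_, h5.symm⟩
      · exact ⟨_, linked_of_up_down_up h h2 h3⟩
    · exact ⟨_, linked_of_up_up h h2⟩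

/-- For `c = φ u` one has `σ c = α u`, which descends exactly when `u` ascends. This identifies
added half-edges with descending ones. -/
theorem mem_added_iff {c : Q.q.E} : c ∈ Q.added ↔ Q.q.σ c ∈ Q.down := by
  obtain ⟨u, rfl⟩ := Q.q.φ.surjective c
  rw [φ_mem_added_iff, Q.q.σ_φ, α_mem_down_iff]

/-! ### Regions and tiles -/

theorem inRegion_of_down {e : Q.q.E} {i : Fin k} (he : e ∈ Q.down) :
    Q.InRegion i (Sum.inl e) ↔ e ∈ Q.tile i :=
  or_iff_left fun h => Q.α_mem_down_iff.1 h.1 he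

/-- Without crossing an added edge, one passes only between descending half-edges that coincide,
follow each other on a leftmost path, or are siblings. None of this changes the tile. -/
theorem RegionStep.inRegion_iff {h h' : Q.q.E ⊕ Q.q.E} (i : Fin k) (hs : Q.RegionStep h h') :
    Q.InRegion i h ↔ Q.InRegion i h' := by
  cases hs with
  | corner_empty c h =>
    rw [mem_added_iff] at h
    have hd := Q.α_mem_down_iff.2 h
    rw [inRegion_of_down hd]
    by_cases hc : c ∈ Q.down
    · rw [inRegion_of_down hc, (leftStep_α_σ hc).mem_tile_iff hd]
    · rw [inRegion_of_up hc]
      exact mem_tile_congr (Q.α_mem_down_iff.2 hc) hd (by simp only [Q.q.α_involutive])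
  | corner_right c c' h =>
    change _ ↔ Q.q.σ c' ∈ Q.tile i
    cases h with
    | simple e h =>
      obtain ⟨h1, h2, h3⟩ := h
      have u1 : e ∉ Q.down := Q.notMem_down_iff.2 h1
      have u2 : Q.q.φ e ∉ Q.down := Q.notMem_down_iff.2 (by omega)
      have d3 := φ_φ_mem_down_of_up_up u1 u2
      have d4 := φ_φ_φ_mem_down_of_up_up u1 u2
      rw [inRegion_of_down d3, (leftStep_of_φ_mem_down d4).mem_tile_iff d3, Q.q.σ_φ]
      refine (mem_tile_congr (Q.α_mem_down_iff.2 u1) d4 ?_).symm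
      rw [← Q.q.σ_φ, Q.φ_four, Q.q.α_involutive]
    | simple_symm e h =>
      obtain ⟨h1, h2, h3⟩ := h
      rw [inRegion_of_up (Q.notMem_down_iff.2 (by omega)), Q.q.σ_φ]
    | confluent e h =>
      obtain ⟨h1, h2, h3⟩ := h
      have d2 : Q.q.φ e ∈ Q.down := Q.mem_down_iff.2 (by omega)
      have u3 : Q.q.φ (Q.q.φ e) ∉ Q.down := Q.notMem_down_iff.2 (by omega)
      rw [inRegion_of_down d2, Q.q.σ_φ]
      refine (mem_tile_congr (Q.α_mem_down_iff.2 u3) d2 ?_).symm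
      rw [← Q.q.σ_φ, Q.q.α_involutive]
    | confluent_symm e h =>
      obtain ⟨h1, h2, h3⟩ := h
      have u1 : e ∉ Q.down := Q.notMem_down_iff.2 h1
      have d4 : Q.q.φ (Q.q.φ (Q.q.φ e)) ∈ Q.down := Q.mem_down_iff.2 (by rw [Q.φ_four]; omega)
      rw [inRegion_of_down d4, Q.q.σ_φ]
      refine (mem_tile_congr (Q.α_mem_down_iff.2 u1) d4 ?_).symm
      rw [← Q.q.σ_φ, Q.φ_four, Q.q.α_involutive]
  | corner_left c h =>
    rw [mem_added_iff] at h
    rw [← inRegion_α, inRegion_of_down h]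
    rfl
  | cross e => exact inRegion_α

theorem inRegion_iff_of_eqvGen {h h' : Q.q.E ⊕ Q.q.E} (i : Fin k)
    (hs : Relation.EqvGen Q.RegionStep h h') : Q.InRegion i h ↔ Q.InRegion i h' := by
  induction hs with
  | rel _ _ h => exact h.inRegion_iff i
  | refl _ => exact Iff.rfl
  | symm _ _ _ ih => exact ih.symm
  | trans _ _ _ _ _ ih ih' => exact ih.trans ih'

theorem eqvGen_of_σ_up {e : Q.q.E} (h : Q.q.σ e ∉ Q.down) :
    Relation.EqvGen Q.RegionStep (Sum.inl (Q.q.σ e)) (Sum.inl e) :=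
  .trans _ _ _ (.rel _ _ (.cross _))
    (.symm _ _ (.rel _ _ (.corner_empty e (by rwa [mem_added_iff]))))

/-- Between `α e` and `e'`, turning clockwise, only ascending half-edges are passed, and the corners
just before them carry no added edge. -/
theorem LeftStep.eqvGen {e e' : Q.q.E} (he : e ∈ Q.down) (h : Q.LeftStep e e') :
    Relation.EqvGen Q.RegionStep (Sum.inl e) (Sum.inl e') := by
  refine .trans _ _ _ (.rel _ _ (.cross e)) ?_
  have key : Q.q.α e ∉ Q.down →
      Relation.EqvGen Q.RegionStep (Sum.inl (Q.q.α e)) (Sum.inl e') := by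
    refine IsFirstHit.induction_on (P := fun x => x ∉ Q.down →
      Relation.EqvGen Q.RegionStep (Sum.inl x) (Sum.inl e')) h (fun x hx hd => ?_)
      (fun x hx ih hd => ?_)
    · rw [← hx]
      have := eqvGen_of_σ_up (e := Q.q.σ⁻¹ x) (by rwa [Equiv.Perm.apply_inv_apply])
      rwa [Equiv.Perm.apply_inv_apply] at this
    · have := eqvGen_of_σ_up (e := Q.q.σ⁻¹ x) (by rwa [Equiv.Perm.apply_inv_apply])
      rw [Equiv.Perm.apply_inv_apply] at this
      exact .trans _ _ _ this (ih hx)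
  exact key (Q.α_notMem_down_iff.2 he)

theorem exists_eqvGen_source {e : Q.q.E} {i : Fin k} (hi : e ∈ Q.tile i) :
    ∃ e', Q.q.origin e' = Q.x i ∧ Relation.EqvGen Q.RegionStep (Sum.inl e) (Sum.inl e') := by
  have he := hi.1
  revert hi
  refine down_induction (P := fun e => e ∈ Q.tile i → ∃ e', Q.q.origin e' = Q.x i ∧
    Relation.EqvGen Q.RegionStep (Sum.inl e) (Sum.inl e'))
    (fun e he l hl hi => ?_) (fun e he e' h ih hi => ?_) he
  · obtain rfl := target_of_mem_tile hl hi
    exact ⟨Q.q.α e, hl, .rel _ _ (.cross e)⟩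
  · obtain ⟨c, hc, hc'⟩ := ih ((h.mem_tile_iff he).1 hi)
    exact ⟨c, hc, .trans _ _ _ (h.eqvGen he) hc'⟩

/-- The tile is an invariant of the region, and conversely the leftmost path from `σ c` reaches the
source inside the region. -/
theorem sourceOnLeft_iff {c : Q.q.E} (hc : c ∈ Q.added) (i : Fin k) :
    Q.SourceOnLeft c i ↔ Q.q.σ c ∈ Q.tile i := by
  constructor
  · rintro ⟨e, he, h⟩
    refine (inRegion_iff_of_eqvGen i h).2 ?_
    have hd := Q.notMem_down_of_source he
    rw [inRegion_of_up hd]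
    exact mem_tile_of_source (Q.α_mem_down_iff.2 hd) (by rw [Q.q.target_α, he])
  · intro h
    obtain ⟨e, he, h'⟩ := exists_eqvGen_source h
    refine ⟨e, he, .trans _ _ _ (.rel _ _ (.corner_left c hc)) (.trans _ _ _ ?_ h')⟩
    exact .symm _ _ (.rel _ _ (.cross _))

end DelayedQuad

/-! ### Excursions above a level -/

/-- `b` is reached from `a` by iterating `π` at least once, and `f` takes values above `l` on the
elements met strictly between them. -/
def RunAbove {X : Type} (π : Equiv.Perm X) (f : X → ℤ) (l : ℤ) (a b : X) : Prop :=
  ∃ n : ℕ, 1 ≤ n ∧ b = (π ^ n) a ∧ ∀ i : ℕ, 1 ≤ i → i < n → l < f ((π ^ i) a)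

namespace RunAbove

variable {X : Type} {π : Equiv.Perm X} {f : X → ℤ} {l l' : ℤ} {a b c : X}

theorem single (a : X) : RunAbove π f l a (π a) :=
  ⟨1, le_rfl, by simp, fun i hi hi' => by omega⟩

theorem mono (h : RunAbove π f l a b) (hl : l' ≤ l) : RunAbove π f l' a b := by
  obtain ⟨n, hn, rfl, hlt⟩ := h
  exact ⟨n, hn, rfl, fun i hi hin => hl.trans_lt (hlt i hi hin)⟩

theorem trans (h : RunAbove π f l a b) (hb : l < f b) (h' : RunAbove π f l b c) :
    RunAbove π f l a c := by
  obtain ⟨n, hn, rfl, hlt⟩ := h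
  obtain ⟨n', hn', rfl, hlt'⟩ := h'
  refine ⟨n' + n, by omega, by rw [pow_add, Equiv.Perm.mul_apply], fun i hi hin => ?_⟩
  rcases lt_trichotomy i n with h | rfl | h
  · exact hlt i hi h
  · exact hb
  · have := hlt' (i - n) (by omega) (by omega)
    rwa [← Equiv.Perm.mul_apply, ← pow_add, Nat.sub_add_cancel h.le] at this

theorem sameCycle (h : RunAbove π f l a b) : π.SameCycle a b := by
  obtain ⟨n, -, rfl, -⟩ := h
  exact ⟨n, by simp⟩

/-- A run that starts above `l` and ends at level `l` is a first hit of level `l`. -/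
theorem isFirstHit (h : RunAbove π f l a b) (hb : f b = l) :
    IsFirstHit π {x | f x = l} a b := by
  obtain ⟨n, hn, rfl, hlt⟩ := h
  exact ⟨n, hn, rfl, hb, fun i hi hin => (hlt i hi hin).ne'⟩

theorem isFirstHit_inv (h : RunAbove π f l a b) (ha : f a = l) :
    IsFirstHit π⁻¹ {x | f x = l} b a := by
  obtain ⟨n, hn, rfl, hlt⟩ := h
  refine ⟨n, hn, by simp, ha, fun i hi hin => ?_⟩
  rw [π.inv_pow_pow_apply hin.le]
  exact (hlt (n - i) (by omega) (by omega)).ne'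

/-- The element that precedes the end of a run is its start or is above the level. -/
theorem inv_apply (h : RunAbove π f l a b) : π⁻¹ b = a ∨ l < f (π⁻¹ b) := by
  obtain ⟨n, hn, rfl, hlt⟩ := h
  obtain ⟨n, rfl⟩ : ∃ t, n = t + 1 := ⟨n - 1, by omega⟩
  have e : π⁻¹ ((π ^ (n + 1)) a) = (π ^ n) a := by
    rw [pow_succ', Equiv.Perm.mul_apply, Equiv.Perm.inv_apply_apply]
  rw [e]
  rcases Nat.eq_zero_or_pos n with rfl | hn0
  · exact Or.inl rfl
  · exact Or.inr (hlt n hn0 (by omega))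

end RunAbove

/-! ### The map of added edges: its faces are the tiles -/

namespace DelayedQuad

variable {g k : ℕ}

/-- `η` identifies the type `X` with the set of descending half-edges, in such a way that the
permutations `s`, `a`, `f` become the vertex, edge and face permutations of the map formed by
the added edges, the descending half-edge `σ c` standing for the added half-edge `c`. -/
structure IsAddedMap (Q : DelayedQuad g k) {X : Type} (s a f : Equiv.Perm X) (η : X → Q.q.E) :
    Prop where
  inj : Function.Injective η
  mem : ∀ x, η x ∈ Q.down
  surj : ∀ e ∈ Q.down, ∃ x, η x = e
  mul : ∀ x, f (a (s x)) = x
  invol : ∀ x, a (a x) = x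
  hit : ∀ x, IsFirstHit Q.q.σ Q.down (η x) (η (s x))
  link : ∀ x, Q.Linked (Q.q.φ (Q.q.α (η x))) (Q.q.φ (Q.q.α (η (a x))))

namespace IsAddedMap

variable {Q : DelayedQuad g k} {X : Type} {s a f : Equiv.Perm X} {η : X → Q.q.E}

theorem s_f (P : Q.IsAddedMap s a f η) (x : X) : s (f x) = a x := by
  have h := P.mul (s⁻¹ (a x))
  rw [Equiv.Perm.apply_inv_apply, P.invol] at h
  rw [h, Equiv.Perm.apply_inv_apply]

/-- Since `f = s⁻¹ a`, one crosses the added edge and then turns clockwise to the next descending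
half-edge. -/
theorem hit_f (P : Q.IsAddedMap s a f η)
    (x : X) : IsFirstHit Q.q.σ⁻¹ Q.down (η (a x)) (η (f x)) := by
  have := P.hit (f x)
  rw [P.s_f] at this
  exact this.inv (P.mem _)

theorem a_eq (P : Q.IsAddedMap s a f η)
    {x : X} {u : Q.q.E} (h : Q.Linked (Q.q.φ (Q.q.α (η x))) (Q.q.φ u)) :
    η (a x) = Q.q.α u := by
  have := Q.q.φ.injective ((P.link x).unique h)
  rw [← this, Q.q.α_involutive]

theorem lab_α (P : Q.IsAddedMap s a f η) (x : X) : Q.lab (Q.q.α (η x)) = Q.lab (η x) - 1 := by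
  rw [DelayedQuad.lab_α]
  exact Q.mem_down_iff.1 (P.mem x)

theorem η_f_of_φ_mem (P : Q.IsAddedMap s a f η)
    {x : X} {u : Q.q.E} (h : η (a x) = Q.q.α u) (hd : Q.q.φ u ∈ Q.down) :
    η (f x) = Q.q.φ u := by
  have h1 := P.hit_f x
  rw [h] at h1
  rw [Q.q.φ_eq] at hd ⊢
  exact h1.unique (IsFirstHit.of_apply_mem hd)

variable [NeZero k]

theorem up (P : Q.IsAddedMap s a f η)
    (x : X) : Q.q.α (η x) ∉ Q.down := Q.α_notMem_down_iff.2 (P.mem x)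

theorem exists_of_up (P : Q.IsAddedMap s a f η)
    {u : Q.q.E} (hu : u ∉ Q.down) : ∃ x, u = Q.q.α (η x) := by
  obtain ⟨x, hx⟩ := P.surj _ (Q.α_mem_down_iff.2 hu)
  exact ⟨x, by rw [hx, Q.q.α_involutive]⟩

theorem η_a_of_σ_mem (P : Q.IsAddedMap s a f η) {x : X} (h : Q.q.σ (Q.q.α (η x)) ∈ Q.down) :
    η (a x) = Q.q.σ (Q.q.α (η x)) := by
  have h1 : Q.q.φ (Q.q.α (Q.q.σ (Q.q.α (η x)))) = Q.q.α (η x) := Q.q.φ_α_σ _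
  have h2 := linked_of_up_up (u := Q.q.α (Q.q.σ (Q.q.α (η x)))) (Q.α_notMem_down_iff.2 h)
    (by rw [h1]; exact P.up x)
  rw [h1] at h2
  have h3 := P.a_eq (u := Q.q.α (Q.q.σ (Q.q.α (η x)))) (by rw [h1]; exact h2.symm)
  rw [h3, Q.q.α_involutive]

/-- Here `η (a x)` is `σ (α (η x))`. Turning clockwise from it, one first passes the ascending `α (η
x)` and then makes the leftmost step of `η x`. -/
theorem leftStep_of_σ_mem (P : Q.IsAddedMap s a f η) {x : X} (h : Q.q.σ (Q.q.α (η x)) ∈ Q.down) :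
    Q.LeftStep (η x) (η (f x)) := by
  have h1 := P.hit_f x
  rw [P.η_a_of_σ_mem h] at h1
  rcases h1.cases_apply with h2 | h2
  · rw [Equiv.Perm.inv_apply_apply] at h2
    exact absurd h2.1 (P.up x)
  · rw [Equiv.Perm.inv_apply_apply] at h2
    exact h2.2

/-- The next corner of the face, when the next edge that enters the same vertex is `η y`. -/
theorem f_cases (P : Q.IsAddedMap s a f η) {x y : X} (h : Q.q.α (η y) = Q.q.σ (Q.q.α (η x))) :
    f x = y ∨ (Q.lab (η (f x)) = Q.lab (η x) + 1 ∧ Q.q.φ (η (f x)) = η y) := by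
  have hux := P.up x
  have hy : Q.q.φ (η y) = Q.q.α (η x) := by
    rw [Q.q.φ_eq, h, Equiv.Perm.inv_apply_apply]
  have h3 : Q.q.φ (Q.q.φ (Q.q.φ (Q.q.α (η x)))) = η y := by
    rw [← hy, Q.φ_four]
  -- The face to the left of `η y` contains `α (η x)`; it is confluent in the first case and simple
  -- in the second.
  by_cases h1 : Q.q.φ (Q.q.α (η x)) ∈ Q.down
  · left
    have h2 : Q.q.φ (Q.q.φ (Q.q.α (η x))) ∉ Q.down := by
      intro h2
      exact φ_φ_notMem_down h1 h2 (by rw [h3]; exact P.mem y)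
    have h4 := P.a_eq (linked_of_up_down_up hux h1 h2)
    exact P.inj (by rw [P.η_f_of_φ_mem h4 (by rw [h3]; exact P.mem y), h3])
  · right
    have h4 := P.a_eq (linked_of_up_up hux h1)
    have h5 := P.η_f_of_φ_mem h4 (φ_φ_mem_down_of_up_up hux h1)
    refine ⟨?_, by rw [h5, h3]⟩
    rw [h5, Q.notMem_down_iff.1 h1, Q.notMem_down_iff.1 hux, P.lab_α]
    omega

/-- The siblings of `η z`, taken counterclockwise up to the next descending half-edge, all continue
by `η y`. The hypothesis `ih` leads from each to the next, and from the last one `f` goes directly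
to `y`. It is restricted to one label so as to fit the induction in `run_sibling`. -/
theorem run_of_leftStep_aux (P : Q.IsAddedMap s a f η) {z y : X}
    (ih : ∀ x x', Q.lab (η x) = Q.lab (η z) → Q.q.α (η x') = Q.q.σ (Q.q.α (η x)) →
      RunAbove f (fun x => Q.lab (η x)) (Q.lab (η x)) x x')
    (h : Q.LeftStep (η z) (η y)) :
    RunAbove f (fun x => Q.lab (η x)) (Q.lab (η z) - 1) z y := by
  obtain ⟨d, hd⟩ : ∃ d, IsFirstHit Q.q.σ Q.down (Q.q.α (η z)) d :=
    IsFirstHit.exists_of_sameCycle (Equiv.Perm.sameCycle_inv.1 h.sameCycle) h.mem_down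
  have key : ∀ w, Q.q.α (η z) = Q.q.α (η w) → Q.lab (η w) = Q.lab (η z) →
      Q.LeftStep (η w) (η y) → RunAbove f (fun x => Q.lab (η x)) (Q.lab (η z) - 1) w y := by
    refine IsFirstHit.induction_on (P := fun v => ∀ w, v = Q.q.α (η w) →
      Q.lab (η w) = Q.lab (η z) → Q.LeftStep (η w) (η y) →
      RunAbove f (fun x => Q.lab (η x)) (Q.lab (η z) - 1) w y) hd ?_ ?_
    · rintro _ hv w rfl hw hwy
      have h1 := P.leftStep_of_σ_mem (x := w) (by rw [hv]; exact hd.mem)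
      rw [← P.inj (h1.unique hwy)]
      exact RunAbove.single w
    · rintro _ hv IH w rfl hw hwy
      obtain ⟨w', hw'⟩ := P.exists_of_up hv
      have h1 := ih w w' hw hw'.symm
      have h2 : Q.lab (η w') = Q.lab (η z) := by
        have h3 := P.lab_α w'
        rw [← hw', lab_σ, P.lab_α] at h3
        omega
      refine (h1.mono (by omega)).trans (by simp only [h2]; omega) ?_
      exact IH w' hw' h2 ((leftStep_congr (P.mem w) hw'.symm).1 hwy)
  exact key z rfl rfl h

/-- Either `f x = y`, or `f x` lies one level higher and has `η y` as its leftmost continuation. The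
siblings needed for the latter are at the higher level, so the induction is on the distance to the
maximal label. -/
theorem run_sibling (P : Q.IsAddedMap s a f η) {x y : X} (h : Q.q.α (η y) = Q.q.σ (Q.q.α (η x))) :
    RunAbove f (fun x => Q.lab (η x)) (Q.lab (η x)) x y := by
  obtain ⟨B, hB⟩ := (Set.finite_range Q.lab).bddAbove
  have hB' : ∀ e, Q.lab e ≤ B := fun e => hB ⟨e, rfl⟩
  induction hn : (B - Q.lab (η x)).toNat using Nat.strong_induction_on generalizing x y with
  | _ n ih =>
    rcases P.f_cases h with hf | ⟨hl, hp⟩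
    · rw [← hf]
      exact RunAbove.single x
    · have hlt : Q.lab (η x) < Q.lab (η (f x)) := by omega
      refine (RunAbove.single x).trans hlt ?_
      have hstep : Q.LeftStep (η (f x)) (η y) := by
        have := leftStep_of_φ_mem_down (e := η (f x)) (by rw [hp]; exact P.mem y)
        rwa [hp] at this
      refine (P.run_of_leftStep_aux (fun w w' hw hww' => ?_) hstep).mono (by omega)
      refine ih _ ?_ hww' rfl
      have := hB' (η (f x))
      omega

theorem run_leftStep (P : Q.IsAddedMap s a f η) {z y : X} (h : Q.LeftStep (η z) (η y)) :
    RunAbove f (fun x => Q.lab (η x)) (Q.lab (η z) - 1) z y :=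
  P.run_of_leftStep_aux (fun _ _ _ h => P.run_sibling h) h

/-- `η (f x)` is the leftmost continuation of `η x`, its sibling, or a half-edge that continues by
its sibling. -/
theorem f_mem_tile_iff (P : Q.IsAddedMap s a f η)
    (x : X) (i : Fin k) : η (f x) ∈ Q.tile i ↔ η x ∈ Q.tile i := by
  by_cases h : Q.q.σ (Q.q.α (η x)) ∈ Q.down
  · exact ((P.leftStep_of_σ_mem h).mem_tile_iff (P.mem x)).symm
  · obtain ⟨y, hy⟩ := P.exists_of_up h
    rw [mem_tile_congr (P.mem x) (P.mem y) hy.symm]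
    rcases P.f_cases hy.symm with hf | ⟨-, hp⟩
    · rw [hf]
    · rw [← hp]
      exact (leftStep_of_φ_mem_down (by rw [hp]; exact P.mem y)).mem_tile_iff (P.mem _)

theorem mem_tile_iff_of_sameCycle (P : Q.IsAddedMap s a f η)
    {x y : X} (h : f.SameCycle x y) (i : Fin k) :
    η x ∈ Q.tile i ↔ η y ∈ Q.tile i := by
  have : Finite X := Finite.of_injective η P.inj
  refine IsFirstHit.rel_of_sameCycle (S := Set.univ)
    (R := fun x y => η x ∈ Q.tile i ↔ η y ∈ Q.tile i)
    ⟨fun _ => Iff.rfl, Iff.symm, Iff.trans⟩ (fun x y _ hxy => ?_) trivial trivial h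
  obtain rfl : y = f x := hxy.unique (IsFirstHit.of_apply_mem trivial)
  exact (P.f_mem_tile_iff x i).symm

/-- All half-edges leaving a source ascend, so the arriving ones form an uninterrupted chain of
siblings. -/
theorem sameCycle_of_target (P : Q.IsAddedMap s a f η)
    {x y : X} {i : Fin k} (hx : Q.q.target (η x) = Q.x i)
    (hy : Q.q.target (η y) = Q.x i) : f.SameCycle x y := by
  have h : Q.q.σ.SameCycle (Q.q.α (η x)) (Q.q.α (η y)) :=
    Q.q.origin_eq_iff.1 (hx.trans hy.symm)
  obtain ⟨n, -, hn⟩ := h.exists_pow_eq'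
  clear h
  induction n generalizing x with
  | zero =>
    obtain rfl : x = y := P.inj (Q.q.α.injective hn)
    exact .refl _ _
  | succ n ih =>
    have hup : Q.q.σ (Q.q.α (η x)) ∉ Q.down :=
      Q.notMem_down_of_source (i := i) (by rw [Q.q.origin_σ]; exact hx)
    obtain ⟨z, hz⟩ := P.exists_of_up hup
    refine (P.run_sibling hz.symm).sameCycle.trans (ih ?_ ?_)
    · rw [Fatgraph.target, ← hz, Q.q.origin_σ]
      exact hx
    · rwa [← hz, ← Equiv.Perm.mul_apply, ← pow_succ]

theorem exists_sameCycle_target (P : Q.IsAddedMap s a f η)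
    {x : X} {i : Fin k} (hi : η x ∈ Q.tile i) :
    ∃ y, f.SameCycle x y ∧ Q.q.target (η y) = Q.x i := by
  have key : ∀ x', η x = η x' → ∃ y, f.SameCycle x' y ∧ Q.q.target (η y) = Q.x i := by
    revert hi
    refine down_induction (P := fun e => e ∈ Q.tile i →
      ∀ x', e = η x' → ∃ y, f.SameCycle x' y ∧ Q.q.target (η y) = Q.x i)
      (fun e he j hj hi x' hx' => ?_) (fun e he e' h ih hi x' hx' => ?_) (P.mem x)
    · obtain rfl := target_of_mem_tile hj hi
      exact ⟨x', .refl _ _, hx' ▸ hj⟩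
    · obtain ⟨z, rfl⟩ := P.surj e' h.mem_down
      obtain ⟨y, hy, hy'⟩ := ih ((h.mem_tile_iff he).1 hi) z rfl
      subst hx'
      exact ⟨y, (P.run_leftStep h).sameCycle.trans hy, hy'⟩
  exact key x rfl

theorem sameCycle_of_mem_tile (P : Q.IsAddedMap s a f η) {x y : X} {i : Fin k} (hx : η x ∈ Q.tile i)
    (hy : η y ∈ Q.tile i) : f.SameCycle x y := by
  obtain ⟨x', h1, h2⟩ := P.exists_sameCycle_target hx
  obtain ⟨y', h3, h4⟩ := P.exists_sameCycle_target hy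
  exact (h1.trans (P.sameCycle_of_target h2 h4)).trans h3.symm

/-- Connectedness is inherited from `q`. Each half-edge of `q` is represented by the element of `X`
that stands for it or for its reversal, and a turn by `σ` changes this element by `s`, by `a`, or
within a cycle of `f`. -/
theorem rel_of_stable (P : Q.IsAddedMap s a f η)
    {R : X → X → Prop} (hR : Equivalence R) (hs : ∀ x, R x (s x))
    (ha : ∀ x, R x (a x)) (hf : ∀ x, R x (f x)) (x y : X) : R x y := by
  have : Finite X := Finite.of_injective η P.inj
  have hcyc : ∀ x y, f.SameCycle x y → R x y := fun x y h =>
    IsFirstHit.rel_of_sameCycle (S := Set.univ) hR (fun x y _ hxy => by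
      rw [hxy.unique (IsFirstHit.of_apply_mem trivial)]
      exact hf x) trivial trivial h
  have hrep : ∀ e, ∃ x, η x = e ∨ η x = Q.q.α e := fun e => by
    by_cases he : e ∈ Q.down
    · obtain ⟨x, hx⟩ := P.surj e he
      exact ⟨x, Or.inl hx⟩
    · obtain ⟨x, hx⟩ := P.exists_of_up he
      exact ⟨x, Or.inr (by rw [hx, Q.q.α_involutive])⟩
  choose r hr using hrep
  have hr1 : ∀ x, r (η x) = x := fun x => by
    rcases hr (η x) with h | h
    · exact P.inj h
    · exact absurd (P.mem _) (h ▸ P.up x)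
  have hr2 : ∀ x, r (Q.q.α (η x)) = x := fun x => by
    rcases hr (Q.q.α (η x)) with h | h
    · exact absurd (P.mem _) (h ▸ P.up x)
    · exact P.inj (by rw [h, Q.q.α_involutive])
  have key := Q.q.rel_of_stable (R := fun e e' => R (r e) (r e'))
    ⟨fun _ => hR.refl _, hR.symm, hR.trans⟩ (fun e => ?_) (fun e => ?_) (η x) (η y)
  · rwa [hr1, hr1] at key
  · by_cases he : e ∈ Q.down
    · obtain ⟨x, rfl⟩ := P.surj e he
      by_cases he' : Q.q.σ (η x) ∈ Q.down
      · rw [← (P.hit x).unique (IsFirstHit.of_apply_mem he'), hr1, hr1]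
        exact hs x
      · obtain ⟨y, hy⟩ := P.exists_of_up he'
        rw [hy, hr1, hr2]
        refine hR.symm (hcyc _ _ (P.run_leftStep ?_).sameCycle)
        have := leftStep_α_σ (P.mem x)
        rwa [hy, Q.q.α_involutive] at this
    · obtain ⟨x, rfl⟩ := P.exists_of_up he
      by_cases he' : Q.q.σ (Q.q.α (η x)) ∈ Q.down
      · rw [← P.η_a_of_σ_mem he', hr1, hr2]
        exact ha x
      · obtain ⟨y, hy⟩ := P.exists_of_up he'
        rw [hy, hr2, hr2]
        exact hcyc _ _ (P.run_sibling hy.symm).sameCycle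
  · by_cases he : e ∈ Q.down
    · obtain ⟨x, rfl⟩ := P.surj e he
      rw [hr1, hr2]
      exact hR.refl _
    · obtain ⟨x, rfl⟩ := P.exists_of_up he
      rw [Q.q.α_involutive, hr1, hr2]
      exact hR.refl _

end IsAddedMap

end DelayedQuad

/-! ### Excursions of labels with steps of size at most one -/

namespace RunAbove

variable {X : Type} {π : Equiv.Perm X} {f : X → ℤ} {l : ℤ} {a b : X}

theorem inv (h : RunAbove π⁻¹ f l a b) : RunAbove π f l b a := by
  obtain ⟨n, hn, rfl, hlt⟩ := h
  refine ⟨n, hn, by simp, fun i hi hin => ?_⟩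
  have e := Equiv.Perm.inv_pow_pow_apply π⁻¹ hin.le a
  rw [inv_inv] at e
  rw [e]
  exact hlt (n - i) (by omega) (by omega)

theorem tail (h : RunAbove π f l a b) : π a = b ∨ (l < f (π a) ∧ RunAbove π f l (π a) b) := by
  obtain ⟨n, hn, rfl, hlt⟩ := h
  rcases eq_or_lt_of_le hn with rfl | hn
  · exact Or.inl (by simp)
  · refine Or.inr ⟨by simpa using hlt 1 le_rfl hn, n - 1, by omega, ?_, fun i hi hin => ?_⟩
    · rw [← Equiv.Perm.mul_apply, ← pow_succ, Nat.sub_add_cancel (by omega)]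
    · rw [← Equiv.Perm.mul_apply, ← pow_succ]
      exact hlt _ (by omega) (by omega)

/-- Discrete intermediate value theorem along a cycle. -/
theorem exists_of_sameCycle [Finite X] (hf : ∀ x, |f (π x) - f x| ≤ 1) (ha : l < f a)
    (h : π.SameCycle a b) (hb : f b ≤ l) : ∃ c, f c = l ∧ RunAbove π f l a c := by
  obtain ⟨c, n, hn, rfl, hc, hlt⟩ :=
    IsFirstHit.exists_of_sameCycle (S := {x | f x ≤ l}) h hb
  have hrun : RunAbove π f l a ((π ^ n) a) :=
    ⟨n, hn, rfl, fun i hi hin => not_le.1 (hlt i hi hin)⟩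
  refine ⟨_, le_antisymm hc ?_, hrun⟩
  -- Just before the hit the value is still above `l`, and one step lowers it by at most one.
  have h1 := hf (π⁻¹ ((π ^ n) a))
  rw [Equiv.Perm.apply_inv_apply, abs_le] at h1
  rcases hrun.inv_apply with h2 | h2
  · rw [h2] at h1
    omega
  · omega

end RunAbove

/-! ### Labeled maps: successors and predecessors of corners -/

namespace LabeledMap

variable {g k : ℕ} {M : LabeledMap g k}

theorem lab_σ (e : M.m.E) : M.lab (M.m.σ e) = M.lab e := by
  rw [lab, M.m.origin_σ, lab]

theorem lab_φ (e : M.m.E) : M.lab (M.m.φ e) = M.lab (M.m.α e) := by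
  rw [← M.m.σ_φ, lab_σ]

theorem lab_φ_α (e : M.m.E) : M.lab (M.m.φ (M.m.α e)) = M.lab e := by
  rw [lab_φ, M.m.α_involutive]

theorem abs_lab_φ_sub_le (e : M.m.E) : |M.lab (M.m.φ e) - M.lab e| ≤ 1 := by
  rw [lab_φ, abs_sub_comm]
  exact M.label_step e

theorem abs_lab_inv_φ_sub_le (e : M.m.E) : |M.lab (M.m.φ⁻¹ e) - M.lab e| ≤ 1 := by
  have := M.abs_lab_φ_sub_le (M.m.φ⁻¹ e)
  rwa [Equiv.Perm.apply_inv_apply, abs_sub_comm] at this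

theorem f_faceIndex (e : M.m.E) : M.f (M.faceIndex e) = M.m.face e := by
  simp [faceIndex]

theorem faceIndex_eq_iff {e : M.m.E} {i : Fin k} : M.faceIndex e = i ↔ M.m.face e = M.f i := by
  rw [faceIndex, Equiv.symm_apply_eq]

theorem faceIndex_eq_of_sameCycle {e e' : M.m.E} (h : M.m.φ.SameCycle e e') :
    M.faceIndex e = M.faceIndex e' := by
  rw [faceIndex, M.m.face_eq_iff.2 h, faceIndex]

theorem sameCycle_of_faceIndex_eq {e e' : M.m.E} (h : M.faceIndex e = M.faceIndex e') :
    M.m.φ.SameCycle e e' := by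
  rw [faceIndex_eq_iff, f_faceIndex] at h
  exact M.m.face_eq_iff.1 h

theorem faceMin_le (e : M.m.E) : M.faceMin (M.faceIndex e) ≤ M.lab e :=
  ciInf_le (f := fun e' : {e' // M.m.face e' = M.f (M.faceIndex e)} => M.lab e')
    (Set.finite_range _).bddBelow ⟨e, (f_faceIndex e).symm⟩

theorem exists_lab_eq_faceMin (i : Fin k) :
    ∃ e, M.faceIndex e = i ∧ M.lab e = M.faceMin i := by
  obtain ⟨e, he⟩ := M.m.face_surjective (M.f i)
  have : Nonempty {e : M.m.E // M.m.face e = M.f i} := ⟨⟨e, he⟩⟩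
  obtain ⟨e', he'⟩ := exists_eq_ciInf_of_finite
    (f := fun e : {e : M.m.E // M.m.face e = M.f i} => M.lab e)
  exact ⟨e', faceIndex_eq_iff.2 e'.2, he'⟩

/-! ### Successors -/

theorem succ_eq_inr_iff {e : M.m.E} {i : Fin k} :
    M.succ e = Sum.inr i ↔ M.faceIndex e = i ∧ M.lab e = M.faceMin i := by
  rw [succ, sourceLabel]
  split_ifs with h
  · rw [Sum.inr.injEq]
    constructor
    · rintro rfl
      exact ⟨rfl, by omega⟩
    · exact fun h => h.1
  · simp only [false_iff]
    rintro ⟨rfl, h'⟩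
    omega

theorem isFirstHit_succTime {e c : M.m.E}
    (h : IsFirstHit M.m.φ {x | M.lab x = M.lab e - 1} e c) :
    (M.m.φ ^ M.succTime e) e = c := by
  obtain ⟨j, hj, rfl, hb, hlt⟩ := h
  have hne : {n : ℕ | 1 ≤ n ∧ M.lab ((M.m.φ ^ n) e) = M.lab e - 1}.Nonempty := ⟨j, hj, hb⟩
  have hmem := Nat.sInf_mem hne
  have heq : M.succTime e = j := by
    refine le_antisymm (Nat.sInf_le ⟨hj, hb⟩) ?_
    by_contra! hl
    exact hlt _ hmem.1 hl hmem.2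
  rw [heq]

theorem succ_eq_inl_of_run {e c : M.m.E} (hc : M.lab c = M.lab e - 1)
    (h : RunAbove M.m.φ M.lab (M.lab e - 1) e c) : M.succ e = Sum.inl c := by
  rw [succ, if_neg, isFirstHit_succTime (h.isFirstHit hc)]
  rw [sourceLabel, faceIndex_eq_of_sameCycle h.sameCycle]
  have := M.faceMin_le c
  omega

/-- A corner above the minimum of its face descends to that minimum, hence takes the value `lab e -
1` on the way; the set in `succTime` is not empty. -/
theorem run_of_succ_eq_inl {e c : M.m.E} (h : M.succ e = Sum.inl c) :
    M.lab c = M.lab e - 1 ∧ RunAbove M.m.φ M.lab (M.lab e - 1) e c := by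
  have h1 : M.lab e ≠ M.faceMin (M.faceIndex e) := by
    intro h1
    rw [succ_eq_inr_iff.2 ⟨rfl, h1⟩] at h
    cases h
  have h2 := M.faceMin_le e
  obtain ⟨e', he', hl⟩ := M.exists_lab_eq_faceMin (M.faceIndex e)
  obtain ⟨c', hc', hrun⟩ := RunAbove.exists_of_sameCycle (l := M.lab e - 1)
    M.abs_lab_φ_sub_le (by omega) (sameCycle_of_faceIndex_eq he'.symm) (by omega)
  rw [succ_eq_inl_of_run hc' hrun, Sum.inl.injEq] at h
  exact h ▸ ⟨hc', hrun⟩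

theorem pow_succTime_of_succ_eq {e c : M.m.E} (h : M.succ e = Sum.inl c) :
    (M.m.φ ^ M.succTime e) e = c := by
  obtain ⟨h1, h2⟩ := run_of_succ_eq_inl h
  exact isFirstHit_succTime (h2.isFirstHit h1)

theorem succ_eq_φ {e : M.m.E} (h : M.lab (M.m.φ e) = M.lab e - 1) :
    M.succ e = Sum.inl (M.m.φ e) :=
  succ_eq_inl_of_run h (.single e)

theorem faceIndex_of_succ_eq {e c : M.m.E} (h : M.succ e = Sum.inl c) :
    M.faceIndex c = M.faceIndex e :=
  (faceIndex_eq_of_sameCycle (run_of_succ_eq_inl h).2.sameCycle).symm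

variable (M) in
/-- The last corner before `e`, following the face, which has the same label as `e`. -/
noncomputable def pred (e : M.m.E) : M.m.E :=
  (IsFirstHit.exists_of_mem (π := M.m.φ⁻¹) (S := {x | M.lab x = M.lab e}) (a := e) rfl).choose

theorem pred_spec (e : M.m.E) : IsFirstHit M.m.φ⁻¹ {x | M.lab x = M.lab e} e (M.pred e) :=
  (IsFirstHit.exists_of_mem (π := M.m.φ⁻¹) (S := {x | M.lab x = M.lab e}) (a := e)
    rfl).choose_spec

theorem lab_pred (e : M.m.E) : M.lab (M.pred e) = M.lab e := (pred_spec e).mem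

theorem pred_eq_of_run {b e : M.m.E} (hb : M.lab b = M.lab e)
    (h : RunAbove M.m.φ M.lab (M.lab e) b e) : M.pred e = b :=
  (pred_spec e).unique (h.isFirstHit_inv hb)

/-- Walking backwards from `e`, an excursion that starts above its level comes back to exactly that
level, at the latest at `e` itself. -/
theorem run_pred {e : M.m.E} (h : M.lab (M.m.φ⁻¹ e) ≠ M.lab e - 1) :
    RunAbove M.m.φ M.lab (M.lab e) (M.pred e) e := by
  have h1 := M.abs_lab_inv_φ_sub_le e
  rw [abs_le] at h1
  by_cases h2 : M.lab (M.m.φ⁻¹ e) = M.lab e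
  · have h3 : RunAbove M.m.φ M.lab (M.lab e) (M.m.φ⁻¹ e) e := by
      have := RunAbove.single (π := M.m.φ) (f := M.lab) (l := M.lab e) (M.m.φ⁻¹ e)
      rwa [Equiv.Perm.apply_inv_apply] at this
    rwa [pred_eq_of_run h2 h3]
  · have h3 : M.lab e < M.lab (M.m.φ⁻¹ e) := by omega
    obtain ⟨c, hc, hrun⟩ := RunAbove.exists_of_sameCycle (l := M.lab e)
      M.abs_lab_inv_φ_sub_le h3
      (Equiv.Perm.sameCycle_apply_left.2 (Equiv.Perm.SameCycle.refl M.m.φ⁻¹ e)) le_rfl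
    have h4 := ((RunAbove.single e).trans h3 hrun).inv
    rwa [pred_eq_of_run hc h4]

/-- The labels stay above `lab e` between `pred e` and `e`, so both corners see the same first
descent, or both are minimal in the face. -/
theorem succ_pred {e : M.m.E} (h : M.lab (M.m.φ⁻¹ e) ≠ M.lab e - 1) :
    M.succ (M.pred e) = M.succ e := by
  have hl := M.lab_pred e
  have hrun := run_pred h
  rcases hs : M.succ e with c | i
  · obtain ⟨h1, h2⟩ := run_of_succ_eq_inl hs
    refine succ_eq_inl_of_run (by omega) ?_
    rw [hl]
    exact (hrun.mono (by omega)).trans (by omega) h2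
  · rw [succ_eq_inr_iff] at hs ⊢
    rw [faceIndex_eq_of_sameCycle hrun.sameCycle, hl]
    exact hs

/-! ### The faces of the quadrangulation -/

variable (M) in
open Classical in
/-- The face permutation of the graph formed by the half-edges `Sum.inl e` from `e` to `succ e`
and their reversals `Sum.inr e`. -/
noncomputable def faceNext : M.m.E ⊕ M.m.E → M.m.E ⊕ M.m.E
  | Sum.inl e =>
    if M.lab (M.m.φ⁻¹ e) = M.lab e - 1 then Sum.inl ((M.m.φ ^ M.succTime e) e)
    else Sum.inr (M.pred e)
  | Sum.inr e =>
    if M.lab (M.m.α e) = M.lab e + 1 then Sum.inr (M.m.α e) else Sum.inl (M.m.φ (M.m.α e))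

theorem faceNext_inl_of_succ {e c : M.m.E} (h : M.lab (M.m.φ⁻¹ e) = M.lab e - 1)
    (hc : M.succ e = Sum.inl c) : M.faceNext (Sum.inl e) = Sum.inl c := by
  rw [faceNext, if_pos h, pow_succTime_of_succ_eq hc]

theorem exists_succ_of_lab_inv_φ {e : M.m.E} (h : M.lab (M.m.φ⁻¹ e) = M.lab e - 1) :
    ∃ c, M.succ e = Sum.inl c := by
  rcases hs : M.succ e with c | i
  · exact ⟨c, rfl⟩
  · have h1 := M.faceMin_le (M.m.φ⁻¹ e)
    rw [faceIndex_eq_of_sameCycle (e' := e) ⟨1, by simp⟩] at h1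
    rw [succ_eq_inr_iff] at hs
    rw [hs.1] at h1
    omega

theorem faceNext_inl_of_run {b e : M.m.E} (hb : M.lab b = M.lab e)
    (h : RunAbove M.m.φ M.lab (M.lab e) b e) : M.faceNext (Sum.inl e) = Sum.inr b := by
  rw [faceNext, if_neg, pred_eq_of_run hb h]
  rcases h.inv_apply with h1 | h1
  · rw [h1]
    omega
  · omega

theorem faceNext_inr_of_eq {e : M.m.E} (h : M.lab (M.m.α e) = M.lab e + 1) :
    M.faceNext (Sum.inr e) = Sum.inr (M.m.α e) := by
  rw [faceNext, if_pos h]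

theorem faceNext_inr_of_ne {e : M.m.E} (h : M.lab (M.m.α e) ≠ M.lab e + 1) :
    M.faceNext (Sum.inr e) = Sum.inl (M.m.φ (M.m.α e)) := by
  rw [faceNext, if_neg h]

/-- The face around an edge of the map along which the label increases. -/
theorem exists_simple_face {e : M.m.E} (h : M.lab (M.m.α e) = M.lab e + 1) :
    ∃ c, M.lab c = M.lab e ∧ M.faceNext (Sum.inr e) = Sum.inr (M.m.α e) ∧
      M.faceNext (Sum.inr (M.m.α e)) = Sum.inl (M.m.φ e) ∧
      M.faceNext (Sum.inl (M.m.φ e)) = Sum.inl c ∧ M.faceNext (Sum.inl c) = Sum.inr e := by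
  have h1 : M.lab (M.m.φ e) = M.lab e + 1 := by rw [lab_φ, h]
  have h2 : M.lab (M.m.φ⁻¹ (M.m.φ e)) = M.lab (M.m.φ e) - 1 := by
    rw [Equiv.Perm.inv_apply_apply]
    omega
  obtain ⟨c, hc⟩ := exists_succ_of_lab_inv_φ h2
  obtain ⟨h3, h4⟩ := run_of_succ_eq_inl hc
  have hce : M.lab c = M.lab e := by omega
  refine ⟨c, hce, faceNext_inr_of_eq h, ?_, faceNext_inl_of_succ h2 hc, ?_⟩
  · rw [faceNext_inr_of_ne, M.m.α_involutive]
    rw [M.m.α_involutive]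
    omega
  · refine faceNext_inl_of_run hce.symm ?_
    rw [hce]
    exact (RunAbove.single e).trans (by omega) (h4.mono (by omega))

theorem confluent_face {e : M.m.E} (h : M.lab (M.m.α e) = M.lab e) :
    M.faceNext (Sum.inr e) = Sum.inl (M.m.φ (M.m.α e)) ∧
      M.faceNext (Sum.inl (M.m.φ (M.m.α e))) = Sum.inr (M.m.α e) := by
  refine ⟨faceNext_inr_of_ne (by omega), faceNext_inl_of_run ?_ (.single _)⟩
  rw [lab_φ_α, h]

/-- The half-edges `Sum.inr e` and `Sum.inr (α e)` lie in a common face of degree four. -/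
theorem faceNext_four_inr (e : M.m.E) :
    M.faceNext (M.faceNext (M.faceNext (M.faceNext (Sum.inr e)))) = Sum.inr e ∧
      M.faceNext (M.faceNext (Sum.inr e)) ≠ Sum.inr e := by
  have hstep := M.abs_lab_φ_sub_le e
  rw [lab_φ, abs_le] at hstep
  rcases lt_trichotomy (M.lab (M.m.α e)) (M.lab e) with h | h | h
  · obtain ⟨c, hc, h1, h2, h3, h4⟩ := exists_simple_face (e := M.m.α e)
      (by rw [M.m.α_involutive]; omega)
    rw [M.m.α_involutive] at h1 h2
    rw [h2, h3, h4, h1]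
    exact ⟨rfl, by simp⟩
  · obtain ⟨h1, h2⟩ := confluent_face h
    obtain ⟨h3, h4⟩ := confluent_face (e := M.m.α e) (by rw [M.m.α_involutive, h])
    rw [h1, h2, h3, h4, M.m.α_involutive]
    refine ⟨rfl, fun h => M.m.α_ne e (Sum.inr.inj h)⟩
  · obtain ⟨c, hc, h1, h2, h3, h4⟩ := exists_simple_face (e := e) (by omega)
    rw [h1, h2, h3, h4]
    exact ⟨rfl, by simp⟩

/-- Every half-edge `Sum.inl e` belongs to the face of some `Sum.inr b`. -/
theorem exists_faceNext_inr_eq_inl (e : M.m.E) : ∃ b, M.faceNext (Sum.inr b) = Sum.inl e ∨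
    M.faceNext (M.faceNext (M.faceNext (Sum.inr b))) = Sum.inl e := by
  -- The corner `α (σ e)` is `φ⁻¹ e`. If it is above `e`, then `e` closes the excursion that starts
  -- at `pred e`, and is the corner `c` given by `exists_simple_face` for that edge.
  by_cases h : M.lab (M.m.α (M.m.σ e)) = M.lab (M.m.σ e) + 1
  · rw [← M.m.inv_φ_eq, lab_σ] at h
    have hrun := run_pred (e := e) (by omega)
    have hl := M.lab_pred e
    have hstep := M.abs_lab_φ_sub_le (M.pred e)
    rw [abs_le] at hstep
    refine ⟨M.pred e, Or.inr ?_⟩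
    rcases hrun.tail with h1 | ⟨h1, h2⟩
    · rw [← h1, Equiv.Perm.inv_apply_apply, h1] at h
      omega
    · obtain ⟨c, hc, h3, h4, h5, h6⟩ := exists_simple_face (e := M.pred e)
        (by rw [← lab_φ]; omega)
      rw [h3, h4, faceNext_inl_of_succ]
      · rw [Equiv.Perm.inv_apply_apply]
        omega
      · refine succ_eq_inl_of_run (by omega) (h2.mono (by omega))
  · exact ⟨M.m.σ e, Or.inl (by rw [faceNext_inr_of_ne h, M.m.φ_α_σ])⟩

theorem faceNext_four (h : M.m.E ⊕ M.m.E) :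
    M.faceNext (M.faceNext (M.faceNext (M.faceNext h))) = h := by
  rcases h with e | e
  · obtain ⟨b, hb | hb⟩ := M.exists_faceNext_inr_eq_inl e <;>
      rw [← hb, (faceNext_four_inr b).1]
  · exact (faceNext_four_inr e).1

theorem faceNext_two_ne (h : M.m.E ⊕ M.m.E) : M.faceNext (M.faceNext h) ≠ h := by
  rcases h with e | e
  · obtain ⟨b, hb | hb⟩ := M.exists_faceNext_inr_eq_inl e <;> intro h
    · refine (faceNext_four_inr b).2 ?_
      rw [← hb] at h
      have := congrArg (fun h => M.faceNext (M.faceNext (M.faceNext h))) h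
      simp only [faceNext_four] at this
      exact this
    · refine (faceNext_four_inr b).2 ?_
      rw [← hb] at h
      have := congrArg M.faceNext h
      simp only [faceNext_four] at this
      exact this
  · exact (faceNext_four_inr e).2

variable (M) in
/-- `faceNext` as a permutation. -/
noncomputable def facePerm : Equiv.Perm (M.m.E ⊕ M.m.E) where
  toFun := M.faceNext
  invFun h := M.faceNext (M.faceNext (M.faceNext h))
  left_inv := faceNext_four
  right_inv := faceNext_four

/-! ### The rotation determines the faces -/

theorem succ_eq_of_mem_arrivals {b c : M.m.E} (h : b ∈ M.arrivals c) (hb : b ≠ c) :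
    M.succ b = Sum.inl c := h.resolve_left hb

/-- The claim is `σ⁻¹ h' = h` for the new graph. Among the arrivals in a corner `c`, the one before
`b` is `pred b`, unless the label just before `b` is already that of `c`, and then `b` is the first;
the last arrival, if there is one, is `φ⁻¹ c`. -/
theorem faceNext_of_rotation {h h' : M.m.E ⊕ M.m.E} (hr : M.Rotation h h') :
    M.faceNext h'.swap = h := by
  cases hr with
  | out_in c b h hb =>
    have hs := succ_eq_of_mem_arrivals h.mem hb
    obtain ⟨h1, h2⟩ := run_of_succ_eq_inl hs
    refine faceNext_inl_of_succ ?_ hs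
    -- Otherwise `pred b` has successor `c` too. It would be an arrival between `c` and `b`, or
    -- equal to `c`, or `c` would lie on the run from `pred b` to `b`, whose labels are too high for
    -- it.
    by_contra hne
    have hp := succ_pred hne
    have hl := M.lab_pred b
    obtain ⟨n, hn, hbn, hlt⟩ := run_pred hne
    obtain ⟨j, hj, rfl, -, hlt'⟩ := h
    rcases lt_trichotomy n j with hnj | rfl | hnj
    · refine hlt' (j - n) (by omega) (by omega) ?_
      rw [← Equiv.Perm.inv_pow_pow_apply _ hnj.le, hbn, Equiv.Perm.inv_pow_pow_apply _ le_rfl, Nat.sub_self]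
      exact Or.inr (hp.trans hs)
    · rw [← (M.m.φ ^ n).injective hbn] at hl
      omega
    · have h3 := hlt (n - j) (by omega) (by omega)
      rw [← Equiv.Perm.inv_pow_pow_apply _ hnj.le, ← hbn,
        Equiv.Perm.inv_pow_pow_apply _ le_rfl, Nat.sub_self] at h3
      simp only [pow_zero, Equiv.Perm.one_apply] at h3
      omega
  | out_out c h =>
    change M.faceNext (Sum.inr (M.m.σ c)) = _
    rw [faceNext_inr_of_ne, M.m.φ_α_σ]
    rw [← M.m.inv_φ_eq, lab_σ]
    intro hl
    have hs : M.succ (M.m.φ⁻¹ c) = Sum.inl c := by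
      have := succ_eq_φ (e := M.m.φ⁻¹ c) (by rw [Equiv.Perm.apply_inv_apply]; omega)
      rwa [Equiv.Perm.apply_inv_apply] at this
    obtain ⟨j, hj, hc, -, hlt⟩ := h
    have he : M.m.φ⁻¹ c = (M.m.φ ^ (j - 1)) c := by
      rw [← Equiv.Perm.inv_pow_pow_apply _ hj, ← hc, pow_one]
    rcases eq_or_lt_of_le hj with rfl | hj
    · rw [he] at hl
      simp at hl
    · refine hlt (j - 1) (by omega) (by omega) ?_
      rw [← he]
      exact Or.inr hs
  | in_in c a b ha h hb =>
    have hs := succ_eq_of_mem_arrivals h.mem hb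
    obtain ⟨h1, n, hn, hcn, hlt⟩ := run_of_succ_eq_inl ha
    obtain ⟨h2, -⟩ := run_of_succ_eq_inl hs
    have hab : M.lab a = M.lab b := by omega
    refine faceNext_inl_of_run hab ?_
    obtain ⟨j, hj, rfl, -, hlt'⟩ := h
    -- The next arrival `b` is met before the run from `a` reaches `c`.
    have hjn : j < n := by
      rcases lt_trichotomy j n with h | rfl | h
      · exact h
      · exact absurd hcn.symm hb
      · exact absurd (Or.inl hcn.symm) (hlt' n hn h)
    refine ⟨j, hj, rfl, fun i hi hij => ?_⟩
    have h3 := hlt i hi (by omega)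
    rw [← hab]
    -- A corner at the level of `a` met before `b` would itself have successor `c`.
    refine lt_of_le_of_ne (by omega) fun h4 => hlt' i hi hij (Or.inr ?_)
    refine succ_eq_inl_of_run (by omega) ⟨n - i, by omega, ?_, fun t ht htn => ?_⟩
    · rw [← Equiv.Perm.mul_apply, ← pow_add, Nat.sub_add_cancel (by omega), hcn]
    · rw [← Equiv.Perm.mul_apply, ← pow_add, ← h4]
      exact hlt _ (by omega) (by omega)
  | in_out c a ha h =>
    change M.faceNext (Sum.inr (M.m.σ c)) = _
    obtain ⟨h1, h2⟩ := run_of_succ_eq_inl ha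
    have hac : M.m.φ⁻¹ c = a := by
      have hstep := M.abs_lab_inv_φ_sub_le c
      rw [abs_le] at hstep
      rcases h2.inv_apply with h3 | h3
      · exact h3
      · have hs : M.succ (M.m.φ⁻¹ c) = Sum.inl c := by
          have := succ_eq_φ (e := M.m.φ⁻¹ c) (by rw [Equiv.Perm.apply_inv_apply]; omega)
          rwa [Equiv.Perm.apply_inv_apply] at this
        obtain ⟨j, hj, hc, -, hlt⟩ := h
        have he : M.m.φ⁻¹ c = (M.m.φ ^ (j - 1)) a := by
          rw [← Equiv.Perm.inv_pow_pow_apply _ hj, ← hc, pow_one]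
        rcases eq_or_lt_of_le hj with rfl | hj
        · simpa using he
        · exact absurd (he ▸ Or.inr hs) (hlt (j - 1) (by omega) (by omega))
    rw [M.m.inv_φ_eq] at hac
    rw [faceNext_inr_of_eq, hac]
    rw [hac, lab_σ]
    omega
  | source i a b ha h =>
    obtain ⟨h1, h2⟩ := succ_eq_inr_iff.1 ha
    obtain ⟨h3, h4⟩ := succ_eq_inr_iff.1 h.mem
    refine faceNext_inl_of_run (by omega) ?_
    obtain ⟨j, hj, rfl, -, hlt⟩ := h
    refine ⟨j, hj, rfl, fun t ht htj => ?_⟩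
    have h5 : M.faceIndex ((M.m.φ ^ t) a) = i := by
      rw [← h1]
      exact (faceIndex_eq_of_sameCycle ⟨t, by simp⟩).symm
    have h6 := M.faceMin_le ((M.m.φ ^ t) a)
    rw [h5] at h6
    rw [h4]
    exact lt_of_le_of_ne h6 fun h7 => hlt t ht htj (succ_eq_inr_iff.2 ⟨h5, h7.symm⟩)

theorem exists_rotation (h : M.m.E ⊕ M.m.E) : ∃ h', M.Rotation h h' := by
  rcases h with c | a
  · obtain ⟨b, hb⟩ := IsFirstHit.exists_of_mem (π := M.m.φ) (S := M.arrivals c) (a := c)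
      (Or.inl rfl)
    by_cases hbc : b = c
    · subst hbc
      exact ⟨_, .out_out b hb⟩
    · exact ⟨_, .out_in c b hb hbc⟩
  · rcases hs : M.succ a with c | i
    · obtain ⟨b, hb⟩ := IsFirstHit.exists_of_mem (π := M.m.φ) (S := M.arrivals c) (a := a)
        (Or.inr hs)
      by_cases hbc : b = c
      · subst hbc
        exact ⟨_, .in_out b a hs hb⟩
      · exact ⟨_, .in_in c a b hs hb hbc⟩
    · obtain ⟨b, hb⟩ := IsFirstHit.exists_of_mem (π := M.m.φ) (S := {b | M.succ b = Sum.inr i})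
        (a := a) hs
      exact ⟨_, .source i a b hs hb⟩

end LabeledMap

theorem IsFirstHit.map {X Y : Type} {π : Equiv.Perm X} {π' : Equiv.Perm Y} {S : Set X}
    {S' : Set Y} {a b : X} (ψ : X → Y) (hψ : ∀ x, ψ (π x) = π' (ψ x))
    (hS : ∀ x, x ∈ S ↔ ψ x ∈ S') (h : IsFirstHit π S a b) : IsFirstHit π' S' (ψ a) (ψ b) := by
  have hpow : ∀ n : ℕ, ψ ((π ^ n) a) = (π' ^ n) (ψ a) := fun n => by
    induction n with
    | zero => rfl
    | succ n ih => rw [pow_succ', pow_succ', Equiv.Perm.mul_apply, hψ, ih, Equiv.Perm.mul_apply]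
  obtain ⟨j, hj, rfl, hb, hlt⟩ := h
  refine ⟨j, hj, hpow j, (hS _).1 hb, fun i hi hij => ?_⟩
  rw [← hpow, ← hS]
  exact hlt i hi hij

theorem rel_of_sameCycle_of_apply {X : Type} [Finite X] {π : Equiv.Perm X} {R : X → X → Prop}
    (hR : Equivalence R) (h : ∀ x, R x (π x)) {x y : X} (hxy : π.SameCycle x y) : R x y :=
  IsFirstHit.rel_of_sameCycle (S := Set.univ) hR (fun x y _ hxy => by
    obtain rfl : y = π x := hxy.unique (IsFirstHit.of_apply_mem trivial)
    exact h x) trivial trivial hxy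

/-! ### The graph of successors: connectedness, vertices, labels and distances -/

namespace LabeledMap

variable {g k : ℕ} {M : LabeledMap g k}

/-- Induction over the corners with successor `c`, from the first one to the last one. -/
theorem succ_induction {c : M.m.E} {P : M.m.E → Prop}
    (first : ∀ b, M.succ b = Sum.inl c → M.lab (M.m.φ⁻¹ b) = M.lab b - 1 → P b)
    (next : ∀ b, M.succ b = Sum.inl c → M.lab (M.m.φ⁻¹ b) ≠ M.lab b - 1 → P (M.pred b) → P b)
    {b : M.m.E} (hb : M.succ b = Sum.inl c) : P b := by
  have hN : 0 < orderOf M.m.φ := orderOf_pos M.m.φ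
  obtain ⟨hl, n, hn, hc, hlt⟩ := run_of_succ_eq_inl hb
  induction ht : orderOf M.m.φ - n using Nat.strong_induction_on generalizing b n with
  | _ t ih =>
    by_cases h : M.lab (M.m.φ⁻¹ b) = M.lab b - 1
    · exact first b hb h
    · obtain ⟨s, hs, hbs, hlt'⟩ := run_pred h
      have hlp := M.lab_pred b
      have hsucc := (succ_pred h).trans hb
      have hcn : c = (M.m.φ ^ (n + s)) (M.pred b) := by
        rw [pow_add, Equiv.Perm.mul_apply, ← hbs, hc]
      have hall : ∀ i, 1 ≤ i → i < n + s → M.lab (M.pred b) - 1 <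
          M.lab ((M.m.φ ^ i) (M.pred b)) := by
        intro i hi hin
        rcases lt_trichotomy i s with h | rfl | h
        · have := hlt' i hi h
          omega
        · rw [← hbs]
          omega
        · have := hlt (i - s) (by omega) (by omega)
          rw [hbs, ← Equiv.Perm.mul_apply, ← pow_add, Nat.sub_add_cancel h.le, ← hbs] at this
          omega
      -- A longer run would pass through `c`, whose label is too low, `orderOf φ` steps before its
      -- end. This bound makes the induction on the length of the run terminate.
      have hle : n + s ≤ orderOf M.m.φ := by
        by_contra! hgt
        have h1 := hall (n + s - orderOf M.m.φ) (by omega) (by omega)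
        have h2 : (M.m.φ ^ (n + s - orderOf M.m.φ)) (M.pred b) = c := by
          rw [hcn]
          conv_rhs => rw [← Nat.sub_add_cancel hgt.le, pow_add, pow_orderOf_eq_one, mul_one]
        rw [h2] at h1
        omega
      exact next b hb h (ih (orderOf M.m.φ - (n + s)) (by omega) hsucc (by omega) (n + s)
        (by omega) hcn hall rfl)

/-- Connectedness is inherited from `m`: `c` and `σ c` are linked through the arrivals between them,
`e` and `α e` through the face built around their edge. -/
theorem rel_of_faceNext_stable {R : M.m.E ⊕ M.m.E → M.m.E ⊕ M.m.E → Prop} (hR : Equivalence R)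
    (hswap : ∀ h, R h h.swap) (hnext : ∀ h, R h (M.faceNext h)) (h h' : M.m.E ⊕ M.m.E) :
    R h h' := by
  have hsucc : ∀ {b c}, M.succ b = Sum.inl c → R (Sum.inl b) (Sum.inl c) := by
    intro b c hb
    refine succ_induction (P := fun b => R (Sum.inl b) (Sum.inl c)) (fun b hb h => ?_)
      (fun b hb h ih => ?_) hb
    · rw [← faceNext_inl_of_succ h hb]
      exact hnext _
    · have h1 := hnext (Sum.inl b)
      rw [faceNext, if_neg h] at h1
      exact hR.trans h1 (hR.trans (hswap _) ih)
  have hα : ∀ e, M.lab (M.m.α e) = M.lab e + 1 → R (Sum.inr e) (Sum.inr (M.m.α e)) := by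
    intro e h
    rw [← faceNext_inr_of_eq h]
    exact hnext _
  have hinl : ∀ e e', R (Sum.inl e) (Sum.inl e') := by
    refine M.m.rel_of_stable (R := fun e e' => R (Sum.inl e) (Sum.inl e'))
      ⟨fun _ => hR.refl _, hR.symm, hR.trans⟩ (fun c => ?_) (fun e => ?_)
    · refine hR.symm (hR.trans (hswap _) (hR.trans (hnext _) ?_))
      change R (M.faceNext (Sum.inr (M.m.σ c))) _
      by_cases h : M.lab (M.m.α (M.m.σ c)) = M.lab (M.m.σ c) + 1
      · rw [faceNext_inr_of_eq h]
        refine hR.trans (hswap _) (hsucc ?_)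
        have := succ_eq_φ (e := M.m.α (M.m.σ c)) (by rw [lab_φ_α]; omega)
        rwa [M.m.φ_α_σ] at this
      · rw [faceNext_inr_of_ne h, M.m.φ_α_σ]
        exact hR.refl _
    · refine hR.trans (hswap _) (hR.trans ?_ (hswap (Sum.inr (M.m.α e))))
      change R (Sum.inr e) (Sum.inr (M.m.α e))
      have hstep := M.abs_lab_φ_sub_le e
      rw [lab_φ, abs_le] at hstep
      rcases lt_trichotomy (M.lab (M.m.α e)) (M.lab e) with h | h | h
      · have := hα (M.m.α e) (by rw [M.m.α_involutive]; omega)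
        rw [M.m.α_involutive] at this
        exact hR.symm this
      · obtain ⟨h1, h2⟩ := confluent_face h
        have h3 := hnext (Sum.inr e)
        have h4 := hnext (M.faceNext (Sum.inr e))
        rw [h1, h2] at h4
        rw [h1] at h3
        exact hR.trans h3 h4
      · exact hα e (by omega)
  rcases h with e | e <;> rcases h' with e' | e'
  · exact hinl e e'
  · exact hR.trans (hinl e e') (hswap _)
  · exact hR.trans (hswap _) (hinl e e')
  · exact hR.trans (hswap _) (hR.trans (hinl e e') (hswap _))

variable (M) in
/-- The graph formed by the edges between corners and their successors. -/
noncomputable def succGraph : Fatgraph where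
  E := M.m.E ⊕ M.m.E
  finite := inferInstance
  nonempty := M.m.nonempty.map Sum.inl
  -- The only rotation compatible with `φ α σ = 1`.
  σ := Equiv.sumComm _ _ * M.facePerm⁻¹
  α := Equiv.sumComm _ _
  φ := M.facePerm
  φ_mul_α_mul_σ := by
    ext h : 1
    simp [Equiv.Perm.mul_apply]
  α_involutive := by simp
  α_ne := by rintro (e | e) <;> simp
  transitive := transitive_of_rel _ _ _ fun R hR _ hα hφ => rel_of_faceNext_stable hR hα hφ

variable (M) in
/-- The origin of a half-edge of the graph of successors: a vertex of the map, or the source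
added in one of its faces. -/
noncomputable def vertexOf : M.m.E ⊕ M.m.E → M.m.Vertex ⊕ Fin k
  | Sum.inl e => Sum.inl (M.m.origin e)
  | Sum.inr e => (M.succ e).map M.m.origin id

theorem vertexOf_inr_of_succ {e c : M.m.E} (h : M.succ e = Sum.inl c) :
    M.vertexOf (Sum.inr e) = Sum.inl (M.m.origin c) := by
  rw [vertexOf, h, Sum.map_inl]

theorem vertexOf_inr_of_source {e : M.m.E} {i : Fin k} (h : M.succ e = Sum.inr i) :
    M.vertexOf (Sum.inr e) = Sum.inr i := by
  rw [vertexOf, h, Sum.map_inr, id]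

theorem succ_eq_of_vertexOf {h : M.m.E ⊕ M.m.E} {i : Fin k} (hi : M.vertexOf h = Sum.inr i) :
    ∃ e, h = Sum.inr e ∧ M.succ e = Sum.inr i := by
  rcases h with e | e
  · cases hi
  · refine ⟨e, rfl, ?_⟩
    rcases hs : M.succ e with c | j
    · rw [vertexOf_inr_of_succ hs] at hi
      cases hi
    · rw [vertexOf_inr_of_source hs] at hi
      rw [Sum.inr.inj hi]

theorem vertexOf_faceNext (h : M.m.E ⊕ M.m.E) :
    M.vertexOf (M.faceNext h) = M.vertexOf h.swap := by
  rcases h with e | e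
  · by_cases h : M.lab (M.m.φ⁻¹ e) = M.lab e - 1
    · obtain ⟨c, hc⟩ := exists_succ_of_lab_inv_φ h
      rw [faceNext_inl_of_succ h hc, Sum.swap_inl, vertexOf_inr_of_succ hc, vertexOf]
    · rw [faceNext, if_neg h, Sum.swap_inl, vertexOf, vertexOf, succ_pred h]
  · have h0 : M.m.origin (M.m.φ (M.m.α e)) = M.m.origin e := by
      rw [M.m.origin_φ, M.m.target_α]
    by_cases h : M.lab (M.m.α e) = M.lab e + 1
    · rw [faceNext_inr_of_eq h, vertexOf_inr_of_succ (succ_eq_φ (by rw [lab_φ_α]; omega)), h0]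
      rfl
    · rw [faceNext_inr_of_ne h, Sum.swap_inr, vertexOf, vertexOf, h0]

variable (M) in
/-- `θ` identifies `q` with the graph of successors of `M`. -/
structure IsSuccGraph (q : Fatgraph) (θ : M.m.E ⊕ M.m.E ≃ q.E) : Prop where
  φ_apply : ∀ h, q.φ (θ h) = θ (M.faceNext h)
  α_apply : ∀ h, q.α (θ h) = θ h.swap

theorem isSuccGraph_succGraph : M.IsSuccGraph M.succGraph (Equiv.refl _) :=
  ⟨fun _ => rfl, fun _ => rfl⟩

variable (M) in
/-- The label of a vertex of the map or of an added source. -/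
noncomputable def sumLabel : M.m.Vertex ⊕ Fin k → ℤ := Sum.elim M.label M.sourceLabel

theorem sumLabel_vertexOf_inl (e : M.m.E) : M.sumLabel (M.vertexOf (Sum.inl e)) = M.lab e := rfl

theorem sumLabel_vertexOf_inr (e : M.m.E) :
    M.sumLabel (M.vertexOf (Sum.inr e)) = M.lab e - 1 := by
  rcases hs : M.succ e with c | i
  · rw [vertexOf_inr_of_succ hs, ← (run_of_succ_eq_inl hs).1]
    rfl
  · rw [vertexOf_inr_of_source hs, (succ_eq_inr_iff.1 hs).2]
    rfl

namespace IsSuccGraph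

variable {q : Fatgraph} {θ : M.m.E ⊕ M.m.E ≃ q.E}

theorem inv_σ_apply (H : M.IsSuccGraph q θ) (h : M.m.E ⊕ M.m.E) :
    q.σ⁻¹ (θ h) = θ (M.faceNext h.swap) := by
  rw [← q.φ_α, H.α_apply, H.φ_apply]

theorem σ_apply_of_rotation (H : M.IsSuccGraph q θ) {h h' : M.m.E ⊕ M.m.E}
    (hr : M.Rotation h h') : q.σ (θ h) = θ h' := by
  rw [← faceNext_of_rotation hr, ← H.inv_σ_apply, Equiv.Perm.apply_inv_apply]

theorem inr_notMem_range (e : M.m.E) : θ (Sum.inr e) ∉ Set.range fun e => θ (Sum.inl e) := by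
  rintro ⟨e', he'⟩
  cases θ.injective he'

/-- Turning clockwise from an arrival in `c`, one goes through `pred b`, its own `pred` and so on,
and then meets `Sum.inl c`. -/
theorem isFirstHit_succ (H : M.IsSuccGraph q θ) {b c : M.m.E} (hb : M.succ b = Sum.inl c) :
    IsFirstHit q.σ⁻¹ (Set.range fun e => θ (Sum.inl e)) (θ (Sum.inr b)) (θ (Sum.inl c)) := by
  refine succ_induction (P := fun b => IsFirstHit q.σ⁻¹ (Set.range fun e => θ (Sum.inl e))
    (θ (Sum.inr b)) (θ (Sum.inl c))) (fun b hb h => ?_) (fun b hb h ih => ?_) hb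
  · have h1 : q.σ⁻¹ (θ (Sum.inr b)) = θ (Sum.inl c) := by
      rw [H.inv_σ_apply, Sum.swap_inr, faceNext_inl_of_succ h hb]
    rw [← h1]
    exact IsFirstHit.of_apply_mem (h1 ▸ ⟨c, rfl⟩)
  · have h1 : q.σ⁻¹ (θ (Sum.inr b)) = θ (Sum.inr (M.pred b)) := by
      rw [H.inv_σ_apply, Sum.swap_inr, faceNext, if_neg h]
    exact IsFirstHit.of_apply_notMem (h1 ▸ inr_notMem_range _) (h1 ▸ ih)

theorem isFirstHit_σ (H : M.IsSuccGraph q θ) (c : M.m.E) :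
    IsFirstHit q.σ (Set.range fun e => θ (Sum.inl e)) (θ (Sum.inl c))
      (θ (Sum.inl (M.m.σ c))) := by
  have key : IsFirstHit q.σ⁻¹ (Set.range fun e => θ (Sum.inl e)) (θ (Sum.inl (M.m.σ c)))
      (θ (Sum.inl c)) := by
    have h0 := H.inv_σ_apply (Sum.inl (M.m.σ c))
    rw [Sum.swap_inl] at h0
    by_cases h : M.lab (M.m.α (M.m.σ c)) = M.lab (M.m.σ c) + 1
    · rw [faceNext_inr_of_eq h] at h0
      refine IsFirstHit.of_apply_notMem (h0 ▸ inr_notMem_range _) ?_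
      rw [h0]
      have := succ_eq_φ (e := M.m.α (M.m.σ c)) (by rw [lab_φ_α]; omega)
      rw [M.m.φ_α_σ] at this
      exact H.isFirstHit_succ this
    · rw [faceNext_inr_of_ne h, M.m.φ_α_σ] at h0
      rw [← h0]
      exact IsFirstHit.of_apply_mem (h0 ▸ ⟨c, rfl⟩)
  have := key.inv (Set.mem_range_self (f := fun e => θ (Sum.inl e)) (M.m.σ c))
  rwa [inv_inv] at this

theorem vertexOf_eq_of_sameCycle (H : M.IsSuccGraph q θ) {e e' : q.E}
    (h : q.σ.SameCycle e e') : M.vertexOf (θ.symm e) = M.vertexOf (θ.symm e') := by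
  refine rel_of_sameCycle_of_apply (π := q.σ⁻¹)
    (R := fun e e' => M.vertexOf (θ.symm e) = M.vertexOf (θ.symm e'))
    ⟨fun _ => rfl, Eq.symm, Eq.trans⟩ (fun e => ?_) (Equiv.Perm.sameCycle_inv.2 h)
  obtain ⟨h, rfl⟩ := θ.surjective e
  rw [H.inv_σ_apply, θ.symm_apply_apply, θ.symm_apply_apply, vertexOf_faceNext, Sum.swap_swap]

theorem origin_inr_eq (H : M.IsSuccGraph q θ) {b c : M.m.E} (hb : M.succ b = Sum.inl c) :
    q.origin (θ (Sum.inr b)) = q.origin (θ (Sum.inl c)) :=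
  q.origin_eq_iff.2 (Equiv.Perm.sameCycle_inv.1 (H.isFirstHit_succ hb).sameCycle)

theorem origin_inl_eq (H : M.IsSuccGraph q θ) {e e' : M.m.E}
    (h : M.m.origin e = M.m.origin e') :
    q.origin (θ (Sum.inl e)) = q.origin (θ (Sum.inl e')) := by
  refine rel_of_sameCycle_of_apply (π := M.m.σ)
    (R := fun e e' => q.origin (θ (Sum.inl e)) = q.origin (θ (Sum.inl e')))
    ⟨fun _ => rfl, Eq.symm, Eq.trans⟩ (fun e => ?_) (M.m.origin_eq_iff.1 h)
  exact q.origin_eq_iff.2 (H.isFirstHit_σ e).sameCycle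

theorem origin_source_eq (H : M.IsSuccGraph q θ) {e e' : M.m.E} {i : Fin k}
    (h : M.succ e = Sum.inr i) (h' : M.succ e' = Sum.inr i) :
    q.origin (θ (Sum.inr e)) = q.origin (θ (Sum.inr e')) := by
  refine IsFirstHit.rel_of_sameCycle (π := M.m.φ) (S := {b | M.succ b = Sum.inr i})
    (R := fun e e' => q.origin (θ (Sum.inr e)) = q.origin (θ (Sum.inr e')))
    ⟨fun _ => rfl, Eq.symm, Eq.trans⟩ (fun a b ha hab => ?_) h h' ?_
  · rw [← H.σ_apply_of_rotation (.source i a b ha hab), q.origin_σ]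
  · exact sameCycle_of_faceIndex_eq ((succ_eq_inr_iff.1 h).1.trans (succ_eq_inr_iff.1 h').1.symm)

theorem origin_eq_of_vertexOf_eq (H : M.IsSuccGraph q θ) {h h' : M.m.E ⊕ M.m.E}
    (hv : M.vertexOf h = M.vertexOf h') : q.origin (θ h) = q.origin (θ h') := by
  rcases hw : M.vertexOf h with v | i
  · have key : ∀ h, M.vertexOf h = Sum.inl v →
        ∃ e, q.origin (θ h) = q.origin (θ (Sum.inl e)) ∧ M.m.origin e = v := by
      rintro (e | e) he
      · exact ⟨e, rfl, Sum.inl.inj he⟩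
      · rcases hs : M.succ e with c | i
        · rw [vertexOf_inr_of_succ hs] at he
          exact ⟨c, H.origin_inr_eq hs, Sum.inl.inj he⟩
        · rw [vertexOf_inr_of_source hs] at he
          cases he
    obtain ⟨e, h1, h2⟩ := key h hw
    obtain ⟨e', h3, h4⟩ := key h' (hv ▸ hw)
    rw [h1, h3]
    exact H.origin_inl_eq (h2.trans h4.symm)
  · obtain ⟨e, rfl, he⟩ := succ_eq_of_vertexOf hw
    obtain ⟨e', rfl, he'⟩ := succ_eq_of_vertexOf (hv ▸ hw)
    exact H.origin_source_eq he he'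

/-- The vertices of the graph of successors are those of the map and the added sources. -/
noncomputable def vertexEquiv (H : M.IsSuccGraph q θ) : q.Vertex ≃ M.m.Vertex ⊕ Fin k :=
  Equiv.ofBijective
    (Quotient.lift (fun e => M.vertexOf (θ.symm e)) fun _ _ h => H.vertexOf_eq_of_sameCycle h) (by
      constructor
      · intro v w hvw
        obtain ⟨e, rfl⟩ := q.origin_surjective v
        obtain ⟨e', rfl⟩ := q.origin_surjective w
        have := H.origin_eq_of_vertexOf_eq (h := θ.symm e) (h' := θ.symm e') hvw
        rwa [θ.apply_symm_apply, θ.apply_symm_apply] at this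
      · rintro (v | i)
        · obtain ⟨e, rfl⟩ := M.m.origin_surjective v
          refine ⟨q.origin (θ (Sum.inl e)), ?_⟩
          change M.vertexOf (θ.symm (θ (Sum.inl e))) = _
          rw [θ.symm_apply_apply]
          rfl
        · obtain ⟨e, he, he'⟩ := M.exists_lab_eq_faceMin i
          refine ⟨q.origin (θ (Sum.inr e)), ?_⟩
          change M.vertexOf (θ.symm (θ (Sum.inr e))) = _
          rw [θ.symm_apply_apply, vertexOf_inr_of_source (succ_eq_inr_iff.2 ⟨he, he'⟩)])

theorem vertexEquiv_origin (H : M.IsSuccGraph q θ) (h : M.m.E ⊕ M.m.E) :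
    H.vertexEquiv (q.origin (θ h)) = M.vertexOf h := by
  change M.vertexOf (θ.symm (θ h)) = _
  rw [θ.symm_apply_apply]

/-- The labels of the vertices of the graph of successors. -/
noncomputable def vertexLabel (H : M.IsSuccGraph q θ) (v : q.Vertex) : ℤ :=
  M.sumLabel (H.vertexEquiv v)

/-- The sources. -/
noncomputable def source (H : M.IsSuccGraph q θ) (i : Fin k) : q.Vertex :=
  H.vertexEquiv.symm (Sum.inr i)

theorem vertexLabel_source (H : M.IsSuccGraph q θ) (i : Fin k) :
    H.vertexLabel (H.source i) = M.sourceLabel i := by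
  rw [vertexLabel, source, Equiv.apply_symm_apply]
  rfl

theorem vertexLabel_origin_inl (H : M.IsSuccGraph q θ) (e : M.m.E) :
    H.vertexLabel (q.origin (θ (Sum.inl e))) = M.lab e := by
  rw [vertexLabel, vertexEquiv_origin, sumLabel_vertexOf_inl]

theorem vertexLabel_origin_inr (H : M.IsSuccGraph q θ) (e : M.m.E) :
    H.vertexLabel (q.origin (θ (Sum.inr e))) = M.lab e - 1 := by
  rw [vertexLabel, vertexEquiv_origin, sumLabel_vertexOf_inr]

theorem origin_inr_eq_source (H : M.IsSuccGraph q θ) {e : M.m.E} {i : Fin k}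
    (h : M.succ e = Sum.inr i) : q.origin (θ (Sum.inr e)) = H.source i := by
  rw [source, Equiv.eq_symm_apply, vertexEquiv_origin, vertexOf_inr_of_source h]

theorem vertexLabel_target_inl (H : M.IsSuccGraph q θ) (e : M.m.E) :
    H.vertexLabel (q.target (θ (Sum.inl e))) = M.lab e - 1 := by
  rw [Fatgraph.target, H.α_apply]
  exact H.vertexLabel_origin_inr e

theorem vertexLabel_target_inr (H : M.IsSuccGraph q θ) (e : M.m.E) :
    H.vertexLabel (q.target (θ (Sum.inr e))) = M.lab e := by
  rw [Fatgraph.target, H.α_apply]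
  exact H.vertexLabel_origin_inl e

theorem vertexLabel_target (H : M.IsSuccGraph q θ) (e : q.E) :
    H.vertexLabel (q.target e) = H.vertexLabel (q.origin e) + 1 ∨
      H.vertexLabel (q.target e) = H.vertexLabel (q.origin e) - 1 := by
  obtain ⟨e | e, rfl⟩ := θ.surjective e
  · rw [vertexLabel_target_inl, vertexLabel_origin_inl]
    exact Or.inr rfl
  · rw [vertexLabel_target_inr, vertexLabel_origin_inr]
    exact Or.inl (by omega)

theorem abs_vertexLabel_sub_le (H : M.IsSuccGraph q θ) (v w : q.Vertex) :
    |H.vertexLabel v - H.vertexLabel w| ≤ q.dist v w := by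
  refine q.abs_sub_le_dist (fun e => ?_) v w
  rw [abs_le]
  rcases H.vertexLabel_target e with h | h <;> omega

theorem vertexLabel_target_of_source (H : M.IsSuccGraph q θ) {e : q.E} {i : Fin k}
    (h : q.origin e = H.source i) :
    H.vertexLabel (q.target e) = H.vertexLabel (q.origin e) + 1 := by
  obtain ⟨h', rfl⟩ := θ.surjective e
  rw [source, Equiv.eq_symm_apply, vertexEquiv_origin] at h
  obtain ⟨e, rfl, -⟩ := succ_eq_of_vertexOf h
  rw [vertexLabel_target_inr, vertexLabel_origin_inr]
  omega

/-- The chain of successors lowers the label by one at each step and stops only at a source; the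
Lipschitz bound shows that it is a geodesic. -/
theorem exists_vertexLabel_eq (H : M.IsSuccGraph q θ) (v : q.Vertex) :
    ∃ i, H.vertexLabel v = M.sourceLabel i + q.dist v (H.source i) := by
  obtain ⟨B, hB⟩ := (Set.finite_range H.vertexLabel).bddBelow
  have hB' : ∀ v, B ≤ H.vertexLabel v := fun v => hB ⟨v, rfl⟩
  have key : ∃ i, M.sourceLabel i + q.dist v (H.source i) ≤ H.vertexLabel v := by
    induction hn : (H.vertexLabel v - B).toNat using Nat.strong_induction_on generalizing v with
    | _ n ih =>
      rcases hv : H.vertexEquiv v with w | i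
      · obtain ⟨e, rfl⟩ := M.m.origin_surjective w
        have hv' : q.origin (θ (Sum.inl e)) = v := by
          rw [← Equiv.apply_eq_iff_eq H.vertexEquiv, hv, vertexEquiv_origin]
          rfl
        have h1 := H.vertexLabel_origin_inl e
        have h2 := H.vertexLabel_target_inl e
        have h3 := hB' (q.target (θ (Sum.inl e)))
        have h5 := q.dist_origin_target_le (θ (Sum.inl e))
        rw [hv'] at h1 h5
        obtain ⟨i, hi⟩ := ih _ (by omega) (q.target (θ (Sum.inl e))) rfl
        have h4 := q.dist_triangle v (q.target (θ (Sum.inl e))) (H.source i)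
        exact ⟨i, by omega⟩
      · have hv' : v = H.source i := by rw [source, Equiv.eq_symm_apply, hv]
        refine ⟨i, ?_⟩
        rw [hv', q.dist_self, vertexLabel_source]
        simp
  obtain ⟨i, hi⟩ := key
  refine ⟨i, le_antisymm ?_ hi⟩
  have := H.abs_vertexLabel_sub_le v (H.source i)
  rw [vertexLabel_source, abs_le] at this
  omega

theorem source_injective (H : M.IsSuccGraph q θ) : Function.Injective H.source :=
  H.vertexEquiv.symm.injective.comp Sum.inr_injective

/-- The first edge of a geodesic from `x i` to `x j` ascends, which wastes a step and makes the
Lipschitz bound strict. -/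
theorem sourceLabel_sub_lt (H : M.IsSuccGraph q θ) {i j : Fin k} (hij : i ≠ j) :
    M.sourceLabel i - M.sourceLabel j < q.dist (H.source i) (H.source j) := by
  obtain ⟨e, he, he'⟩ := q.exists_closer (H.source_injective.ne hij)
  have h1 := H.vertexLabel_target_of_source he
  have h2 := H.abs_vertexLabel_sub_le (q.target e) (H.source j)
  rw [vertexLabel_source, abs_le] at h2
  rw [he, vertexLabel_source] at h1
  omega

theorem abs_sourceLabel_sub_lt (H : M.IsSuccGraph q θ) {i j : Fin k} (hij : i ≠ j) :
    |M.sourceLabel i - M.sourceLabel j| < q.dist (H.source i) (H.source j) := by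
  have h1 := H.sourceLabel_sub_lt hij
  have h2 := H.sourceLabel_sub_lt hij.symm
  rw [Fatgraph.dist_comm] at h2
  rw [abs_lt]
  omega

theorem exists_dist_add_eq (H : M.IsSuccGraph q θ) (i j : Fin k) : ∃ n : ℕ,
    (q.dist (H.source i) (H.source j) : ℤ) + M.sourceLabel i - M.sourceLabel j = 2 * (n : ℤ) := by
  have h1 := q.even_dist_add_sub H.vertexLabel_target (H.source i) (H.source j)
  have h2 := H.abs_vertexLabel_sub_le (H.source i) (H.source j)
  rw [H.vertexLabel_source, H.vertexLabel_source] at h1 h2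
  rw [abs_le] at h2
  exact ⟨(((q.dist (H.source i) (H.source j) : ℤ) + M.sourceLabel i - M.sourceLabel j) / 2).toNat,
    by omega⟩

theorem isQuadrangulation (H : M.IsSuccGraph q θ) : q.IsQuadrangulation := by
  refine q.isQuadrangulation_of_φ (fun e => ?_) (fun e => ?_)
  · obtain ⟨h, rfl⟩ := θ.surjective e
    simp only [H.φ_apply, faceNext_four]
  · obtain ⟨h, rfl⟩ := θ.surjective e
    simp only [H.φ_apply]
    exact θ.injective.ne (faceNext_two_ne h)

theorem isBipartite (H : M.IsSuccGraph q θ) : q.IsBipartite := by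
  refine ⟨fun v => decide (H.vertexLabel v % 2 = 0), fun e he => ?_⟩
  rw [decide_eq_decide] at he
  rcases H.vertexLabel_target e with h | h <;> omega

/-- There are `k` more vertices, twice as many edges, and one face for each edge of `m`, while `m`
has `k` faces: the Euler characteristic is unchanged. -/
theorem hasGenus (H : M.IsSuccGraph q θ) : q.HasGenus g := by
  have h1 := Nat.card_congr H.vertexEquiv
  rw [Nat.card_sum, Nat.card_fin] at h1
  have h2 := H.isQuadrangulation.card_eq
  have h3 := q.card_eq_two_mul_card_edge
  have h4 := M.m.card_eq_two_mul_card_edge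
  have h5 := Nat.card_congr θ
  rw [Nat.card_sum] at h5
  have h6 := Nat.card_congr M.f
  rw [Nat.card_fin] at h6
  have h7 := M.genus
  rw [Fatgraph.HasGenus] at h7 ⊢
  omega

end IsSuccGraph

variable (M) in
/-- The quadrangulation given by the construction `Φ°`. -/
noncomputable def phi : DelayedQuad g k where
  q := M.succGraph
  genus := M.isSuccGraph_succGraph.hasGenus
  quad := M.isSuccGraph_succGraph.isQuadrangulation
  bipartite := M.isSuccGraph_succGraph.isBipartite
  x := M.isSuccGraph_succGraph.source
  d := M.sourceLabel
  delay_lt _ _ hij := M.isSuccGraph_succGraph.abs_sourceLabel_sub_lt hij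
  delay_even := M.isSuccGraph_succGraph.exists_dist_add_eq

theorem isPhi_phi : M.IsPhi M.phi :=
  ⟨Equiv.refl _, fun _ _ hr => M.isSuccGraph_succGraph.σ_apply_of_rotation hr, fun _ => rfl,
    fun _ _ h => M.isSuccGraph_succGraph.origin_inr_eq_source h, 0, fun _ => (add_zero _).symm⟩

/-- The half-edges of a quadrangulation obtained by the construction `Φ°` form the graph of
successors. -/
theorem isSuccGraph_of_rotation {q : Fatgraph} {θ : M.m.E ⊕ M.m.E ≃ q.E}
    (hσ : ∀ h h', M.Rotation h h' → q.σ (θ h) = θ h')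
    (hα : ∀ e, q.α (θ (Sum.inl e)) = θ (Sum.inr e)) : M.IsSuccGraph q θ := by
  have hα' : ∀ h, q.α (θ h) = θ h.swap := by
    rintro (e | e)
    · exact hα e
    · rw [← hα, q.α_involutive, Sum.swap_inr]
  refine ⟨fun h => ?_, hα'⟩
  -- Every half-edge has a `Rotation` image, so `σ` is known everywhere; at `φ (θ h)` its value is
  -- `α (θ h)`.
  obtain ⟨h', hr⟩ := M.exists_rotation (θ.symm (q.φ (θ h)))
  have h1 := hσ _ _ hr
  rw [θ.apply_symm_apply, q.σ_φ, hα'] at h1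
  have h2 := faceNext_of_rotation hr
  rw [← θ.injective h1, Sum.swap_swap] at h2
  rw [h2, θ.apply_symm_apply]

end LabeledMap

/-! ### The construction `Ψ°` in terms of descending half-edges -/

namespace DelayedQuad

variable {g k : ℕ} {Q : DelayedQuad g k} {M : LabeledMap g k}

theorem Linked.abs_lab_sub_le [NeZero k] {c c' : Q.q.E} (h : Q.Linked c c') :
    |Q.lab c - Q.lab c'| ≤ 1 := by
  have h4 := Q.lab_φ (Q.q.φ (Q.q.φ (Q.q.φ c)))
  rw [Q.φ_four] at h4
  rw [abs_le]
  rcases h.eq_iterate with ⟨h1, rfl⟩ | ⟨h1, h2, rfl⟩ | ⟨h1, h2, rfl⟩ <;> omega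

theorem Linked.ne [NeZero k] {c c' : Q.q.E} (h : Q.Linked c c') : c' ≠ c := by
  have h4 := Q.lab_φ (Q.q.φ (Q.q.φ (Q.q.φ c)))
  rw [Q.φ_four] at h4
  intro hc
  rcases h.eq_iterate with ⟨h1, rfl⟩ | ⟨h1, h2, rfl⟩ | ⟨h1, h2, rfl⟩
  · rw [hc] at h1
    omega
  · have h5 : Function.minimalPeriod Q.q.φ c ∣ 2 :=
      Function.IsPeriodicPt.minimalPeriod_dvd (show Q.q.φ^[2] c = c from hc)
    rw [Q.quad.minimalPeriod] at h5
    omega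
  · rw [hc] at h4
    omega

/-- Corners are shifted by `σ`: `η = σ ∘ θ` takes an added corner to the descending half-edge that
bounds it, and regions become tiles. -/
theorem isPsi_iff [NeZero k] : Q.IsPsi M ↔
    ∃ η, Q.IsAddedMap M.m.σ M.m.α M.m.φ η ∧
      (∀ e i, M.m.face e = M.f i ↔ η e ∈ Q.tile i) ∧ ∃ c : ℤ, ∀ e, M.lab e = Q.lab (η e) + c := by
  constructor
  · rintro ⟨θ, hσ, hα, hf, c, hc⟩
    refine ⟨fun e => Q.q.σ (θ e), ⟨?_, ?_, ?_, M.m.φ_α_σ, M.m.α_involutive, ?_, ?_⟩, ?_, c, ?_⟩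
    · exact Q.q.σ.injective.comp (Subtype.val_injective.comp θ.injective)
    · exact fun e => mem_added_iff.1 (θ e).2
    · intro d hd
      have : Q.q.σ⁻¹ d ∈ Q.added := by rwa [mem_added_iff, Equiv.Perm.apply_inv_apply]
      obtain ⟨e, he⟩ := θ.surjective ⟨_, this⟩
      exact ⟨e, by rw [he, Equiv.Perm.apply_inv_apply]⟩
    · exact fun e => (hσ e).map Q.q.σ (fun _ => rfl) fun _ => mem_added_iff
    · intro e
      rw [Q.q.φ_α_σ, Q.q.φ_α_σ]
      exact hα e
    · intro e i
      rw [hf, sourceOnLeft_iff (θ e).2]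
    · intro e
      rw [lab_σ]
      exact hc e
  · rintro ⟨η, P, hf, c, hc⟩
    have hmem : ∀ e, Q.q.σ⁻¹ (η e) ∈ Q.added := fun e => by
      rw [mem_added_iff, Equiv.Perm.apply_inv_apply]
      exact P.mem e
    refine ⟨Equiv.ofBijective (fun e => ⟨Q.q.σ⁻¹ (η e), hmem e⟩) ⟨fun e e' h => ?_, ?_⟩,
      fun e => ?_, fun e => ?_, fun e i => ?_, c, fun e => ?_⟩
    · exact P.inj (Q.q.σ⁻¹.injective (congrArg Subtype.val h))
    · rintro ⟨c, hc⟩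
      obtain ⟨e, he⟩ := P.surj _ (mem_added_iff.1 hc)
      exact ⟨e, Subtype.ext (Equiv.Perm.inv_eq_iff_eq.2 he)⟩
    · refine (P.hit e).map (fun e => Q.q.σ⁻¹ e) (fun x => ?_) fun x => ?_
      · rw [Equiv.Perm.inv_apply_apply, Equiv.Perm.apply_inv_apply]
      · rw [mem_added_iff, Equiv.Perm.apply_inv_apply]
    · have := P.link e
      rw [Q.q.φ_α, Q.q.φ_α] at this
      exact this
    · change _ ↔ Q.SourceOnLeft (Q.q.σ⁻¹ (η e)) i
      rw [hf, sourceOnLeft_iff (hmem e), Equiv.Perm.apply_inv_apply]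
    · change M.lab e = Q.lab (Q.q.σ⁻¹ (η e)) + c
      rw [hc, lab_inv_σ]

namespace IsAddedMap

variable {X : Type} {s a f : Equiv.Perm X} {η : X → Q.q.E}

theorem origin_s (P : Q.IsAddedMap s a f η) (x : X) :
    Q.q.origin (η (s x)) = Q.q.origin (η x) :=
  (Q.q.origin_eq_iff.2 (P.hit x).sameCycle).symm

theorem sameCycle_s_iff (P : Q.IsAddedMap s a f η) {x y : X} :
    s.SameCycle x y ↔ Q.q.origin (η x) = Q.q.origin (η y) := by
  have : Finite X := Finite.of_injective η P.inj
  constructor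
  · exact rel_of_sameCycle_of_apply (R := fun x y => Q.q.origin (η x) = Q.q.origin (η y))
      ⟨fun _ => rfl, Eq.symm, Eq.trans⟩ fun x => (P.origin_s x).symm
  · intro h
    have : Nonempty X := ⟨x⟩
    have hinv := Function.leftInverse_invFun P.inj
    have key := IsFirstHit.rel_of_sameCycle (π := Q.q.σ) (S := Q.down)
      (R := fun e e' => s.SameCycle (Function.invFun η e) (Function.invFun η e'))
      ⟨fun _ => .refl _ _, .symm, .trans⟩ (fun e e' he hee' => ?_) (P.mem x) (P.mem y)
      (Q.q.origin_eq_iff.1 h)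
    · rwa [hinv, hinv] at key
    · obtain ⟨z, rfl⟩ := P.surj e he
      rw [hee'.unique (P.hit z), hinv, hinv]
      exact Equiv.Perm.sameCycle_apply_right.2 (.refl _ _)

variable [NeZero k]

/-- The sources are exactly the vertices that no descending half-edge leaves. -/
theorem card_vertex (P : Q.IsAddedMap s a f η) :
    Nat.card Q.q.Vertex = Nat.card (Quotient (Equiv.Perm.SameCycle.setoid s)) + k := by
  have : Finite X := Finite.of_injective η P.inj
  let F : Quotient (Equiv.Perm.SameCycle.setoid s) ⊕ Fin k → Q.q.Vertex :=
    Sum.elim (Quotient.lift (fun x => Q.q.origin (η x)) fun _ _ h => P.sameCycle_s_iff.1 h) Q.x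
  have hF : Function.Bijective F := by
    constructor
    · rintro (v | i) (w | j) h
      · induction v using Quotient.inductionOn with | _ x
        induction w using Quotient.inductionOn with | _ y
        exact congrArg Sum.inl (Quotient.sound (P.sameCycle_s_iff.2 h))
      · induction v using Quotient.inductionOn with | _ x
        exact absurd (P.mem x) (Q.notMem_down_of_source h)
      · induction w using Quotient.inductionOn with | _ y
        exact absurd (P.mem y) (Q.notMem_down_of_source h.symm)
      · exact congrArg Sum.inr (Q.x_injective h)
    · intro v
      by_cases hv : ∃ i, v = Q.x i
      · obtain ⟨i, rfl⟩ := hv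
        exact ⟨Sum.inr i, rfl⟩
      · obtain ⟨e, he, rfl⟩ := Q.exists_mem_down (not_exists.1 hv)
        obtain ⟨x, rfl⟩ := P.surj e he
        exact ⟨Sum.inl (Quotient.mk _ x), rfl⟩
  rw [← Nat.card_congr (Equiv.ofBijective F hF), Nat.card_sum, Nat.card_fin]

theorem bijective_elim (P : Q.IsAddedMap s a f η) :
    Function.Bijective (Sum.elim η fun x => Q.q.α (η x)) := by
  constructor
  · rintro (x | x) (y | y) h
    · exact congrArg Sum.inl (P.inj h)
    · have h' : η x = Q.q.α (η y) := h
      exact absurd (P.mem x) (h' ▸ P.up y)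
    · have h' : Q.q.α (η x) = η y := h
      exact absurd (P.mem y) (h' ▸ P.up x)
    · exact congrArg Sum.inr (P.inj (Q.q.α.injective h))
  · intro e
    by_cases he : e ∈ Q.down
    · obtain ⟨x, hx⟩ := P.surj e he
      exact ⟨Sum.inl x, hx⟩
    · obtain ⟨x, hx⟩ := P.exists_of_up he
      exact ⟨Sum.inr x, hx.symm⟩

theorem two_mul_card (P : Q.IsAddedMap s a f η) : 2 * Nat.card X = Nat.card Q.q.E := by
  have : Finite X := Finite.of_injective η P.inj
  rw [← Nat.card_congr (Equiv.ofBijective _ P.bijective_elim), Nat.card_sum, two_mul]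

end IsAddedMap

/-! ### Existence of the map of added edges -/

variable (Q) in
theorem exists_linkPerm [NeZero k] : ∃ a : Equiv.Perm Q.down, (∀ x, a (a x) = x) ∧
    ∀ x : Q.down, Q.Linked (Q.q.φ (Q.q.α x)) (Q.q.φ (Q.q.α (a x))) := by
  have hex : ∀ x : Q.down, ∃ y : Q.down, Q.Linked (Q.q.φ (Q.q.α x)) (Q.q.φ (Q.q.α y)) := by
    intro x
    obtain ⟨c', hc'⟩ := φ_mem_added_iff.2 (Q.α_notMem_down_iff.2 x.2)
    have h1 : c' ∈ Q.added := ⟨_, hc'.symm⟩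
    rw [mem_added_iff] at h1
    exact ⟨⟨_, h1⟩, by rwa [Q.q.φ_α_σ]⟩
  choose a ha using hex
  have hinv : ∀ x, a (a x) = x := fun x => Subtype.ext
    (Q.q.α.injective (Q.q.φ.injective ((ha (a x)).unique (ha x).symm)))
  exact ⟨⟨a, a, hinv, hinv⟩, hinv, ha⟩

variable (Q) in
theorem exists_isPsi [NeZero k] : ∃ M : LabeledMap g k, Q.IsPsi M := by
  obtain ⟨s, hs⟩ := exists_firstReturn Q.q.σ Q.down
  obtain ⟨a, ha, hlink⟩ := Q.exists_linkPerm
  have P : Q.IsAddedMap s a (a * s)⁻¹ (fun x : Q.down => (x : Q.q.E)) :=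
    ⟨Subtype.val_injective, fun x => x.2, fun e he => ⟨⟨e, he⟩, rfl⟩,
      fun x => Equiv.Perm.inv_apply_apply (a * s) x, ha, hs, hlink⟩
  obtain ⟨d, hd, -⟩ := exists_down_target_eq (Q := Q) 0
  let m : Fatgraph :=
    { E := Q.down
      finite := inferInstance
      nonempty := ⟨⟨d, hd⟩⟩
      σ := s
      α := a
      φ := (a * s)⁻¹
      φ_mul_α_mul_σ := by rw [mul_assoc, inv_mul_cancel]
      α_involutive := ha
      α_ne := fun x hx => (hlink x).ne (by rw [hx])
      transitive := transitive_of_rel _ _ _ fun R hR h1 h2 h3 => P.rel_of_stable hR h1 h2 h3 }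
  -- A descending half-edge that arrives at `x i` represents the face of index `i`.
  choose r hr hr' using fun i => exists_down_target_eq (Q := Q) i
  have hface : ∀ (x : Q.down) i, m.face x = m.face ⟨r i, hr i⟩ ↔ (x : Q.q.E) ∈ Q.tile i := by
    intro x i
    have hri : r i ∈ Q.tile i := mem_tile_of_source (hr i) (hr' i)
    rw [m.face_eq_iff]
    exact ⟨fun h => (P.mem_tile_iff_of_sameCycle h i).2 hri, fun h => P.sameCycle_of_mem_tile h hri⟩
  let F : Fin k ≃ m.Face := Equiv.ofBijective (fun i => m.face ⟨r i, hr i⟩) (by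
    constructor
    · intro i j hij
      exact mem_tile_unique ((hface ⟨r i, hr i⟩ i).1 rfl) ((hface ⟨r i, hr i⟩ j).1 hij)
    · intro c
      obtain ⟨x, rfl⟩ := m.face_surjective c
      obtain ⟨i, hi⟩ := exists_mem_tile x.2
      exact ⟨i, ((hface x i).2 hi).symm⟩)
  have hV : Nat.card Q.q.Vertex = Nat.card m.Vertex + k := P.card_vertex
  have hgenus : m.HasGenus g := by
    have h1 : 2 * Nat.card m.E = Nat.card Q.q.E := P.two_mul_card
    have h2 := Q.quad.card_eq
    have h3 := Q.q.card_eq_two_mul_card_edge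
    have h4 := m.card_eq_two_mul_card_edge
    have h6 := Nat.card_congr F
    rw [Nat.card_fin] at h6
    have h7 := Q.genus
    rw [Fatgraph.HasGenus] at h7 ⊢
    omega
  let M : LabeledMap g k :=
    { m := m
      genus := hgenus
      f := F
      label := Quotient.lift (fun x : Q.down => Q.lab x) fun _ _ h =>
        congrArg Q.label (P.sameCycle_s_iff.1 h)
      label_step := fun x => by
        have h := (hlink x).abs_lab_sub_le
        rw [← DelayedQuad.lab_α, ← DelayedQuad.lab_α, Q.q.α_involutive, Q.q.α_involutive] at h
        exact h }
  exact ⟨M, isPsi_iff.2 ⟨fun x => (x : Q.q.E), P, hface, 0, fun _ => (add_zero _).symm⟩⟩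

/-! ### The two constructions are inverse of each other -/

section

variable {η : M.m.E → Q.q.E} {c : ℤ}

theorem run_lab (hc : ∀ e, M.lab e = Q.lab (η e) + c) {l : ℤ} {x y : M.m.E}
    (h : RunAbove M.m.φ (fun x => Q.lab (η x)) l x y) : RunAbove M.m.φ M.lab (l + c) x y := by
  obtain ⟨n, hn, hy, hlt⟩ := h
  refine ⟨n, hn, hy, fun i hi hin => ?_⟩
  rw [hc]
  exact add_lt_add_left (hlt i hi hin) c

variable [NeZero k]

/-- The minimum over a tile is attained by the half-edges that arrive at its center. -/
theorem IsAddedMap.faceMin_eq (P : Q.IsAddedMap M.m.σ M.m.α M.m.φ η)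
    (hf : ∀ e i, M.m.face e = M.f i ↔ η e ∈ Q.tile i) (hc : ∀ e, M.lab e = Q.lab (η e) + c)
    (i : Fin k) : M.faceMin i = Q.d i + 1 + c := by
  refine le_antisymm ?_ ?_
  · obtain ⟨d, hd, hdi⟩ := exists_down_target_eq (Q := Q) i
    obtain ⟨e, rfl⟩ := P.surj d hd
    have h1 := M.faceMin_le e
    rw [LabeledMap.faceIndex_eq_iff.2 ((hf e i).2 (mem_tile_of_source hd hdi)), hc,
      lab_of_target_source hd hdi] at h1
    exact h1
  · obtain ⟨e, he, he'⟩ := M.exists_lab_eq_faceMin i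
    have h1 := lab_gt_of_mem_tile ((hf e i).1 (LabeledMap.faceIndex_eq_iff.1 he))
    have h2 := hc e
    omega

/-- After the descent `η x` the face of `q` either descends again, along the leftmost continuation,
which is the successor by `run_leftStep`; or ascends along the reversal of a sibling, which is the
predecessor by `run_sibling`. -/
theorem IsAddedMap.φ_inl (P : Q.IsAddedMap M.m.σ M.m.α M.m.φ η)
    (hc : ∀ e, M.lab e = Q.lab (η e) + c) (x : M.m.E) :
    Q.q.φ (η x) = Sum.elim η (fun e => Q.q.α (η e)) (M.faceNext (Sum.inl x)) := by
  by_cases h : Q.q.φ (η x) ∈ Q.down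
  · obtain ⟨y, hy⟩ := P.surj _ h
    have h2 := φ_φ_notMem_down (P.mem x) h
    have h3 : Q.q.φ (Q.q.φ (Q.q.φ (η x))) ∉ Q.down := by
      intro h3
      have l1 := Q.mem_down_iff.1 (P.mem x)
      have l2 := Q.mem_down_iff.1 h
      have l3 := Q.lab_φ (Q.q.φ (Q.q.φ (η x)))
      have l4 := Q.mem_down_iff.1 h3
      rw [Q.φ_four] at l4
      omega
    have h4 : Q.q.φ (Q.q.φ (Q.q.φ (Q.q.φ (η x)))) = η x := Q.φ_four _
    have hs : η (M.m.σ x) = Q.q.α (Q.q.φ (Q.q.φ (Q.q.φ (η x)))) := by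
      have h5 : Q.q.σ (η x) = Q.q.α (Q.q.φ (Q.q.φ (Q.q.φ (η x)))) := by
        conv_lhs => rw [← h4, Q.q.σ_φ]
      refine (P.hit x).unique ?_
      rw [← h5]
      exact IsFirstHit.of_apply_mem (by rw [h5]; exact Q.α_mem_down_iff.2 h3)
    have ha : η (M.m.α (M.m.σ x)) = Q.q.α (Q.q.φ (Q.q.φ (η x))) := by
      refine P.a_eq ?_
      rw [hs, Q.q.α_involutive]
      exact (linked_of_up_up h2 h3).symm
    have hl : M.lab (M.m.φ⁻¹ x) = M.lab x - 1 := by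
      rw [M.m.inv_φ_eq, hc, hc, ha, DelayedQuad.lab_α]
      have l3 := Q.notMem_down_iff.1 h3
      rw [Q.φ_four] at l3
      omega
    have hstep : Q.LeftStep (η x) (η y) := by
      rw [hy]
      exact leftStep_of_φ_mem_down h
    have hrun := run_lab hc (P.run_leftStep hstep)
    have hsucc : M.succ x = Sum.inl y := by
      refine LabeledMap.succ_eq_inl_of_run ?_ ?_
      · rw [hc, hc, hstep.lab_eq (P.mem x)]
        omega
      · rw [hc]
        exact hrun.mono (by omega)
    rw [LabeledMap.faceNext_inl_of_succ hl hsucc, Sum.elim_inl, hy]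
  · obtain ⟨z, hz⟩ := P.exists_of_up h
    have hsib : Q.q.α (η x) = Q.q.σ (Q.q.α (η z)) := by rw [← hz, Q.q.σ_φ]
    have hl : Q.lab (η z) = Q.lab (η x) := by
      have h1 := P.lab_α z
      have h2 := P.lab_α x
      rw [hsib, lab_σ] at h2
      omega
    have hrun := run_lab hc (P.run_sibling hsib)
    rw [LabeledMap.faceNext_inl_of_run (b := z) (by rw [hc, hc, hl])
      (by rw [hc, ← hl]; exact hrun), Sum.elim_inr, hz]

theorem IsAddedMap.φ_inr (P : Q.IsAddedMap M.m.σ M.m.α M.m.φ η)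
    (hc : ∀ e, M.lab e = Q.lab (η e) + c) (x : M.m.E) :
    Q.q.φ (Q.q.α (η x)) = Sum.elim η (fun e => Q.q.α (η e)) (M.faceNext (Sum.inr x)) := by
  have hu := P.up x
  have l0 := P.lab_α x
  have l1 := Q.notMem_down_iff.1 hu
  by_cases h : Q.q.φ (Q.q.α (η x)) ∈ Q.down
  · have hf : η (M.m.φ (M.m.α x)) = Q.q.φ (Q.q.α (η x)) :=
      P.η_f_of_φ_mem (by rw [M.m.α_involutive, Q.q.α_involutive]) h
    rw [LabeledMap.faceNext_inr_of_ne, Sum.elim_inl, hf]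
    rw [hc, hc]
    have l2 := Q.mem_down_iff.1 h
    by_cases h2 : Q.q.φ (Q.q.φ (Q.q.α (η x))) ∈ Q.down
    · have h3 := φ_φ_notMem_down h h2
      have h4 := linked_of_up_up h3 (by rwa [Q.φ_four])
      rw [Q.φ_four] at h4
      have h5 := P.a_eq (x := x) (u := Q.q.φ (Q.q.φ (Q.q.φ (Q.q.α (η x)))))
        (by rw [Q.φ_four]; exact h4.symm)
      rw [h5, DelayedQuad.lab_α, Q.φ_four]
      omega
    · rw [P.a_eq (linked_of_up_down_up hu h h2), DelayedQuad.lab_α]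
      have l3 := Q.notMem_down_iff.1 h2
      omega
  · have ha := P.a_eq (linked_of_up_up hu h)
    rw [LabeledMap.faceNext_inr_of_eq, Sum.elim_inr, ha, Q.q.α_involutive]
    rw [hc, hc, ha, DelayedQuad.lab_α]
    have l2 := Q.notMem_down_iff.1 h
    omega

/-- `Sum.inl e` goes to `η e` and `Sum.inr e` to its reversal; agreement of the face permutations
suffices, since these determine the rotation. -/
theorem isPhi_of_isPsi (h : Q.IsPsi M) : M.IsPhi Q := by
  obtain ⟨η, P, hf, c, hc⟩ := isPsi_iff.1 h
  have hbij : Function.Bijective (Sum.elim η fun e => Q.q.α (η e)) := P.bijective_elim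
  have H : M.IsSuccGraph Q.q (Equiv.ofBijective _ hbij) := by
    constructor
    · rintro (e | e)
      · exact P.φ_inl hc e
      · exact P.φ_inr hc e
    · rintro (e | e)
      · rfl
      · exact Q.q.α_involutive _
  have hmin := P.faceMin_eq hf hc
  refine ⟨_, fun _ _ hr => H.σ_apply_of_rotation hr, fun _ => rfl, fun e i hs => ?_, -c,
    fun i => ?_⟩
  · obtain ⟨h1, h2⟩ := LabeledMap.succ_eq_inr_iff.1 hs
    refine target_eq_of_mem_tile ((hf e i).1 (LabeledMap.faceIndex_eq_iff.1 h1)) ?_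
    have h3 := hc e
    have h4 := hmin i
    omega
  · rw [LabeledMap.sourceLabel, hmin]
    omega

end

end DelayedQuad

/-! ### From `Φ°` back to `Ψ°` -/

namespace LabeledMap

variable {g k : ℕ} {Q : DelayedQuad g k} {M : LabeledMap g k}

namespace IsSuccGraph

variable {θ : M.m.E ⊕ M.m.E ≃ Q.q.E} {c : ℤ}

theorem mem_down_iff (H : M.IsSuccGraph Q.q θ) (hlab : ∀ v, Q.label v = H.vertexLabel v + c)
    {e : Q.q.E} : e ∈ Q.down ↔ e ∈ Set.range fun e => θ (Sum.inl e) := by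
  obtain ⟨h, rfl⟩ := θ.surjective e
  change Q.label _ = Q.label _ - 1 ↔ _
  rw [hlab, hlab]
  rcases h with e | e
  · rw [vertexLabel_target_inl, vertexLabel_origin_inl]
    exact iff_of_true (by omega) ⟨e, rfl⟩
  · rw [vertexLabel_target_inr, vertexLabel_origin_inr]
    exact iff_of_false (by omega) (inr_notMem_range e)

variable [NeZero k]

theorem label_eq (H : M.IsSuccGraph Q.q θ) (hx : ∀ i, Q.x i = H.source i)
    (hd : ∀ i, Q.d i = M.sourceLabel i + c) (v : Q.q.Vertex) :
    Q.label v = H.vertexLabel v + c := by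
  refine le_antisymm ?_ ?_
  · obtain ⟨i, hi⟩ := H.exists_vertexLabel_eq v
    have := Q.label_le v i
    rw [hx, hd] at this
    omega
  · obtain ⟨i, hi⟩ := Q.exists_label_eq v
    have := H.abs_vertexLabel_sub_le v (H.source i)
    rw [vertexLabel_source, abs_le] at this
    rw [hx, hd] at hi
    omega

theorem linked (H : M.IsSuccGraph Q.q θ) (hlab : ∀ v, Q.label v = H.vertexLabel v + c)
    (e : M.m.E) : Q.Linked (Q.q.φ (θ (Sum.inr e))) (Q.q.φ (θ (Sum.inr (M.m.α e)))) := by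
  have hup : ∀ e, θ (Sum.inr e) ∉ Q.down := fun e => by
    rw [H.mem_down_iff hlab]
    exact inr_notMem_range e
  have hstep := M.abs_lab_φ_sub_le e
  rw [lab_φ, abs_le] at hstep
  have key : ∀ e, M.lab (M.m.α e) = M.lab e + 1 →
      Q.Linked (Q.q.φ (θ (Sum.inr e))) (Q.q.φ (θ (Sum.inr (M.m.α e)))) := fun e h => by
    have h1 := H.φ_apply (Sum.inr e)
    rw [faceNext_inr_of_eq h] at h1
    have h2 := DelayedQuad.linked_of_up_up (hup e) (by rw [h1]; exact hup _)
    rwa [h1] at h2 ⊢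
  rcases lt_trichotomy (M.lab (M.m.α e)) (M.lab e) with h | h | h
  · have := key (M.m.α e) (by rw [M.m.α_involutive]; omega)
    rw [M.m.α_involutive] at this
    exact this.symm
  · obtain ⟨h1, h2⟩ := confluent_face h
    have h3 := H.φ_apply (Sum.inr e)
    have h4 := H.φ_apply (M.faceNext (Sum.inr e))
    rw [← h3, h1, h2] at h4
    have h5 := DelayedQuad.linked_of_up_down_up (hup e)
      (by rw [h3, h1, H.mem_down_iff hlab]; exact ⟨_, rfl⟩) (by rw [h4]; exact hup _)
    rwa [h4] at h5
  · exact key e (by omega)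

theorem isAddedMap (H : M.IsSuccGraph Q.q θ) (hlab : ∀ v, Q.label v = H.vertexLabel v + c) :
    Q.IsAddedMap M.m.σ M.m.α M.m.φ fun e => θ (Sum.inl e) where
  inj := θ.injective.comp Sum.inl_injective
  mem e := (H.mem_down_iff hlab).2 ⟨e, rfl⟩
  surj e he := (H.mem_down_iff hlab).1 he
  mul := M.m.φ_α_σ
  invol := M.m.α_involutive
  hit e := by
    rw [show Q.down = Set.range fun e => θ (Sum.inl e) from Set.ext fun _ => H.mem_down_iff hlab]
    exact H.isFirstHit_σ e
  link e := by
    rw [H.α_apply, H.α_apply]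
    exact H.linked hlab e

/-- Leftmost paths follow successors, and a successor lies in the same face of `m`. -/
theorem mem_tile (H : M.IsSuccGraph Q.q θ) (hx : ∀ i, Q.x i = H.source i)
    (hlab : ∀ v, Q.label v = H.vertexLabel v + c) (e : M.m.E) :
    θ (Sum.inl e) ∈ Q.tile (M.faceIndex e) := by
  have P := H.isAddedMap hlab
  have key : ∀ e', θ (Sum.inl e) = θ (Sum.inl e') → θ (Sum.inl e) ∈ Q.tile (M.faceIndex e') := by
    refine DelayedQuad.down_induction (P := fun d => ∀ e', d = θ (Sum.inl e') →
      d ∈ Q.tile (M.faceIndex e')) ?_ ?_ (P.mem e)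
    · rintro _ hd i hi e rfl
      have h1 : Q.q.target (θ (Sum.inl e)) = Q.q.origin (θ (Sum.inr e)) := by
        rw [Fatgraph.target, H.α_apply, Sum.swap_inl]
      have h2 := hi
      rw [h1, hx, source, Equiv.eq_symm_apply, vertexEquiv_origin] at h2
      obtain ⟨_, h3, h4⟩ := succ_eq_of_vertexOf h2
      rw [← Sum.inr.inj h3] at h4
      rw [(succ_eq_inr_iff.1 h4).1]
      exact DelayedQuad.mem_tile_of_source hd hi
    · rintro _ hd d' hstep ih e rfl
      rcases hs : M.succ e with c | i
      · have h1 : Q.LeftStep (θ (Sum.inl e)) (θ (Sum.inl c)) := by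
          have := H.isFirstHit_succ hs
          rw [← show Q.down = Set.range fun e => θ (Sum.inl e) from
            Set.ext fun _ => H.mem_down_iff hlab] at this
          rw [DelayedQuad.LeftStep, H.α_apply]
          exact this
        rw [h1.mem_tile_iff hd, ← faceIndex_of_succ_eq hs, ← hstep.unique h1]
        exact ih c (hstep.unique h1)
      · refine absurd hstep (DelayedQuad.not_leftStep_of_source (i := i) ?_)
        rw [Fatgraph.target, H.α_apply, hx]
        exact H.origin_inr_eq_source hs
  exact key e rfl

end IsSuccGraph

/-- By `label_eq` the labels of `Q` are those of `M` up to a constant, so `down` consists of the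
half-edges `Sum.inl e`, and `η e = θ (Sum.inl e)` satisfies `isPsi_iff`. -/
theorem isPsi_of_isPhi [NeZero k] (h : M.IsPhi Q) : Q.IsPsi M := by
  obtain ⟨θ, hσ, hα, hx, c, hd⟩ := h
  have H := M.isSuccGraph_of_rotation hσ hα
  have hx' : ∀ i, Q.x i = H.source i := fun i => by
    obtain ⟨e, he, he'⟩ := M.exists_lab_eq_faceMin i
    have hs := succ_eq_inr_iff.2 ⟨he, he'⟩
    rw [← hx e i hs, H.origin_inr_eq_source hs]
  have hlab := H.label_eq hx' hd
  refine DelayedQuad.isPsi_iff.2 ⟨_, H.isAddedMap hlab, fun e i => ?_, -c, fun e => ?_⟩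
  · rw [← faceIndex_eq_iff]
    constructor
    · rintro rfl
      exact H.mem_tile hx' hlab e
    · exact DelayedQuad.mem_tile_unique (H.mem_tile hx' hlab e)
  · rw [DelayedQuad.lab, hlab, H.vertexLabel_origin_inl]
    omega

/-! ### Isomorphism invariance -/

theorem IsPhi.of_iso {Q' : DelayedQuad g k} (h : M.IsPhi Q) (hQ : Q ≈ Q') : M.IsPhi Q' := by
  obtain ⟨θ, hσ, hα, hx, c, hd⟩ := h
  obtain ⟨⟨ψ, hψσ, hψα, hψx⟩, c', hc'⟩ := hQ
  refine ⟨θ.trans ψ, fun h h' hr => ?_, fun e => ?_, fun e i hs => ?_, c + c', fun i => ?_⟩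
  · rw [Equiv.trans_apply, ← hψσ, hσ h h' hr, Equiv.trans_apply]
  · rw [Equiv.trans_apply, ← hψα, hα, Equiv.trans_apply]
  · exact (hψx _ i).1 (hx e i hs)
  · rw [hc', hd]
    omega

theorem IsPhi.unique {Q' : DelayedQuad g k} (h : M.IsPhi Q) (h' : M.IsPhi Q') : Q ≈ Q' := by
  obtain ⟨θ, hσ, hα, hx, c, hd⟩ := h
  obtain ⟨θ', hσ', hα', hx', c', hd'⟩ := h'
  have H := M.isSuccGraph_of_rotation hσ hα
  have H' := M.isSuccGraph_of_rotation hσ' hα'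
  refine ⟨⟨θ.symm.trans θ', fun e => ?_, fun e => ?_, fun e i => ?_⟩, c' - c, fun i => ?_⟩
  · obtain ⟨h, rfl⟩ := θ.surjective e
    obtain ⟨h', hr⟩ := M.exists_rotation h
    simp [hσ h h' hr, hσ' h h' hr]
  · obtain ⟨h, rfl⟩ := θ.surjective e
    simp [H.α_apply, H'.α_apply]
  · obtain ⟨h, rfl⟩ := θ.surjective e
    obtain ⟨b, hb, hb'⟩ := M.exists_lab_eq_faceMin i
    have hs := succ_eq_inr_iff.2 ⟨hb, hb'⟩
    rw [Equiv.trans_apply, θ.symm_apply_apply, ← hx b i hs, ← hx' b i hs,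
      ← H.vertexEquiv.apply_eq_iff_eq, ← H'.vertexEquiv.apply_eq_iff_eq, H.vertexEquiv_origin,
      H.vertexEquiv_origin, H'.vertexEquiv_origin, H'.vertexEquiv_origin]
  · rw [hd, hd']
    omega

end LabeledMap

namespace DelayedQuad

variable {g k : ℕ} {Q : DelayedQuad g k} {M M' : LabeledMap g k}

theorem IsPsi.of_iso (h : Q.IsPsi M) (hM : M ≈ M') : Q.IsPsi M' := by
  obtain ⟨θ, hσ, hα, hf, c, hc⟩ := h
  obtain ⟨ψ, hψσ, hψα, hψf, c', hc'⟩ := Setoid.symm hM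
  refine ⟨ψ.trans θ, fun e => ?_, fun e => ?_, fun e i => ?_, c - c', fun e => ?_⟩
  · rw [Equiv.trans_apply, Equiv.trans_apply, hψσ]
    exact hσ _
  · rw [Equiv.trans_apply, Equiv.trans_apply, hψα]
    exact hα _
  · rw [hψf, hf, Equiv.trans_apply]
  · have h1 := hc' e
    have h2 := hc (ψ e)
    rw [Equiv.trans_apply]
    omega

theorem IsPsi.unique (h : Q.IsPsi M) (h' : Q.IsPsi M') : M ≈ M' := by
  obtain ⟨θ, hσ, hα, hf, c, hc⟩ := h
  obtain ⟨θ', hσ', hα', hf', c', hc'⟩ := h'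
  refine ⟨θ.trans θ'.symm, fun e => ?_, fun e => ?_, fun e i => ?_, c' - c, fun e => ?_⟩
  · rw [Equiv.trans_apply, Equiv.trans_apply, Equiv.symm_apply_eq]
    have h1 := hσ' (θ'.symm (θ e))
    rw [Equiv.apply_symm_apply] at h1
    exact Subtype.ext ((hσ e).unique h1)
  · rw [Equiv.trans_apply, Equiv.trans_apply, Equiv.symm_apply_eq]
    have h1 := hα' (θ'.symm (θ e))
    rw [Equiv.apply_symm_apply] at h1
    exact Subtype.ext ((hα e).unique h1)
  · rw [hf, hf', Equiv.trans_apply, Equiv.apply_symm_apply]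
  · have h1 := hc' (θ'.symm (θ e))
    have h2 := hc e
    rw [Equiv.apply_symm_apply] at h1
    rw [Equiv.trans_apply]
    omega

/-! ### Counting -/

variable [NeZero k]

theorem IsPsi.two_mul_card_face (h : Q.IsPsi M) : 2 * Nat.card Q.q.Face = Nat.card Q.q.Edge ∧
    Nat.card Q.q.Face = Nat.card M.m.Edge := by
  obtain ⟨η, P, -⟩ := isPsi_iff.1 h
  have h1 := P.two_mul_card
  have h2 := Q.quad.card_eq
  have h3 := Q.q.card_eq_two_mul_card_edge
  have h4 := M.m.card_eq_two_mul_card_edge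
  omega

theorem IsPsi.card_vertex (h : Q.IsPsi M) : Nat.card Q.q.Vertex = Nat.card M.m.Vertex + k := by
  obtain ⟨η, P, -⟩ := isPsi_iff.1 h
  exact P.card_vertex

theorem IsPsi.ncard_tile (h : Q.IsPsi M) (i : Fin k) :
    (Q.tile i).ncard = M.m.faceDegree (M.f i) := by
  obtain ⟨η, P, hf, -⟩ := isPsi_iff.1 h
  have himg : Q.tile i = η '' {e | M.m.face e = M.f i} := by
    ext d
    constructor
    · intro hd
      obtain ⟨e, rfl⟩ := P.surj d hd.1
      exact ⟨e, (hf e i).2 hd, rfl⟩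
    · rintro ⟨e, he, rfl⟩
      exact (hf e i).1 he
  rw [himg, Set.ncard_image_of_injective _ P.inj]
  rfl

theorem IsPsi.ncard_tile_dist (h : Q.IsPsi M) (i : Fin k) (d : ℕ) :
    {e | e ∈ Q.tile i ∧ Q.q.dist (Q.q.origin e) (Q.x i) = d}.ncard =
      {e | M.m.face e = M.f i ∧ M.lab e - M.faceMin i + 1 = (d : ℤ)}.ncard := by
  obtain ⟨η, P, hf, c, hc⟩ := isPsi_iff.1 h
  have hiff : ∀ e, η e ∈ Q.tile i → (Q.q.dist (Q.q.origin (η e)) (Q.x i) = d ↔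
      M.lab e - M.faceMin i + 1 = (d : ℤ)) := fun e he => by
    have h1 := lab_eq_of_mem_tile he
    have h2 := P.faceMin_eq hf hc i
    have h3 := hc e
    omega
  have himg : {e | e ∈ Q.tile i ∧ Q.q.dist (Q.q.origin e) (Q.x i) = d} =
      η '' {e | M.m.face e = M.f i ∧ M.lab e - M.faceMin i + 1 = (d : ℤ)} := by
    ext x
    constructor
    · rintro ⟨hx, hxd⟩
      obtain ⟨e, rfl⟩ := P.surj x hx.1
      exact ⟨e, ⟨(hf e i).2 hx, (hiff e hx).1 hxd⟩, rfl⟩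
    · rintro ⟨e, ⟨he, hed⟩, rfl⟩
      have he' := (hf e i).1 he
      exact ⟨he', (hiff e he').2 hed⟩
  rw [himg, Set.ncard_image_of_injective _ P.inj]

end DelayedQuad

/-! ### The bijection -/

theorem mainTheorem2 (g k : ℕ) (hk : 1 ≤ k) :
    ∃ (Ψ : QuadSet g k → LabeledMapSet g k) (Φ : LabeledMapSet g k → QuadSet g k),
      -- `Ψ` and `Φ` are the maps given by the two constructions
      (∀ (Q : DelayedQuad g k) (M : LabeledMap g k),
        Ψ (Quotient.mk _ Q) = Quotient.mk _ M ↔ Q.IsPsi M) ∧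
      (∀ (M : LabeledMap g k) (Q : DelayedQuad g k),
        Φ (Quotient.mk _ M) = Quotient.mk _ Q ↔ M.IsPhi Q) ∧
      -- they are inverse of each other, hence bijections
      Function.LeftInverse Φ Ψ ∧ Function.RightInverse Φ Ψ ∧
      Function.Bijective Ψ ∧ Function.Bijective Φ ∧
      -- further properties
      ∀ (Q : DelayedQuad g k) (M : LabeledMap g k),
        Ψ (Quotient.mk _ Q) = Quotient.mk _ M →
          (2 * Nat.card Q.q.Face = Nat.card Q.q.Edge ∧
            Nat.card Q.q.Face = Nat.card M.m.Edge ∧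
            ∀ i, (Q.tile i).ncard = M.m.faceDegree (M.f i)) ∧
          Nat.card Q.q.Vertex = Nat.card M.m.Vertex + k ∧
          ∀ (i : Fin k) (d : ℕ), 1 ≤ d →
            {e | e ∈ Q.tile i ∧ Q.q.dist (Q.q.origin e) (Q.x i) = d}.ncard =
              {e | M.m.face e = M.f i ∧ M.lab e - M.faceMin i + 1 = (d : ℤ)}.ncard := by
  have : NeZero k := ⟨by omega⟩
  have hiff : ∀ (Q : DelayedQuad g k) (M : LabeledMap g k), Q.IsPsi M ↔ M.IsPhi Q := fun Q M =>
    ⟨DelayedQuad.isPhi_of_isPsi, LabeledMap.isPsi_of_isPhi⟩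
  choose ψ hψ using fun Q : DelayedQuad g k => Q.exists_isPsi
  -- Invariance under isomorphisms of `Q` is taken from `IsPhi`, and for `Φ` invariance under those
  -- of `M` is taken from `IsPsi`.
  let Ψ : QuadSet g k → LabeledMapSet g k := Quotient.lift (fun Q => Quotient.mk _ (ψ Q))
    fun Q Q' hQ => Quotient.sound
      (((hiff _ _).2 (((hiff _ _).1 (hψ Q)).of_iso hQ)).unique (hψ Q'))
  let Φ : LabeledMapSet g k → QuadSet g k := Quotient.lift (fun M => Quotient.mk _ M.phi)
    fun M M' hM => Quotient.sound
      (((hiff _ _).1 (((hiff _ _).2 M.isPhi_phi).of_iso hM)).unique M'.isPhi_phi)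
  have hΨ : ∀ (Q : DelayedQuad g k) (M : LabeledMap g k),
      Ψ (Quotient.mk _ Q) = Quotient.mk _ M ↔ Q.IsPsi M := fun Q M =>
    ⟨fun h => (hψ Q).of_iso (Quotient.exact h), fun h => Quotient.sound ((hψ Q).unique h)⟩
  have hΦ : ∀ (M : LabeledMap g k) (Q : DelayedQuad g k),
      Φ (Quotient.mk _ M) = Quotient.mk _ Q ↔ M.IsPhi Q := fun M Q =>
    ⟨fun h => M.isPhi_phi.of_iso (Quotient.exact h),
      fun h => Quotient.sound (M.isPhi_phi.unique h)⟩
  have hleft : Function.LeftInverse Φ Ψ := by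
    intro x
    induction x using Quotient.inductionOn with | _ Q
    exact (hΦ _ _).2 ((hiff _ _).1 (hψ Q))
  have hright : Function.RightInverse Φ Ψ := by
    intro x
    induction x using Quotient.inductionOn with | _ M
    exact (hΨ _ _).2 ((hiff _ _).2 M.isPhi_phi)
  refine ⟨Ψ, Φ, hΨ, hΦ, hleft, hright, ⟨hleft.injective, hright.surjective⟩,
    ⟨hright.injective, hleft.surjective⟩, fun Q M h => ?_⟩
  have hQM := (hΨ Q M).1 h
  exact ⟨⟨hQM.two_mul_card_face.1, hQM.two_mul_card_face.2, hQM.ncard_tile⟩, hQM.card_vertex,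
    fun i d _ => hQM.ncard_tile_dist i d⟩
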